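/- Let $F$ be a perfect field of characteristic $p>0$ with algebraic closure $\bar F$, and let $(L,[p])$ be a finite-dimensional restricted Lie algebra over $F$. For an $F$-space $X$ write $\bar X=\bar F\otimes_F X$. A *character* of $L$ is an $F$-linear map $c:L\to\bar F$; for $\alpha\in\operatorname{Aut}(\bar F/F)$ its conjugate is $c^\alpha=\alpha\circ c$. For an $\bar L$-module $M$ with representation $\rho$ put $\phi_x=\rho(x)^p-\rho(x^{[p]})$ for $x\in L$; $M$ *has character* $c$ if $\phi_x m=c(x)^p m$ for all $x\in L$, $m\in M$, and its component $M_c$ is the set of all $m\in M$ for which there is an $r$ with $(\phi_x-c(x)^p)^r m=0$ for all $x\in L$. The *cluster* $\mathrm{cl}(V)$ of an $L$-module $V$ is the set of characters of the composition factors of the $\bar L$-module $\bar V$. A *simple cluster* is a set of characters consisting of a single conjugacy class. The $c$-reduced enveloping algebra $u(\bar L,c)$ is the quotient of the universal enveloping algebra of $\bar L$ by the relations $x^p-x^{[p]}=c(x)^p$. Let $S$ be a $p$-subalgebra of $L$ (a Lie subalgebra closed under $[p]$); the same notions are used for $S$. Let $C$ be a simple cluster of $L$ that restricts simply to $S$,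 i.e. distinct members of $C$ have distinct restrictions to $S$. Let $W$ be a finite-dimensional $S$-module with $\mathrm{cl}(W)=C|_S=\{c|_S: c\in C\}$ that is amenable, i.e. for every $d\in\mathrm{cl}(W)$ the component $\bar W_d$ has character $d$. For $c\in C$ write $\bar W_c$ for $\bar W_{c|_S}$, and form the $\bar L$-module $$\bar V=\bigoplus_{c\in C}u(\bar L,c)\otimes_{u(\bar S,c|_S)}\bar W_c .$$ Then $\bar W=\bigoplus_{c\in C}\bar W_c$; write $w=\sum_c w_c$ for the decomposition of $w\in\bar W$. For $e_1,\dots,e_n\in L$ and $r\in\{0,\dots,p-1\}^n$ let $e(r)\otimes w=\sum_{c\in C}e_1^{r_1}\cdots e_n^{r_n}\otimes w_c\in\bar V$, where the product in the summand for $c$ is taken in $u(\bar L,c)$. There is an $F$-subspace $V$ of $\bar V$, closed under the action of $L$ and hence an $L$-module (the $C$-induced module $\mathrm{ind}^L_S(W,C)$), such that: 1. For every cobasis $e_1,\dots,e_n$ of $S$ in $L$ (a basis of a subspace complementary to $S$) and every $F$-basis $b^1,\dots,b^m$ of $W$, the elements $e(r)\otimes b^i$ with $r\in\{0,\dots,p-1\}^n$,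 $1\le i\le m$, form an $\bar F$-basis of $\bar V$. Let $\alpha\in\operatorname{Aut}(\bar F/F)$ act on $\bar V$ by acting on the coefficients with respect to this basis. Then $\alpha(e(r)\otimes w)=e(r)\otimes w^\alpha$ for all $w\in\bar W$, where $(\lambda\otimes w_0)^\alpha=\alpha(\lambda)\otimes w_0$ for $\lambda\in\bar F$, $w_0\in W$. Moreover $V$ is exactly the set of all elements of $\bar V$ that are invariant under all $\alpha$, and it is the $F$-span of the $e(r)\otimes b^i$. In particular, if $v\in\bar V$ is invariant, then $xv$ is invariant for all $x\in L$. 2. The natural map $\bar F\otimes_F V\to\bar V$ is an isomorphism. 3. $\mathrm{cl}(V)=C$. -/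

import Mathlib

open scoped TensorProduct DirectSum

section PMap

/-- `adCoeff a b n k` is the coefficient of `X ^ k` in `ad (a X + b) ^ n (a)`, computed in
`L[X] = L ⊗ F[X]`. -/
def adCoeff {L : Type*} [LieRing L] (a b : L) : ℕ → ℕ → L
  | 0, 0 => a
  | 0, _ + 1 => 0
  | n + 1, 0 => ⁅b, adCoeff a b n 0⁆
  | n + 1, k + 1 => ⁅b, adCoeff a b n (k + 1)⁆ + ⁅a, adCoeff a b n k⁆

/-- Jacobson's Lie polynomials `s_i(a, b)`, determined for `1 ≤ i ≤ p - 1` by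
`ad (a X + b) ^ (p - 1) (a) = ∑ i s_i(a, b) X ^ (i - 1)`. -/
def jacobsonS (F : Type*) {L : Type*} [Field F] [LieRing L] [LieAlgebra F L]
    (p i : ℕ) (a b : L) : L :=
  (i : F)⁻¹ • adCoeff a b (p - 1) (i - 1)

/-- A `p`-operation on a Lie algebra `L` over a field `F` (of characteristic `p`): the pair
of `L` and such an operation is a restricted Lie algebra. -/
structure PMap (p : ℕ) (F L : Type*) [Field F] [LieRing L] [LieAlgebra F L] where
  /-- the map `x ↦ x^[p]` -/
  toFun : L → L
  ad_toFun : ∀ x : L, LieAlgebra.ad F L (toFun x) = LieAlgebra.ad F L x ^ p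
  smul : ∀ (t : F) (x : L), toFun (t • x) = t ^ p • toFun x
  add : ∀ x y : L, toFun (x + y) =
    toFun x + toFun y + ∑ i ∈ Finset.Icc 1 (p - 1), jacobsonS F p i x y

variable {p : ℕ} {F L : Type*} [Field F] [LieRing L] [LieAlgebra F L]

theorem adCoeff_coe (S : LieSubalgebra F L) (a b : S) (n k : ℕ) :
    ((adCoeff a b n k : S) : L) = adCoeff (a : L) (b : L) n k := by
  induction n generalizing k with
  | zero => cases k <;> simp [adCoeff]
  | succ n ih => cases k <;> simp [adCoeff, ih]

/-- The `p`-operation induced on a `p`-subalgebra `S`, that is, a Lie subalgebra closed under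
the `p`-operation of `L`. -/
def PMap.restrict (P : PMap p F L) (S : LieSubalgebra F L) (hS : ∀ s ∈ S, P.toFun s ∈ S) :
    PMap p F S where
  toFun s := ⟨P.toFun s, hS s s.2⟩
  ad_toFun s := by
    have key : ∀ (n : ℕ) (y : S), (((LieAlgebra.ad F S s ^ n) y : S) : L)
        = (LieAlgebra.ad F L (s : L) ^ n) (y : L) := by
      intro n
      induction n with
      | zero => intro y; simp
      | succ n ih => intro y; simp [pow_succ, ih]
    ext y
    rw [key, ← P.ad_toFun]
    simp
  smul t s := Subtype.ext (by simp [P.smul])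
  add a b := Subtype.ext (by simp [P.add, jacobsonS, adCoeff_coe])

end PMap

section Characters

variable {p : ℕ} {F L : Type*} [Field F] [LieRing L] [LieAlgebra F L] (P : PMap p F L)
variable (K : Type*) [Field K] [Algebra F K]

/-- The operator `φ_x = ρ(x)^p - ρ(x^[p])`, for `x ∈ L`, on a module `M` over `K ⊗ L`. -/
noncomputable def phi (M : Type*) [AddCommGroup M] [Module K M] [LieRingModule (K ⊗[F] L) M]
    [LieModule K (K ⊗[F] L) M] (x : L) : Module.End K M :=
  LieModule.toEnd K (K ⊗[F] L) M ((1 : K) ⊗ₜ[F] x) ^ p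
    - LieModule.toEnd K (K ⊗[F] L) M ((1 : K) ⊗ₜ[F] P.toFun x)

variable {K} in
/-- The module `M` over `K ⊗ L` has character `c`, where `c : L → K` is an `F`-linear map. -/
def HasCharacter (c : L →ₗ[F] K) (M : Type*) [AddCommGroup M] [Module K M]
    [LieRingModule (K ⊗[F] L) M] [LieModule K (K ⊗[F] L) M] : Prop :=
  ∀ (x : L) (m : M), phi P K M x m = c x ^ p • m

/-- The cluster of an `L`-module `V`: the set of the characters of the composition factors
(irreducible subquotients `B / A`) of the `K ⊗ L`-module `K ⊗ V`. Here `K` is an algebraic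
closure of `F`. -/
def cluster (V : Type*) [AddCommGroup V] [Module F V] [LieRingModule L V] [LieModule F L V] :
    Set (L →ₗ[F] K) :=
  {c | ∃ A B : LieSubmodule K (K ⊗[F] L) (K ⊗[F] V), A ≤ B ∧
    LieModule.IsIrreducible K (K ⊗[F] L) (B ⧸ A.comap B.incl) ∧
    HasCharacter P c (B ⧸ A.comap B.incl)}

variable {K} in
/-- The conjugate `c^α` of a character `c`. -/
def conjChar (α : K ≃ₐ[F] K) (c : L →ₗ[F] K) : L →ₗ[F] K := α.toLinearMap ∘ₗ c

variable {K} in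
/-- A simple cluster of `L`: a set of characters which consists of a single conjugacy class. -/
def IsSimpleCluster (C : Set (L →ₗ[F] K)) : Prop :=
  ∃ c : L →ₗ[F] K, C = Set.range fun α : K ≃ₐ[F] K => conjChar α c

variable {K} in
/-- The restriction to a subalgebra `S` of a character of `L`. -/
def resChar (S : LieSubalgebra F L) (c : L →ₗ[F] K) : S →ₗ[F] K := c ∘ₗ S.toSubmodule.subtype

variable {K} in
/-- `C` restricts simply to `S`: distinct members of `C` have distinct restrictions. -/
def RestrictsSimply (S : LieSubalgebra F L) (C : Set (L →ₗ[F] K)) : Prop :=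
  Set.InjOn (resChar S) C

section

attribute [local instance 100] LieRing.ofAssociativeRing

theorem phi_lie [Fact p.Prime] [CharP F p] {M : Type*} [AddCommGroup M] [Module K M]
    [LieRingModule (K ⊗[F] L) M] [LieModule K (K ⊗[F] L) M] (x : L) (y : K ⊗[F] L) (m : M) :
    phi P K M x ⁅y, m⁆ = ⁅y, phi P K M x m⁆ := by
  rcases subsingleton_or_nontrivial M with hM | hM
  · exact Subsingleton.elim _ _
  have hK : CharP K p := charP_of_injective_algebraMap (algebraMap F K).injective p
  have hE : CharP (Module.End K (Module.End K M)) p :=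
    charP_of_injective_algebraMap (algebraMap K (Module.End K (Module.End K M))).injective p
  set ρ := LieModule.toEnd K (K ⊗[F] L) M with hρ
  have h1 : ∀ (n : ℕ) (z : K ⊗[F] L), (LieAlgebra.ad K (Module.End K M) (ρ (1 ⊗ₜ x)) ^ n) (ρ z)
      = ρ ((LieAlgebra.ad K (K ⊗[F] L) (1 ⊗ₜ x) ^ n) z) := by
    intro n
    induction n with
    | zero => intro z; simp
    | succ n ih =>
      intro z
      rw [pow_succ, pow_succ, Module.End.mul_apply, Module.End.mul_apply, LieAlgebra.ad_apply,
        LieAlgebra.ad_apply, ← LieHom.map_lie, ih]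
  have h2 : (LieAlgebra.ad K (K ⊗[F] L) (1 ⊗ₜ x) ^ p) y = ⁅(1 : K) ⊗ₜ[F] P.toFun x, y⁆ := by
    have h3 : ∀ (n : ℕ) (t : K) (z : L), (LieAlgebra.ad K (K ⊗[F] L) (1 ⊗ₜ x) ^ n) (t ⊗ₜ z)
        = t ⊗ₜ ((LieAlgebra.ad F L x ^ n) z) := by
      intro n
      induction n with
      | zero => intro t z; simp
      | succ n ih => intro t z; simp [pow_succ, ih]
    induction y with
    | zero => simp
    | add a b ha hb => simp [ha, hb]
    | tmul t z => rw [h3, ← P.ad_toFun]; simp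
  have h4 : (LieAlgebra.ad K (Module.End K M) (ρ (1 ⊗ₜ x)) ^ p) (ρ y)
      = ρ (1 ⊗ₜ x) ^ p * ρ y - ρ y * ρ (1 ⊗ₜ x) ^ p := by
    rw [LieAlgebra.ad_eq_lmul_left_sub_lmul_right, Pi.sub_apply,
      sub_pow_char_of_commute _ (LinearMap.commute_mulLeft_right _ _),
      LinearMap.pow_mulLeft, LinearMap.pow_mulRight]
    simp
  have h5 : ρ (1 ⊗ₜ x) ^ p * ρ y - ρ y * ρ (1 ⊗ₜ x) ^ p
      = ρ (1 ⊗ₜ P.toFun x) * ρ y - ρ y * ρ (1 ⊗ₜ P.toFun x) := by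
    rw [← h4, h1, h2, LieHom.map_lie, LieRing.of_associative_ring_bracket]
  have h6 := congrArg (fun f : Module.End K M => f m) h5
  simp only [LinearMap.sub_apply, Module.End.mul_apply] at h6
  have h7 : ∀ m : M, ρ y m = ⁅y, m⁆ := fun _ => rfl
  simp only [h7] at h6
  simp only [phi, ← hρ, LinearMap.sub_apply, lie_sub]
  rw [sub_eq_sub_iff_add_eq_add] at h6 ⊢
  rw [h6]; abel

end

variable {K} in
/-- The component `M_c` of a module `M` over `K ⊗ L`: the set of all `m` annihilated by some power
`(φ_x - c(x)^p) ^ r`, for all `x ∈ L`. -/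
noncomputable def component [Fact p.Prime] [CharP F p] (c : L →ₗ[F] K) (M : Type*)
    [AddCommGroup M] [Module K M] [LieRingModule (K ⊗[F] L) M] [LieModule K (K ⊗[F] L) M] :
    LieSubmodule K (K ⊗[F] L) M where
  carrier := {m | ∃ r : ℕ, ∀ x : L,
    ((phi P K M x - algebraMap K (Module.End K M) (c x ^ p)) ^ r) m = 0}
  zero_mem' := ⟨0, fun x => by simp⟩
  add_mem' := by
    rintro a b ⟨r, hr⟩ ⟨s, hs⟩
    refine ⟨r + s, fun x => ?_⟩
    rw [map_add]
    nth_rewrite 1 [add_comm r s]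
    rw [pow_add, pow_add, Module.End.mul_apply, Module.End.mul_apply, hr, hs]
    simp
  smul_mem' := by
    rintro t a ⟨r, hr⟩
    exact ⟨r, fun x => by rw [map_smul, hr, smul_zero]⟩
  lie_mem := by
    rintro y a ⟨r, hr⟩
    refine ⟨r, fun x => ?_⟩
    have key : ∀ (n : ℕ) (m : M),
        ((phi P K M x - algebraMap K (Module.End K M) (c x ^ p)) ^ n) ⁅y, m⁆
        = ⁅y, ((phi P K M x - algebraMap K (Module.End K M) (c x ^ p)) ^ n) m⁆ := by
      intro n
      induction n with
      | zero => intro m; simp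
      | succ n ih =>
        intro m
        rw [pow_succ, Module.End.mul_apply, Module.End.mul_apply, ← ih]
        congr 1
        simp only [LinearMap.sub_apply, Module.algebraMap_end_apply, phi_lie, lie_sub, lie_smul]
    rw [key, hr, lie_zero]

/-- The `L`-module `W` is amenable: for each `c ∈ cl(W)`, the component of `K ⊗ W` for `c` has
character `c`. -/
def IsAmenable [Fact p.Prime] [CharP F p] (W : Type*) [AddCommGroup W] [Module F W]
    [LieRingModule L W] [LieModule F L W] : Prop :=
  ∀ c ∈ cluster P K W, HasCharacter P c (component P c (K ⊗[F] W))

end Characters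

section Reduced

variable {p : ℕ} {F L : Type*} [Field F] [LieRing L] [LieAlgebra F L] (P : PMap p F L)
variable {K : Type*} [Field K] [Algebra F K]

/-- The relations `x ^ p = x^[p] + c(x) ^ p` in the universal enveloping algebra of `K ⊗ L`.
Since `x ^ p - x^[p]` and `c(x) ^ p` are `p`-semilinear in `x`, the relations for `x ∈ L` imply those
for all `x ∈ K ⊗ L`. -/
inductive ReducedRel (c : L →ₗ[F] K) : UniversalEnvelopingAlgebra K (K ⊗[F] L) →
    UniversalEnvelopingAlgebra K (K ⊗[F] L) → Prop
  | rel (x : L) : ReducedRel c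
      (UniversalEnvelopingAlgebra.ι K ((1 : K) ⊗ₜ[F] x) ^ p)
      (UniversalEnvelopingAlgebra.ι K ((1 : K) ⊗ₜ[F] P.toFun x) + algebraMap K _ (c x ^ p))

/-- The `c`-reduced enveloping algebra `u(K ⊗ L, c)`. -/
def ReducedEnv (c : L →ₗ[F] K) : Type _ := RingQuot (ReducedRel P c)

noncomputable instance (c : L →ₗ[F] K) : Ring (ReducedEnv P c) :=
  inferInstanceAs (Ring (RingQuot (ReducedRel P c)))

noncomputable instance (c : L →ₗ[F] K) : Algebra K (ReducedEnv P c) :=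
  inferInstanceAs (Algebra K (RingQuot (ReducedRel P c)))

namespace ReducedEnv

attribute [local instance 100] LieRing.ofAssociativeRing

/-- The quotient map from the universal enveloping algebra. -/
noncomputable def mk (c : L →ₗ[F] K) :
    UniversalEnvelopingAlgebra K (K ⊗[F] L) →ₐ[K] ReducedEnv P c :=
  RingQuot.mkAlgHom K (ReducedRel P c)

/-- The canonical map `K ⊗ L → u(K ⊗ L, c)`. -/
noncomputable def ι (c : L →ₗ[F] K) : (K ⊗[F] L) →ₗ[K] ReducedEnv P c :=
  (mk P c).toLinearMap ∘ₗ
    (UniversalEnvelopingAlgebra.ι K : (K ⊗[F] L) →ₗ⁅K⁆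
      UniversalEnvelopingAlgebra K (K ⊗[F] L)).toLinearMap

theorem ι_apply (c : L →ₗ[F] K) (x : K ⊗[F] L) :
    ι P c x = mk P c (UniversalEnvelopingAlgebra.ι K x) := rfl

theorem ι_lie (c : L →ₗ[F] K) (x y : K ⊗[F] L) :
    ι P c ⁅x, y⁆ = ι P c x * ι P c y - ι P c y * ι P c x := by
  simp only [ι_apply, LieHom.map_lie, LieRing.of_associative_ring_bracket, map_sub, map_mul]

theorem ι_pow (c : L →ₗ[F] K) (x : L) :
    ι P c ((1 : K) ⊗ₜ[F] x) ^ p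
      = ι P c ((1 : K) ⊗ₜ[F] P.toFun x) + algebraMap K _ (c x ^ p) := by
  have h : mk P c (UniversalEnvelopingAlgebra.ι K ((1 : K) ⊗ₜ[F] x) ^ p) = _ :=
    RingQuot.mkAlgHom_rel K (ReducedRel.rel (P := P) (c := c) x)
  rw [map_pow] at h
  refine h.trans ?_
  exact ((mk P c).map_add _ _).trans (congrArg _ ((mk P c).commutes _))

variable {P}

/-- The universal property of `u(K ⊗ L, c)`. -/
noncomputable def lift {c : L →ₗ[F] K} {A : Type*} [Ring A] [Algebra K A]
    (f : (K ⊗[F] L) →ₗ⁅K⁆ A)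
    (hf : ∀ x : L, f ((1 : K) ⊗ₜ[F] x) ^ p
      = f ((1 : K) ⊗ₜ[F] P.toFun x) + algebraMap K A (c x ^ p)) :
    ReducedEnv P c →ₐ[K] A :=
  RingQuot.liftAlgHom K ⟨UniversalEnvelopingAlgebra.lift K f, by
    rintro _ _ ⟨x⟩
    simpa using hf x⟩

/-- The action of `u(K ⊗ L, c)` on a `K ⊗ L`-module with character `c`. -/
noncomputable def act {c : L →ₗ[F] K} {M : Type*} [AddCommGroup M] [Module K M]
    [LieRingModule (K ⊗[F] L) M] [LieModule K (K ⊗[F] L) M] (h : HasCharacter P c M) :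
    ReducedEnv P c →ₐ[K] Module.End K M :=
  lift (LieModule.toEnd K (K ⊗[F] L) M) fun x => by
    have h1 : phi P K M x = algebraMap K (Module.End K M) (c x ^ p) :=
      LinearMap.ext fun m => h x m
    rw [← h1, phi]
    abel

/-- The algebra homomorphism `u(K ⊗ S, c|S) → u(K ⊗ L, c)` induced by the inclusion of a
`p`-subalgebra `S` in `L`. -/
noncomputable def incl (S : LieSubalgebra F L) (hS : ∀ s ∈ S, P.toFun s ∈ S) (c : L →ₗ[F] K) :
    ReducedEnv (P.restrict S hS) (resChar S c) →ₐ[K] ReducedEnv P c :=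
  lift
    { ι P c ∘ₗ S.toSubmodule.subtype.baseChange K with
      map_lie' := by
        have key : ∀ x y : K ⊗[F] S, S.toSubmodule.subtype.baseChange K ⁅x, y⁆
            = (⁅S.toSubmodule.subtype.baseChange K x,
                S.toSubmodule.subtype.baseChange K y⁆ : K ⊗[F] L) :=
          fun x y => (LieAlgebra.ExtendScalars.map (AlgHom.id F K) S.incl).map_lie x y
        intro x y
        change ι P c (S.toSubmodule.subtype.baseChange K ⁅x, y⁆) = _
        rw [key, ι_lie, LieRing.of_associative_ring_bracket]
        rfl }
    fun x => ι_pow P c (x : L)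

end ReducedEnv

/-- The tensor product `B ⊗_A M`, where `j : A → B` is a homomorphism of (not necessarily
commutative) `K`-algebras and the left `A`-module `M` is given by a representation `ρ`. It is the
quotient of `B ⊗_K M` by all `b j(a) ⊗ m - b ⊗ a m`, a left `B`-module. -/
abbrev BalancedTensor {A B M : Type*} [Ring A] [Algebra K A] [Ring B] [Algebra K B]
    [AddCommGroup M] [Module K M] (j : A →ₐ[K] B) (ρ : A →ₐ[K] Module.End K M) : Type _ :=
  (B ⊗[K] M) ⧸ Submodule.span B
    {t : B ⊗[K] M | ∃ (b : B) (a : A) (m : M), t = (b * j a) ⊗ₜ[K] m - b ⊗ₜ[K] (ρ a m)}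

variable (S : LieSubalgebra F L) (hS : ∀ s ∈ S, P.toFun s ∈ S) (c : L →ₗ[F] K)
  {M : Type*} [AddCommGroup M] [Module K M] [LieRingModule (K ⊗[F] S) M]
  [LieModule K (K ⊗[F] S) M] (h : HasCharacter (P.restrict S hS) (resChar S c) M)

/-- The `c`-induced module `u(K ⊗ L, c) ⊗_{u(K ⊗ S, c|S)} M`, for a `K ⊗ S`-module `M` with
character `c|S`. -/
def CInd : Type _ := BalancedTensor (ReducedEnv.incl S hS c) (ReducedEnv.act h)

noncomputable instance : AddCommGroup (CInd P S hS c h) :=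
  inferInstanceAs (AddCommGroup (BalancedTensor _ _))

noncomputable instance : Module (ReducedEnv P c) (CInd P S hS c h) :=
  inferInstanceAs (Module (ReducedEnv P c) (BalancedTensor _ _))

noncomputable instance : Module K (CInd P S hS c h) :=
  inferInstanceAs (Module K (BalancedTensor _ _))

instance : IsScalarTower K (ReducedEnv P c) (CInd P S hS c h) :=
  inferInstanceAs (IsScalarTower K (ReducedEnv P c) (BalancedTensor _ _))

instance : SMulCommClass (ReducedEnv P c) K (CInd P S hS c h) :=
  ⟨fun a t m => by
    rw [← algebraMap_smul (ReducedEnv P c) t, ← algebraMap_smul (ReducedEnv P c) t, smul_smul,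
      smul_smul, Algebra.commutes]⟩

noncomputable instance : LieRingModule (K ⊗[F] L) (CInd P S hS c h) where
  bracket y m := ReducedEnv.ι P c y • m
  add_lie y z m := by simp [add_smul]
  lie_add y m n := by simp [smul_add]
  leibniz_lie y z m := by
    simp only [ReducedEnv.ι_lie, smul_smul, sub_smul]
    abel

instance : LieModule K (K ⊗[F] L) (CInd P S hS c h) where
  smul_lie t y m := by
    change ReducedEnv.ι P c (t • y) • m = t • (ReducedEnv.ι P c y • m)
    rw [map_smul, smul_assoc]
  lie_smul t y m := by
    change ReducedEnv.ι P c y • (t • m) = t • (ReducedEnv.ι P c y • m)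
    rw [smul_comm]

/-- The map `m ↦ u ⊗ m`. -/
noncomputable def CInd.tmul (a : ReducedEnv P c) : M →ₗ[K] CInd P S hS c h where
  toFun m := Submodule.Quotient.mk (a ⊗ₜ[K] m)
  map_add' m n := by rw [TensorProduct.tmul_add]; rfl
  map_smul' t m := by rw [TensorProduct.tmul_smul]; rfl

end Reduced

section CInduced

variable {p : ℕ} [Fact p.Prime] {F L : Type*} [Field F] [CharP F p] [LieRing L] [LieAlgebra F L]
  (P : PMap p F L) (S : LieSubalgebra F L) (hS : ∀ s ∈ S, P.toFun s ∈ S)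
  {K : Type*} [Field K] [Algebra F K] (C : Set (L →ₗ[F] K))
  (W : Type*) [AddCommGroup W] [Module F W] [LieRingModule S W] [LieModule F S W]

/-- The component of `K ⊗ W`, where `W` is an `S`-module, for the restriction to `S` of a character
`c` of `L`. -/
noncomputable abbrev wComp (c : L →ₗ[F] K) : LieSubmodule K (K ⊗[F] S) (K ⊗[F] W) :=
  component (P.restrict S hS) (resChar S c) (K ⊗[F] W)

variable {W C} in
theorem wComp_hasCharacter (hW : IsAmenable (P.restrict S hS) K W)
    (hC : cluster (P.restrict S hS) K W = resChar S '' C) (c : C) :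
    HasCharacter (P.restrict S hS) (resChar S c.1) (wComp P S hS W c.1) :=
  hW _ (hC ▸ ⟨c.1, c.2, rfl⟩)

variable (hW : IsAmenable (P.restrict S hS) K W)
  (hC : cluster (P.restrict S hS) K W = resChar S '' C)

/-- The direct sum over `c ∈ C` of the `c`-induced modules
`u(K ⊗ L, c) ⊗_{u(K ⊗ S, c)} (K ⊗ W)_c`. -/
def CIndSum : Type _ :=
  ⨁ c : C, CInd P S hS c.1 (wComp_hasCharacter P S hS hW hC c)

noncomputable instance : AddCommGroup (CIndSum P S hS C W hW hC) :=
  inferInstanceAs (AddCommGroup (⨁ c : C, CInd P S hS c.1 (wComp_hasCharacter P S hS hW hC c)))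

noncomputable instance : Module K (CIndSum P S hS C W hW hC) :=
  inferInstanceAs (Module K (⨁ c : C, CInd P S hS c.1 (wComp_hasCharacter P S hS hW hC c)))

noncomputable instance : LieRingModule (K ⊗[F] L) (CIndSum P S hS C W hW hC) :=
  inferInstanceAs (LieRingModule (K ⊗[F] L)
    (⨁ c : C, CInd P S hS c.1 (wComp_hasCharacter P S hS hW hC c)))

instance : LieModule K (K ⊗[F] L) (CIndSum P S hS C W hW hC) :=
  inferInstanceAs (LieModule K (K ⊗[F] L)
    (⨁ c : C, CInd P S hS c.1 (wComp_hasCharacter P S hS hW hC c)))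

/-- The `F`-space structure, by restriction of scalars. -/
noncomputable instance : Module F (CIndSum P S hS C W hW hC) :=
  Module.compHom _ (algebraMap F K)

instance : IsScalarTower F K (CIndSum P S hS C W hW hC) :=
  IsScalarTower.of_algebraMap_smul fun _ _ => rfl

/-- The action of `L` through `x ↦ 1 ⊗ x`. -/
noncomputable instance : LieRingModule L (CIndSum P S hS C W hW hC) where
  bracket y m := ⁅(1 : K) ⊗ₜ[F] y, m⁆
  add_lie y z m := by simp [TensorProduct.tmul_add]
  lie_add y m n := by simp
  leibniz_lie y z m := by
    rw [leibniz_lie, LieAlgebra.ExtendScalars.bracket_tmul, mul_one]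

instance : LieModule F L (CIndSum P S hS C W hW hC) where
  smul_lie t y m := by
    change ⁅(1 : K) ⊗ₜ[F] (t • y), m⁆ = t • ⁅(1 : K) ⊗ₜ[F] y, m⁆
    rw [TensorProduct.tmul_smul, ← algebraMap_smul K t ((1 : K) ⊗ₜ[F] y), smul_lie,
      algebraMap_smul]
  lie_smul t y m := by
    change ⁅(1 : K) ⊗ₜ[F] y, t • m⁆ = t • ⁅(1 : K) ⊗ₜ[F] y, m⁆
    rw [← algebraMap_smul K t m, lie_smul, algebraMap_smul]

variable {W C} in
/-- The element `∑ c, e(r) ⊗ w_c` for a family `(w_c)` with `w_c ∈ (K ⊗ W)_c`, where `e(r)` is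
the product `e_1 ^ r_1 ⋯ e_n ^ r_n` in `u(K ⊗ L, c)`. -/
noncomputable def monomialTmulFamily {n : ℕ} (e : Fin n → L) (r : Fin n → ℕ) :
    (⨁ c : C, wComp P S hS W c.1) →ₗ[K] CIndSum P S hS C W hW hC :=
  DirectSum.lmap fun c => CInd.tmul P S hS c.1 (wComp_hasCharacter P S hS hW hC c)
    (List.ofFn fun j => ReducedEnv.ι P c.1 ((1 : K) ⊗ₜ[F] e j) ^ r j).prod

open Classical in
/-- `K ⊗ W` is the internal direct sum of its components `(K ⊗ W)_c`, `c ∈ C`. -/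
def IsComponentSum : Prop :=
  DirectSum.IsInternal fun c : C => wComp P S hS W c.1

variable {W C} in
open Classical in
/-- The element `e(r) ⊗ w = ∑ c, e(r) ⊗ w_c`, where `w = ∑ c, w_c` is the decomposition of
`w ∈ K ⊗ W` into its components. -/
noncomputable def monomialTmul (hD : IsComponentSum P S hS C W)
    {n : ℕ} (e : Fin n → L) (r : Fin n → ℕ) (t : K ⊗[F] W) : CIndSum P S hS C W hW hC :=
  monomialTmulFamily P S hS hW hC e r
    ((AddEquiv.ofBijective (DirectSum.coeAddMonoidHom fun c : C => wComp P S hS W c.1) hD).symm t)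

/-- A cobasis of `S` in `L`: a basis of a subspace complementary to `S`. -/
def IsCobasis {n : ℕ} (e : Fin n → L) : Prop :=
  LinearIndependent F e ∧ IsCompl S.toSubmodule (Submodule.span F (Set.range e))

end CInduced

/-- The semilinear action of `α` on a space with `K`-basis `B`: it fixes the elements of `B` and
acts on the coefficients. -/
noncomputable def basisConj {F K V κ : Type*} [Field F] [Field K] [Algebra F K] [AddCommGroup V]
    [Module K V] [Fintype κ] (B : Module.Basis κ K V) (α : K ≃ₐ[F] K) (v : V) : V :=
  ∑ i, α (B.repr v i) • B i

/-!
Let `e_1, …, e_n` be a cobasis of `S` and `b¹, …, bᵐ` a basis of `W`. The elements `e(r) ⊗ bⁱ` are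
linearly independent over `K` by a Poincaré–Birkhoff–Witt theorem for reduced enveloping algebras,
which follows from Bergman's diamond lemma. The point is that their `F`-span is stable under `L`.
In the sum of the `u(L, c) ⊗ W_c`, the operator `x ^ p - x^[p]` sends `1 ⊗ t` to `1 ⊗ D_x t`, where
`D_x` acts on `W_c` by the scalar `c(x) ^ p`. Since `C` is closed under conjugation, `D_x` commutes
with the Galois action on `K ⊗ W`, and as `F` is perfect it therefore preserves `W`. So `e_i ^ p`
maps `1 ⊗ W` into `1 ⊗ W + L (1 ⊗ W)`, and straightening of products identifies the `F`-span of the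
`e(r) ⊗ bⁱ` with the `L`-module generated by `1 ⊗ W`. This is an `F`-form of the whole module, so by
Galois descent it consists of the invariant elements, and its cluster is that of the sum of the
modules `u(L, c) ⊗ W_c`, whose characters are the `c ∈ C`.
-/

/-! ### Jacobson's formula -/

section CharP

variable {p : ℕ} [hp : Fact p.Prime]

theorem natCast_choose_pred_prime (R : Type*) [Ring R] [CharP R p] {m : ℕ} (hm : m < p) :
    ((p - 1).choose m : R) = (-1) ^ m := by
  induction m with
  | zero => simp
  | succ m ih =>
    have pascal : p.choose (m + 1) = (p - 1).choose m + (p - 1).choose (m + 1) := by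
      rw [← Nat.choose_succ_succ', Nat.sub_add_cancel hp.out.one_le]
    have vanish : ((p.choose (m + 1) : ℕ) : R) = 0 :=
      (CharP.cast_eq_zero_iff R p _).2 (hp.out.dvd_choose_self m.succ_ne_zero hm)
    rw [pascal, Nat.cast_add, ih (by lia)] at vanish
    rw [pow_succ, mul_neg_one, neg_eq_of_add_eq_zero_right vanish]

theorem sub_pow_pred_char_of_commute {R : Type*} [Ring R] [CharP R p] {x y : R}
    (h : Commute x y) :
    (x - y) ^ (p - 1) = ∑ s ∈ Finset.range p, x ^ s * y ^ (p - 1 - s) := by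
  rw [sub_eq_add_neg, h.neg_right.add_pow, Nat.sub_add_cancel hp.out.one_le]
  refine Finset.sum_congr rfl fun s hs => ?_
  have hs : s < p := Finset.mem_range.1 hs
  have sign : (-1 : R) ^ (p - 1 - s) * (-1) ^ s = 1 := by
    rw [← pow_add, Nat.sub_add_cancel (by lia), ← natCast_choose_pred_prime R (p := p) (by lia),
      Nat.choose_self, Nat.cast_one]
  rw [natCast_choose_pred_prime R hs, neg_pow y, (((Commute.neg_one_left y).pow_pow _ _).eq),
    mul_assoc, mul_assoc, sign, mul_one]

section

attribute [local instance 100] LieRing.ofAssociativeRing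

theorem sum_pow_mul_mul_pow_eq_ad_pow (k : Type*) [CommRing k] {A : Type*} [Ring A] [Algebra k A]
    [CharP A p] (x y : A) :
    ∑ s ∈ Finset.range p, y ^ s * x * y ^ (p - 1 - s) = (LieAlgebra.ad k A y ^ (p - 1)) x := by
  have : CharP (Module.End k A) p :=
    charP_of_injective_ringHom (f := (Algebra.lmul k A).toRingHom) Algebra.lmul_injective p
  rw [LieAlgebra.ad_eq_lmul_left_sub_lmul_right, Pi.sub_apply,
    sub_pow_pred_char_of_commute (LinearMap.commute_mulLeft_right y y), LinearMap.sum_apply]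
  refine Finset.sum_congr rfl fun s _ => ?_
  simp [LinearMap.pow_mulLeft, LinearMap.pow_mulRight, mul_assoc]

end

end CharP

section Jacobson

open Polynomial

attribute [local instance 100] LieRing.ofAssociativeRing

variable {A : Type*} [Ring A]

theorem derivative_pow_eq_sum (f : A[X]) (n : ℕ) :
    derivative (f ^ n) = ∑ s ∈ Finset.range n, f ^ s * derivative f * f ^ (n - 1 - s) := by
  induction n with
  | zero => simp
  | succ n ih =>
    rw [pow_succ, derivative_mul, ih, Finset.sum_range_succ, Finset.sum_mul]
    congr 1
    · refine Finset.sum_congr rfl fun s hs => ?_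
      have := Finset.mem_range.1 hs
      rw [mul_assoc, ← pow_succ, show n - 1 - s + 1 = n + 1 - 1 - s by lia]
    · simp

theorem coeff_ad_pow_linear (a b : A) (n k : ℕ) :
    ((LieAlgebra.ad ℤ A[X] (C a * X + C b) ^ n) (C a)).coeff k = adCoeff a b n k := by
  induction n generalizing k with
  | zero => cases k <;> simp [adCoeff, coeff_C]
  | succ n ih =>
    rw [pow_succ', Module.End.mul_apply, LieAlgebra.ad_apply]
    set g := (LieAlgebra.ad ℤ A[X] (C a * X + C b) ^ n) (C a)
    have lie_eq : ⁅C a * X + C b, g⁆ = ⁅C b, g⁆ + ⁅C a, g⁆ * X := by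
      simp only [LieRing.of_associative_ring_bracket, add_mul, mul_add, sub_mul, mul_assoc, X_mul]
      abel
    have coeff_lie (d : A) (i : ℕ) : ⁅C d, g⁆.coeff i = ⁅d, g.coeff i⁆ := by
      simp [LieRing.of_associative_ring_bracket]
    cases k <;> simp [lie_eq, coeff_lie, adCoeff, ih]

theorem eval_one_add_linear_pow (a b : A) (n : ℕ) :
    (a + b) ^ n = ∑ i ∈ Finset.range (n + 1), ((C a * X + C b) ^ n).coeff i := by
  have hdeg : ((C a * X + C b) ^ n).natDegree < n + 1 :=
    Nat.lt_succ_of_le (by simpa using natDegree_pow_le_of_le n (natDegree_linear_le (a := a)))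
  have h : (eval₂RingHom' (RingHom.id A) 1 fun _ => Commute.one_right _) ((C a * X + C b) ^ n)
      = ∑ i ∈ Finset.range (n + 1), ((C a * X + C b) ^ n).coeff i := by
    change eval₂ _ _ _ = _
    rw [eval₂_eq_sum_range' _ hdeg]
    simp
  rw [← h, map_pow]
  change _ = eval₂ _ _ _ ^ n
  simp [eval₂_add, eval₂_mul_X]

theorem coeff_zero_linear_pow (a b : A) (n : ℕ) : ((C a * X + C b) ^ n).coeff 0 = b ^ n := by
  induction n with
  | zero => simp
  | succ n ih => rw [pow_succ, mul_coeff_zero, ih, pow_succ]; simp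

variable (k : Type*) [Field k] [Algebra k A] {p : ℕ} [hp : Fact p.Prime] [CharP k p]

theorem coeff_linear_pow_char (a b : A) {i : ℕ} (hi : i ∈ Finset.Icc 1 (p - 1)) :
    ((C a * X + C b) ^ p).coeff i = jacobsonS k p i a b := by
  rcases subsingleton_or_nontrivial A with _ | _
  · exact Subsingleton.elim _ _
  have : CharP A p := charP_of_injective_algebraMap (algebraMap k A).injective p
  rw [Finset.mem_Icc] at hi
  have hderiv : derivative ((C a * X + C b) ^ p)
      = (LieAlgebra.ad ℤ A[X] (C a * X + C b) ^ (p - 1)) (C a) := by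
    rw [derivative_pow_eq_sum, ← sum_pow_mul_mul_pow_eq_ad_pow]
    simp
  have hcoeff := congrArg (fun q => coeff q (i - 1)) hderiv
  rw [coeff_ad_pow_linear, coeff_derivative, Nat.sub_add_cancel hi.1] at hcoeff
  have hik : (i : k) ≠ 0 := by
    rw [Ne, CharP.cast_eq_zero_iff k p]
    exact Nat.not_dvd_of_pos_of_lt hi.1 (by lia)
  rw [jacobsonS, ← hcoeff, eq_inv_smul_iff₀ hik, Algebra.smul_def, map_natCast,
    ← Nat.cast_add_one, Nat.sub_add_cancel hi.1, Nat.cast_comm]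

theorem jacobson_formula (a b : A) :
    (a + b) ^ p = a ^ p + b ^ p + ∑ i ∈ Finset.Icc 1 (p - 1), jacobsonS k p i a b := by
  have hp1 := hp.out.one_le
  have htop : ((C a * X + C b) ^ p).coeff p = a ^ p := by
    simpa using coeff_pow_of_natDegree_le (m := p) (natDegree_linear_le (a := a) (b := b))
  have hrange : Finset.range (p + 1) = insert 0 (insert p (Finset.Icc 1 (p - 1))) := by
    ext i
    simp only [Finset.mem_range, Finset.mem_insert, Finset.mem_Icc]
    lia
  rw [eval_one_add_linear_pow, hrange,
    Finset.sum_insert (by simp; lia), Finset.sum_insert (by simp; lia), coeff_zero_linear_pow,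
    htop, Finset.sum_congr rfl fun i hi => coeff_linear_pow_char k a b hi]
  abel

end Jacobson

section Semilinear

variable {p : ℕ} [hp : Fact p.Prime] {F L : Type*} [Field F] [CharP F p] [LieRing L]
  [LieAlgebra F L] (P : PMap p F L) {K : Type*} [Field K] [Algebra F K]

attribute [local instance 100] LieRing.ofAssociativeRing

theorem map_adCoeff {L A : Type*} [LieRing L] [LieRing A] (f : L →+ A)
    (hf : ∀ x y, f ⁅x, y⁆ = ⁅f x, f y⁆) (a b : L) (n k : ℕ) :
    f (adCoeff a b n k) = adCoeff (f a) (f b) n k := by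
  induction n generalizing k with
  | zero => cases k <;> simp [adCoeff]
  | succ n ih => cases k <;> simp [adCoeff, ih, hf]

theorem PMap.pow_sub_add {A : Type*} [Ring A] [Algebra F A] (f : L →ₗ⁅F⁆ A) (x y : L) :
    f (x + y) ^ p - f (P.toFun (x + y))
      = (f x ^ p - f (P.toFun x)) + (f y ^ p - f (P.toFun y)) := by
  have map_jacobsonS (i : ℕ) : f (jacobsonS F p i x y) = jacobsonS F p i (f x) (f y) := by
    rw [jacobsonS, map_smul, jacobsonS]
    congr 1
    exact map_adCoeff f.toLinearMap.toAddMonoidHom f.map_lie x y _ _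
  rw [map_add, jacobson_formula F, P.add]
  simp only [map_add, map_sum, map_jacobsonS]
  abel

omit hp [CharP F p] in
theorem PMap.pow_sub_smul {A : Type*} [Ring A] [Algebra F A] (f : L →ₗ[F] A) (t : F) (x : L) :
    f (t • x) ^ p - f (P.toFun (t • x)) = t ^ p • (f x ^ p - f (P.toFun x)) := by
  rw [P.smul, map_smul, map_smul, smul_pow, smul_sub]

theorem PMap.pow_eq_of_basis {A : Type*} [Ring A] [Algebra K A] [Algebra F A] [IsScalarTower F K A]
    (c : L →ₗ[F] K) {κ : Type*} (y : Module.Basis κ F L) (f : L →ₗ⁅F⁆ A)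
    (h : ∀ i, f (y i) ^ p = f (P.toFun (y i)) + algebraMap K A (c (y i) ^ p)) (x : L) :
    f x ^ p = f (P.toFun x) + algebraMap K A (c x ^ p) := by
  have : CharP K p := charP_of_injective_algebraMap (algebraMap F K).injective p
  suffices f x ^ p - f (P.toFun x) = algebraMap K A (c x ^ p) by rw [← this]; abel
  induction y.mem_span x using Submodule.span_induction with
  | zero =>
    have toFun_zero : P.toFun 0 = 0 := by simpa [hp.out.ne_zero] using P.smul 0 0
    simp [toFun_zero, hp.out.ne_zero]
  | mem _ hx => obtain ⟨i, rfl⟩ := hx; rw [h]; abel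
  | add x y _ _ hx hy => rw [P.pow_sub_add f, hx, hy, map_add, add_pow_char, map_add]
  | smul t x _ hx =>
    refine (P.pow_sub_smul (f : L →ₗ[F] A) t x).trans ?_
    rw [map_smul, smul_pow, Algebra.algebraMap_eq_smul_one, smul_assoc,
      ← Algebra.algebraMap_eq_smul_one]
    exact congrArg _ hx

end Semilinear

/-! ### Reduction systems -/

section FreeWord

variable {k ι : Type*} [CommRing k]

/-- The product of the letters of the word `w` in the free algebra, which is the monomial
written `w` in the theory of reduction systems. -/
noncomputable def freeWord (k : Type*) {ι : Type*} [CommRing k] (w : List ι) : FreeAlgebra k ι :=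
  (w.map (FreeAlgebra.ι k)).prod

theorem freeWord_nil : freeWord k ([] : List ι) = 1 := by simp [freeWord]

theorem freeWord_singleton (a : ι) : freeWord k [a] = FreeAlgebra.ι k a := by simp [freeWord]

theorem freeWord_append (u v : List ι) : freeWord k (u ++ v) = freeWord k u * freeWord k v := by
  simp [freeWord]

theorem freeWord_replicate (n : ℕ) (a : ι) :
    freeWord k (List.replicate n a) = FreeAlgebra.ι k a ^ n := by simp [freeWord]

/-- The basis of the free algebra which consists of the words. -/
noncomputable def freeWordBasis (k ι : Type*) [CommRing k] :
    Module.Basis (List ι) k (FreeAlgebra k ι) :=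
  (FreeAlgebra.basisFreeMonoid k ι).reindex FreeMonoid.toList

theorem freeWordBasis_apply (w : List ι) : freeWordBasis k ι w = freeWord k w := by
  simp [freeWordBasis, FreeAlgebra.basisFreeMonoid, FreeAlgebra.equivMonoidAlgebraFreeMonoid,
    FreeMonoid.lift_apply, freeWord]

theorem coe_freeWordBasis : ⇑(freeWordBasis k ι) = freeWord k := funext freeWordBasis_apply

end FreeWord

theorem injective_of_basis_unitriangular {k ι M : Type*} [CommRing k] [AddCommGroup M]
    [Module k M] (b : Module.Basis ι k M) (lt : ι → ι → Prop) [IsStrictOrder ι lt] (T : M →ₗ[k] M)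
    (hT : ∀ i, T (b i) - b i ∈ Submodule.span k (b '' {j | lt j i})) : Function.Injective T := by
  rw [injective_iff_map_eq_zero]
  intro x hx
  have lower : T x - x ∈ Submodule.span k (b '' {i | ∃ j ∈ (b.repr x).support, lt i j}) := by
    have expand : T x - x = ∑ j ∈ (b.repr x).support, b.repr x j • (T (b j) - b j) := by
      conv_lhs => rw [← b.linearCombination_repr x]
      simp [Finsupp.linearCombination_apply, Finsupp.sum, smul_sub]
    rw [expand]
    refine Submodule.sum_smul_mem _ _ fun j hj => Submodule.span_mono (Set.image_mono ?_) (hT j)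
    exact fun i hi => ⟨j, hj, hi⟩
  rw [hx, zero_sub, neg_mem_iff, b.mem_span_image] at lower
  suffices (b.repr x).support = ∅ by simpa using this
  refine Finset.eq_empty_of_forall_notMem fun i hi => ?_
  refine (Finset.wellFoundedOn (r := Function.swap lt) _).induction (P := fun _ => False) hi
    fun i hi above => ?_
  obtain ⟨j, hj, hij⟩ := lower hi
  exact above j hj hij

/-- A reduction system on the free algebra, in the sense of Bergman's diamond lemma: the rules
`r ↦ f` replace a word `r` by a linear combination `f` of words which are smaller for a
well-founded order compatible with concatenation. -/
structure ReductionSystem (k ι : Type*) [CommRing k] where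
  /-- The order on words. -/
  lt : List ι → List ι → Prop
  isStrictOrder : IsStrictOrder (List ι) lt
  wf : WellFounded lt
  lt_append : ∀ u v {w w'}, lt w w' → lt (u ++ w ++ v) (u ++ w' ++ v)
  /-- The rules `r ↦ f`. -/
  Rule : List ι → FreeAlgebra k ι → Prop
  rule_mem : ∀ {r f}, Rule r f → f ∈ Submodule.span k (freeWord k '' {w | lt w r})

namespace ReductionSystem

variable {k ι : Type*} [CommRing k] (R : ReductionSystem k ι)

/-- A word is reducible if it has a subword to which a rule applies. -/
def IsReducible (w : List ι) : Prop := ∃ u r v f, R.Rule r f ∧ w = u ++ r ++ v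

/-- The span of the words below `w`. -/
def lowerSpan (w : List ι) : Submodule k (FreeAlgebra k ι) :=
  Submodule.span k (freeWord k '' {v | R.lt v w})

/-- The span of all `u (r - f) v`, where `r ↦ f` is a rule and `u r v` a word below `w`. Two
elements which are congruent modulo this space have the same reductions as soon as reduction is
confluent below `w`. -/
def lowerIdeal (w : List ι) : Submodule k (FreeAlgebra k ι) :=
  Submodule.span k {x | ∃ u r v f, R.Rule r f ∧ R.lt (u ++ r ++ v) w ∧
    x = freeWord k u * (freeWord k r - f) * freeWord k v}

/-- All overlap and inclusion ambiguities of the rules are resolvable relative to the order. -/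
structure IsResolvable : Prop where
  overlap : ∀ {A B C f g}, B ≠ [] → R.Rule (A ++ B) f → R.Rule (B ++ C) g →
    f * freeWord k C - freeWord k A * g ∈ R.lowerIdeal (A ++ B ++ C)
  inclusion : ∀ {A B C f g}, R.Rule (A ++ B ++ C) f → R.Rule B g →
    f - freeWord k A * g * freeWord k C ∈ R.lowerIdeal (A ++ B ++ C)

/-- The ideal generated by the relations `r - f` of the reduction system. -/
def relationIdeal : TwoSidedIdeal (FreeAlgebra k ι) :=
  TwoSidedIdeal.span {x | ∃ r f, R.Rule r f ∧ x = freeWord k r - f}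

/-- The `k`-algebra with generators `ι` and relations `r = f` for the rules `r ↦ f`. -/
def PresentedAlgebra : Type _ := R.relationIdeal.ringCon.Quotient

noncomputable instance : Ring R.PresentedAlgebra :=
  inferInstanceAs (Ring R.relationIdeal.ringCon.Quotient)

noncomputable instance : Algebra k R.PresentedAlgebra :=
  inferInstanceAs (Algebra k R.relationIdeal.ringCon.Quotient)

/-- The quotient map from the free algebra. -/
noncomputable def quotientMap : FreeAlgebra k ι →ₐ[k] R.PresentedAlgebra :=
  R.relationIdeal.ringCon.mkₐ k

variable {R}

theorem quotientMap_eq_zero {x : FreeAlgebra k ι} : R.quotientMap x = 0 ↔ x ∈ R.relationIdeal :=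
  SetLike.ext_iff.1 (TwoSidedIdeal.ker_ringCon_mk' R.relationIdeal) x

theorem mul_mem_lowerSpan {r : List ι} {f : FreeAlgebra k ι} (hf : f ∈ R.lowerSpan r)
    (u v : List ι) : freeWord k u * f * freeWord k v ∈ R.lowerSpan (u ++ r ++ v) := by
  suffices R.lowerSpan r ≤ (R.lowerSpan (u ++ r ++ v)).comap
      (LinearMap.mulLeftRight k (freeWord k u, freeWord k v)) from this hf
  refine Submodule.span_le.2 ?_
  rintro _ ⟨w, hw, rfl⟩
  exact Submodule.subset_span
    ⟨u ++ w ++ v, R.lt_append u v hw, by simp [freeWord_append, mul_assoc]⟩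

theorem mul_mem_lowerIdeal {w : List ι} {x : FreeAlgebra k ι} (hx : x ∈ R.lowerIdeal w)
    (u v : List ι) : freeWord k u * x * freeWord k v ∈ R.lowerIdeal (u ++ w ++ v) := by
  suffices R.lowerIdeal w ≤ (R.lowerIdeal (u ++ w ++ v)).comap
      (LinearMap.mulLeftRight k (freeWord k u, freeWord k v)) from this hx
  refine Submodule.span_le.2 ?_
  rintro _ ⟨u', r, v', f, hr, hlt, rfl⟩
  exact Submodule.subset_span ⟨u ++ u', r, v' ++ v, f, hr, by simpa using R.lt_append u v hlt,
    by simp [freeWord_append, mul_assoc]⟩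

theorem lowerSpan_mul_relation_mem {r w t : List ι} {f x : FreeAlgebra k ι} (hr : R.Rule r f)
    (hx : x ∈ R.lowerSpan w) :
    x * freeWord k t * (freeWord k r - f) ∈ R.lowerIdeal (w ++ t ++ r) := by
  suffices R.lowerSpan w ≤ (R.lowerIdeal (w ++ t ++ r)).comap
      (LinearMap.mulRight k (freeWord k t * (freeWord k r - f))) by
    simpa [mul_assoc] using this hx
  refine Submodule.span_le.2 ?_
  rintro _ ⟨s, hs, rfl⟩
  exact Submodule.subset_span ⟨s ++ t, r, [], f, hr, by simpa using R.lt_append [] (t ++ r) hs,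
    by simp [freeWord_append, freeWord_nil, mul_assoc]⟩

theorem relation_mul_lowerSpan_mem {r w t : List ι} {f x : FreeAlgebra k ι} (hr : R.Rule r f)
    (hx : x ∈ R.lowerSpan w) :
    (freeWord k r - f) * freeWord k t * x ∈ R.lowerIdeal (r ++ t ++ w) := by
  suffices R.lowerSpan w ≤ (R.lowerIdeal (r ++ t ++ w)).comap
      (LinearMap.mulLeft k ((freeWord k r - f) * freeWord k t)) from this hx
  refine Submodule.span_le.2 ?_
  rintro _ ⟨s, hs, rfl⟩
  exact Submodule.subset_span ⟨[], r, t ++ s, f, hr, by simpa using R.lt_append (r ++ t) [] hs,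
    by simp [freeWord_append, freeWord_nil]⟩

theorem disjoint_reductions_sub_mem {r r' t : List ι} {f f' : FreeAlgebra k ι} (hr : R.Rule r f)
    (hr' : R.Rule r' f') :
    f * freeWord k (t ++ r') - freeWord k (r ++ t) * f' ∈ R.lowerIdeal (r ++ t ++ r') := by
  convert sub_mem (lowerSpan_mul_relation_mem (t := t) hr' (R.rule_mem hr))
    (relation_mul_lowerSpan_mem (t := t) hr (R.rule_mem hr')) using 1
  simp only [freeWord_append]
  noncomm_ring

theorem IsResolvable.reductions_sub_mem_of_prefix (hR : R.IsResolvable) {r r' t v v' : List ι}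
    {f f' : FreeAlgebra k ι} (hr : R.Rule r f) (hr' : R.Rule r' f')
    (h : r ++ v = t ++ (r' ++ v')) :
    f * freeWord k v - freeWord k t * f' * freeWord k v' ∈ R.lowerIdeal (r ++ v) := by
  have disjoint (s : List ι) (ht : t = r ++ s) (hv : v = s ++ (r' ++ v')) :
      f * freeWord k v - freeWord k t * f' * freeWord k v' ∈ R.lowerIdeal (r ++ v) := by
    have := mul_mem_lowerIdeal (disjoint_reductions_sub_mem (t := s) hr hr') [] v'
    simpa [ht, hv, freeWord_append, freeWord_nil, sub_mul, mul_assoc] using this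
  rcases List.append_eq_append_iff.1 h with ⟨s, ht, hv⟩ | ⟨B, rfl, hB⟩
  · exact disjoint s ht hv
  rcases eq_or_ne B [] with rfl | hB0
  · exact disjoint [] (by simp) (by simpa using hB.symm)
  rcases List.append_eq_append_iff.1 hB with ⟨C, rfl, rfl⟩ | ⟨C, rfl, rfl⟩
  · have hr : R.Rule (t ++ r' ++ C) f := by rwa [List.append_assoc]
    have := mul_mem_lowerIdeal (hR.inclusion hr hr') [] v
    simpa [freeWord_append, freeWord_nil, sub_mul, mul_assoc] using this
  · have := mul_mem_lowerIdeal (hR.overlap hB0 hr hr') [] v'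
    simpa [freeWord_append, freeWord_nil, sub_mul, mul_assoc] using this

theorem IsResolvable.reductions_sub_mem (hR : R.IsResolvable) {u r v u' r' v' : List ι}
    {f f' : FreeAlgebra k ι} (hr : R.Rule r f) (hr' : R.Rule r' f')
    (h : u ++ r ++ v = u' ++ r' ++ v') :
    freeWord k u * f * freeWord k v - freeWord k u' * f' * freeWord k v'
      ∈ R.lowerIdeal (u ++ r ++ v) := by
  simp only [List.append_assoc] at h
  rcases List.append_eq_append_iff.1 h with ⟨t, rfl, ht⟩ | ⟨t, rfl, ht⟩
  · have := mul_mem_lowerIdeal (hR.reductions_sub_mem_of_prefix hr hr' ht) u []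
    simpa [freeWord_append, freeWord_nil, mul_sub, mul_assoc] using this
  · have := mul_mem_lowerIdeal (hR.reductions_sub_mem_of_prefix hr' hr ht) u' []
    rw [← neg_mem_iff]
    simpa [freeWord_append, freeWord_nil, mul_sub, mul_assoc, ht] using this

open Classical in
variable (R) in
/-- The linear map which replaces each reducible word `w = u r v` by one of the relations
`u (r - f) v`. -/
noncomputable def relationMap : FreeAlgebra k ι →ₗ[k] FreeAlgebra k ι :=
  (freeWordBasis k ι).constr k fun w =>
    if h : R.IsReducible w then
      freeWord k w - freeWord k h.choose * h.choose_spec.choose_spec.choose_spec.choose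
        * freeWord k h.choose_spec.choose_spec.choose
    else freeWord k w

theorem relationMap_of_not_isReducible {w : List ι} (hw : ¬ R.IsReducible w) :
    R.relationMap (freeWord k w) = freeWord k w := by
  rw [relationMap, ← freeWordBasis_apply, Module.Basis.constr_basis, dif_neg hw,
    freeWordBasis_apply]

theorem exists_relationMap_eq {w : List ι} (hw : R.IsReducible w) :
    ∃ u r v f, R.Rule r f ∧ w = u ++ r ++ v ∧
      R.relationMap (freeWord k w) = freeWord k w - freeWord k u * f * freeWord k v := by
  refine ⟨_, _, _, _, hw.choose_spec.choose_spec.choose_spec.choose_spec.1,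
    hw.choose_spec.choose_spec.choose_spec.choose_spec.2, ?_⟩
  rw [relationMap, ← freeWordBasis_apply, Module.Basis.constr_basis, dif_pos hw,
    freeWordBasis_apply]

variable (R) in
theorem relationMap_injective : Function.Injective R.relationMap := by
  have := R.isStrictOrder
  refine injective_of_basis_unitriangular (freeWordBasis k ι) R.lt _ fun w => ?_
  rw [freeWordBasis_apply, coe_freeWordBasis]
  by_cases hw : R.IsReducible w
  · obtain ⟨u, r, v, f, hr, rfl, hf⟩ := exists_relationMap_eq hw
    rw [hf, sub_sub_cancel_left, neg_mem_iff]
    exact mul_mem_lowerSpan (R.rule_mem hr) u v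
  · rw [relationMap_of_not_isReducible hw, sub_self]
    exact zero_mem _

theorem IsResolvable.relation_mem_map (hR : R.IsResolvable) {u r v : List ι}
    {f : FreeAlgebra k ι} (hr : R.Rule r f) :
    freeWord k u * (freeWord k r - f) * freeWord k v
      ∈ (Submodule.span k (freeWord k '' {w | R.IsReducible w})).map R.relationMap := by
  obtain ⟨w, hw⟩ : ∃ w, w = u ++ r ++ v := ⟨_, rfl⟩
  induction w using R.wf.induction generalizing u r v f with
  | _ w ih =>
  have lower : R.lowerIdeal w
      ≤ (Submodule.span k (freeWord k '' {w | R.IsReducible w})).map R.relationMap := by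
    refine Submodule.span_le.2 ?_
    rintro _ ⟨u', r', v', f', hr', hlt, rfl⟩
    exact ih _ hlt hr' rfl
  have hred : R.IsReducible w := ⟨u, r, v, f, hr, hw⟩
  obtain ⟨u', r', v', f', hr', hw', hf'⟩ := exists_relationMap_eq hred
  have hdiff := hR.reductions_sub_mem hr' hr (hw'.symm.trans hw)
  rw [← hw'] at hdiff
  convert add_mem (lower hdiff) (Submodule.mem_map_of_mem
    (Submodule.subset_span (Set.mem_image_of_mem (freeWord k) hred))) using 1
  rw [hf', hw]
  simp only [freeWord_append]
  noncomm_ring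

theorem IsResolvable.relationIdeal_le (hR : R.IsResolvable) {x : FreeAlgebra k ι}
    (hx : x ∈ R.relationIdeal) :
    x ∈ (Submodule.span k (freeWord k '' {w | R.IsReducible w})).map R.relationMap := by
  set N := (Submodule.span k (freeWord k '' {w | R.IsReducible w})).map R.relationMap
  rw [relationIdeal, TwoSidedIdeal.mem_span_iff_mem_addSubgroup_closure] at hx
  refine (AddSubgroup.closure_le N.toAddSubgroup).2 ?_ hx
  rintro _ ⟨_, ⟨a, -, _, ⟨r, f, hr, rfl⟩, rfl⟩, b, -, rfl⟩
  have span_words (c : FreeAlgebra k ι) : c ∈ Submodule.span k (Set.range (freeWord k)) := by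
    rw [← coe_freeWordBasis]
    exact (freeWordBasis k ι).mem_span c
  have left (v : List ι) : a * (freeWord k r - f) * freeWord k v ∈ N := by
    suffices Submodule.span k (Set.range (freeWord k))
        ≤ N.comap (LinearMap.mulRight k ((freeWord k r - f) * freeWord k v)) by
      simpa [mul_assoc] using this (span_words a)
    refine Submodule.span_le.2 ?_
    rintro _ ⟨u, rfl⟩
    change freeWord k u * ((freeWord k r - f) * freeWord k v) ∈ N
    rw [← mul_assoc]
    exact hR.relation_mem_map hr
  suffices Submodule.span k (Set.range (freeWord k))
      ≤ N.comap (LinearMap.mulLeft k (a * (freeWord k r - f))) from this (span_words b)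
  refine Submodule.span_le.2 ?_
  rintro _ ⟨v, rfl⟩
  exact left v

/-- **Bergman's diamond lemma**. -/
theorem IsResolvable.linearIndependent_irreducible (hR : R.IsResolvable) :
    LinearIndependent k fun w : {w // ¬ R.IsReducible w} => R.quotientMap (freeWord k w.1) := by
  have words := (freeWordBasis k ι).linearIndependent
  rw [coe_freeWordBasis] at words
  refine (words.comp _ Subtype.val_injective).map (f := R.quotientMap.toLinearMap)
    (Submodule.disjoint_def.2 fun x hx hx0 => ?_)
  obtain ⟨y, hy, hyx⟩ := hR.relationIdeal_le (quotientMap_eq_zero.1 hx0)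
  have hTx : R.relationMap x = x := by
    refine LinearMap.eqOn_span (f := R.relationMap) (g := LinearMap.id) ?_ hx
    rintro _ ⟨w, rfl⟩
    exact relationMap_of_not_isReducible w.2
  obtain rfl := R.relationMap_injective (hTx.trans hyx.symm)
  rw [Set.range_comp, Subtype.range_coe_subtype] at hx
  exact Submodule.disjoint_def.1
    (words.disjoint_span_image (s := {w | R.IsReducible w}) (t := {w | ¬ R.IsReducible w})
      (Set.disjoint_left.2 fun _ h h' => h' h)) x hy hx

end ReductionSystem

/-! ### The Poincaré–Birkhoff–Witt theorem for reduced enveloping algebras -/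

section PBW

theorem lex_append_of_length_eq {α : Type*} {r : α → α → Prop} {s t : List α}
    (h : List.Lex r s t) (hl : s.length = t.length) (v : List α) :
    List.Lex r (s ++ v) (t ++ v) := by
  induction h with
  | nil => simp at hl
  | cons _ ih => exact List.Lex.cons (ih (by simpa using hl))
  | rel h => exact List.Lex.rel h

theorem shortlex_append_append {α : Type*} {r : α → α → Prop} {s t : List α}
    (h : List.Shortlex r s t) (u v : List α) : List.Shortlex r (u ++ s ++ v) (u ++ t ++ v) := by
  rcases List.shortlex_def.1 h with h | ⟨hlen, hlex⟩
  · exact .of_length_lt (by simpa using h)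
  · refine .of_lex (by simpa using hlen) ?_
    rw [List.append_assoc, List.append_assoc]
    exact List.Lex.append_left r (lex_append_of_length_eq hlex hlen v) u

theorem isStrictOrder_shortlex (α : Type*) [LinearOrder α] :
    IsStrictOrder (List α) (List.Shortlex (· < ·)) where
  trans s t u hst htu := by
    rw [List.shortlex_def] at *
    rcases hst with hst | ⟨hst, hst'⟩ <;> rcases htu with htu | ⟨htu, htu'⟩
    · exact .inl (hst.trans htu)
    · exact .inl (htu ▸ hst)
    · exact .inl (hst ▸ htu)
    · exact .inr ⟨hst.trans htu, lt_trans (α := List α) hst' htu'⟩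
  irrefl s hs := by
    rcases List.shortlex_def.1 hs with h | ⟨-, h⟩
    · exact lt_irrefl _ h
    · exact lt_irrefl s h

namespace ReductionSystem

variable {k ι : Type*} [CommRing k] {R : ReductionSystem k ι}

variable (R) in
/-- The span of all `u (r - f) v`, where `r ↦ f` is a rule and the word `u r v` has length at most
`n`. -/
def lengthIdeal (n : ℕ) : Submodule k (FreeAlgebra k ι) :=
  Submodule.span k {x | ∃ u r v f, R.Rule r f ∧ (u ++ r ++ v).length ≤ n ∧
    x = freeWord k u * (freeWord k r - f) * freeWord k v}

theorem lengthIdeal_mono {m n : ℕ} (h : m ≤ n) : R.lengthIdeal m ≤ R.lengthIdeal n :=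
  Submodule.span_mono fun _ ⟨u, r, v, f, hr, hl, hx⟩ => ⟨u, r, v, f, hr, hl.trans h, hx⟩

theorem mul_mem_lengthIdeal {n : ℕ} {x : FreeAlgebra k ι} (hx : x ∈ R.lengthIdeal n)
    (s t : List ι) :
    freeWord k s * x * freeWord k t ∈ R.lengthIdeal (n + s.length + t.length) := by
  suffices R.lengthIdeal n ≤ (R.lengthIdeal (n + s.length + t.length)).comap
      (LinearMap.mulLeftRight k (freeWord k s, freeWord k t)) from this hx
  refine Submodule.span_le.2 ?_
  rintro _ ⟨u, r, v, f, hr, hl, rfl⟩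
  refine Submodule.subset_span ⟨s ++ u, r, v ++ t, f, hr, ?_, ?_⟩
  · simp only [List.length_append] at hl ⊢
    omega
  · simp [freeWord_append, mul_assoc]

end ReductionSystem

variable {p : ℕ} [hp : Fact p.Prime] {k g ι : Type*} [CommRing k] [LieRing g] [LieAlgebra k g]
  [LinearOrder ι]

/-- The linear map from a Lie algebra to the free algebra on a basis `y` which sends the elements
of `y` to the generators. -/
noncomputable def freeEmb (y : Module.Basis ι k g) : g →ₗ[k] FreeAlgebra k ι :=
  y.constr k (FreeAlgebra.ι k)

omit [LinearOrder ι] in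
theorem freeEmb_basis (y : Module.Basis ι k g) (a : ι) : freeEmb y (y a) = FreeAlgebra.ι k a := by
  simp [freeEmb]

/-- The rewriting rules of the algebra which is generated by an ordered basis `y` of a Lie algebra
with the commutation relations of the Lie algebra and the relations `(y i)^p = z i + γ i`. -/
inductive PBWRule (p : ℕ) (y : Module.Basis ι k g) (z : ι → g) (γ : ι → k) :
    List ι → FreeAlgebra k ι → Prop
  | comm (a b : ι) (h : b < a) : PBWRule p y z γ [a, b]
      (FreeAlgebra.ι k b * FreeAlgebra.ι k a + freeEmb y ⁅y a, y b⁆)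
  | pow (a : ι) : PBWRule p y z γ (List.replicate p a)
      (freeEmb y (z a) + algebraMap k _ (γ a))

omit [LinearOrder ι] in
theorem freeEmb_mem_span_singleton (y : Module.Basis ι k g) (x : g) :
    freeEmb y x ∈ Submodule.span k (Set.range fun a => freeWord k [a]) := by
  suffices Submodule.span k (Set.range y)
      ≤ (Submodule.span k (Set.range fun a => freeWord k [a])).comap (freeEmb y) from
    this (y.mem_span x)
  refine Submodule.span_le.2 ?_
  rintro _ ⟨a, rfl⟩
  exact Submodule.subset_span ⟨a, by simp [freeEmb_basis, freeWord_singleton]⟩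

theorem PBWRule.mem_span {y : Module.Basis ι k g} {z : ι → g} {γ : ι → k} {r : List ι}
    {f : FreeAlgebra k ι} (hr : PBWRule p y z γ r f) :
    f ∈ Submodule.span k (freeWord k '' {w | List.Shortlex (· < ·) w r}) := by
  have emb_mem {w : List ι} (hw : 1 < w.length) (x : g) :
      freeEmb y x ∈ Submodule.span k (freeWord k '' {v | List.Shortlex (· < ·) v w}) := by
    refine Submodule.span_mono ?_ (freeEmb_mem_span_singleton y x)
    rintro _ ⟨a, rfl⟩
    exact ⟨[a], .of_length_lt hw, rfl⟩
  rcases hr with ⟨a, b, h⟩ | ⟨a⟩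
  · refine add_mem (Submodule.subset_span ⟨[b, a], .of_lex rfl (.rel h), ?_⟩) (emb_mem (by simp) _)
    simp [freeWord]
  · refine add_mem (emb_mem (by simpa using hp.out.one_lt) _) ?_
    rw [Algebra.algebraMap_eq_smul_one, ← freeWord_nil]
    exact Submodule.smul_mem _ _
      (Submodule.subset_span ⟨[], .of_length_lt (by simpa using hp.out.pos), rfl⟩)

/-- The reduction system of the rules `PBWRule`, for the length-lexicographic order. -/
def pbwSystem (p : ℕ) [Fact p.Prime] [WellFoundedLT ι] (y : Module.Basis ι k g) (z : ι → g)
    (γ : ι → k) : ReductionSystem k ι where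
  lt := List.Shortlex (· < ·)
  isStrictOrder := isStrictOrder_shortlex ι
  wf := List.Shortlex.wf wellFounded_lt
  lt_append u v _ _ h := shortlex_append_append h u v
  Rule := PBWRule p y z γ
  rule_mem := PBWRule.mem_span

variable [WellFoundedLT ι] (y : Module.Basis ι k g) (z : ι → g) (γ : ι → k)

variable {y z γ} in
theorem lengthIdeal_le_lowerIdeal {n : ℕ} {w : List ι} (h : n < w.length) :
    (pbwSystem p y z γ).lengthIdeal n ≤ (pbwSystem p y z γ).lowerIdeal w :=
  Submodule.span_mono fun _ ⟨u, r, v, f, hr, hl, hx⟩ =>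
    ⟨u, r, v, f, hr, .of_length_lt (hl.trans_lt h), hx⟩

/-- The element `[a, b] - ⁅y a, y b⁆` of the free algebra. -/
noncomputable def commRelation (y : Module.Basis ι k g) (a b : ι) : FreeAlgebra k ι :=
  FreeAlgebra.ι k a * FreeAlgebra.ι k b - FreeAlgebra.ι k b * FreeAlgebra.ι k a
    - freeEmb y ⁅y a, y b⁆

omit [LinearOrder ι] [WellFoundedLT ι] in
theorem commRelation_swap (a b : ι) : commRelation y a b = -commRelation y b a := by
  rw [commRelation, commRelation, ← lie_skew (y a), map_neg]
  abel

omit [LinearOrder ι] [WellFoundedLT ι] in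
theorem commRelation_self (a : ι) : commRelation y a a = 0 := by
  simp [commRelation]

omit hp [WellFoundedLT ι] in
theorem commRelation_of_lt {a b : ι} (h : b < a) :
    ∃ f, PBWRule p y z γ [a, b] f ∧ commRelation y a b = freeWord k [a, b] - f :=
  ⟨_, .comm a b h, by simp [commRelation, freeWord, sub_sub]⟩

theorem mul_commRelation_mul_mem_lowerIdeal {u v w : List ι} {a b : ι}
    (hab : List.Shortlex (· < ·) (u ++ [a, b] ++ v) w)
    (hba : List.Shortlex (· < ·) (u ++ [b, a] ++ v) w) :
    freeWord k u * commRelation y a b * freeWord k v ∈ (pbwSystem p y z γ).lowerIdeal w := by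
  rcases lt_trichotomy a b with h | rfl | h
  · obtain ⟨f, hr, hf⟩ := commRelation_of_lt (p := p) y z γ h
    rw [commRelation_swap, mul_neg, neg_mul, neg_mem_iff, hf]
    exact Submodule.subset_span ⟨u, [b, a], v, f, hr, hba, rfl⟩
  · simp [commRelation_self]
  · obtain ⟨f, hr, hf⟩ := commRelation_of_lt (p := p) y z γ h
    rw [hf]
    exact Submodule.subset_span ⟨u, [a, b], v, f, hr, hab, rfl⟩

theorem commRelation_mem_lengthIdeal (a b : ι) :
    commRelation y a b ∈ (pbwSystem p y z γ).lengthIdeal 2 := by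
  have ordered {a b : ι} (h : b < a) :
      commRelation y a b ∈ (pbwSystem p y z γ).lengthIdeal 2 := by
    obtain ⟨f, hr, hf⟩ := commRelation_of_lt (p := p) y z γ h
    exact Submodule.subset_span ⟨[], [a, b], [], f, hr, by simp, by simp [hf, freeWord_nil]⟩
  rcases lt_trichotomy a b with h | rfl | h
  · rw [commRelation_swap, neg_mem_iff]
    exact ordered h
  · simp [commRelation_self]
  · exact ordered h

theorem freeEmb_comm_mem_lengthIdeal (x x' : g) :
    freeEmb y x * freeEmb y x' - freeEmb y x' * freeEmb y x - freeEmb y ⁅x, x'⁆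
      ∈ (pbwSystem p y z γ).lengthIdeal 2 := by
  let B : g →ₗ[k] g →ₗ[k] FreeAlgebra k ι :=
    (LinearMap.mul k _).compl₁₂ (freeEmb y) (freeEmb y)
      - ((LinearMap.mul k _).compl₁₂ (freeEmb y) (freeEmb y)).flip
      - (LieModule.toEnd k g g : g →ₗ[k] Module.End k g).compr₂ (freeEmb y)
  change B x x' ∈ _
  refine LinearMap.BilinMap.apply_apply_mem_of_mem_span _ (Set.range y) (Set.range y) B ?_ x x'
    (y.mem_span x) (y.mem_span x')
  rintro _ ⟨a, rfl⟩ _ ⟨b, rfl⟩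
  simpa [B, commRelation, freeEmb_basis] using commRelation_mem_lengthIdeal y z γ a b

attribute [local instance 100] LieRing.ofAssociativeRing

/-- The rule `y b ^ p ↦ z b + γ b` as a relation. -/
noncomputable def powRelation (p : ℕ) (y : Module.Basis ι k g) (z : ι → g) (γ : ι → k) (b : ι) :
    FreeAlgebra k ι :=
  FreeAlgebra.ι k b ^ p - (freeEmb y (z b) + algebraMap k _ (γ b))

theorem ad_pow_freeEmb_mem_lengthIdeal (b : ι) (x : g) (n : ℕ) :
    (LieAlgebra.ad k (FreeAlgebra k ι) (FreeAlgebra.ι k b) ^ n) (freeEmb y x)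
      - freeEmb y ((LieAlgebra.ad k g (y b) ^ n) x)
      ∈ (pbwSystem p y z γ).lengthIdeal (n + 1) := by
  induction n with
  | zero => simp
  | succ n ih =>
    rw [pow_succ', pow_succ', Module.End.mul_apply, Module.End.mul_apply, LieAlgebra.ad_apply,
      LieAlgebra.ad_apply, LieRing.of_associative_ring_bracket]
    have left := ReductionSystem.mul_mem_lengthIdeal ih [b] []
    have right := ReductionSystem.mul_mem_lengthIdeal ih [] [b]
    have comm := ReductionSystem.lengthIdeal_mono (by omega : 2 ≤ n + 1 + 1)
      (freeEmb_comm_mem_lengthIdeal (p := p) y z γ (y b) ((LieAlgebra.ad k g (y b) ^ n) x))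
    simp only [List.length_nil, List.length_singleton, add_zero] at left right
    convert add_mem (sub_mem left right) comm using 1
    simp only [freeWord_singleton, freeWord_nil, one_mul, mul_one, freeEmb_basis]
    noncomm_ring

theorem sum_pow_mul_comm_mul_pow {A : Type*} [Ring A] (x y e : A) (n : ℕ) :
    ∑ s ∈ Finset.range n, y ^ s * (x * y - y * x - e) * y ^ (n - 1 - s)
      = x * y ^ n - y ^ n * x - ∑ s ∈ Finset.range n, y ^ s * e * y ^ (n - 1 - s) := by
  have telescope := Finset.sum_range_sub' (fun s => y ^ s * x * y ^ (n - s)) n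
  simp only [pow_zero, one_mul, Nat.sub_zero, Nat.sub_self, mul_one] at telescope
  rw [← telescope, ← Finset.sum_sub_distrib]
  refine Finset.sum_congr rfl fun s hs => ?_
  have hs := Finset.mem_range.1 hs
  rw [show n - s = n - 1 - s + 1 by omega, show n - (s + 1) = n - 1 - s by omega,
    pow_succ' _ (n - 1 - s), pow_succ _ s]
  noncomm_ring

omit [LinearOrder ι] [WellFoundedLT ι] in
variable {y z} in
theorem ad_pow_pred_lie (hz : ∀ i x, ⁅z i, x⁆ = (LieAlgebra.ad k g (y i) ^ p) x) (b : ι) (x : g) :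
    (LieAlgebra.ad k g (y b) ^ (p - 1)) ⁅x, y b⁆ = -⁅z b, x⁆ := by
  rw [hz, ← lie_skew, map_neg, ← LieAlgebra.ad_apply k, ← Module.End.mul_apply, ← pow_succ,
    Nat.sub_add_cancel hp.out.pos]

variable {y z} [CharP k p]

theorem powRelation_comm_mem_lengthIdeal
    (hz : ∀ i x, ⁅z i, x⁆ = (LieAlgebra.ad k g (y i) ^ p) x) (a b : ι) :
    FreeAlgebra.ι k a * powRelation p y z γ b - powRelation p y z γ b * FreeAlgebra.ι k a
      - ∑ s ∈ Finset.range p,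
        FreeAlgebra.ι k b ^ s * commRelation y a b * FreeAlgebra.ι k b ^ (p - 1 - s)
      ∈ (pbwSystem p y z γ).lengthIdeal p := by
  have : CharP (FreeAlgebra k ι) p :=
    charP_of_injective_algebraMap (FreeAlgebra.algebraMap_leftInverse (R := k) (X := ι)).injective p
  have ad := ad_pow_freeEmb_mem_lengthIdeal (p := p) y z γ b ⁅y a, y b⁆ (p - 1)
  rw [← sum_pow_mul_mul_pow_eq_ad_pow, Nat.sub_add_cancel hp.out.pos, ad_pow_pred_lie hz] at ad
  have comm := ReductionSystem.lengthIdeal_mono hp.out.two_le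
    (freeEmb_comm_mem_lengthIdeal (p := p) y z γ (z b) (y a))
  convert add_mem ad comm using 1
  simp only [commRelation]
  rw [sum_pow_mul_comm_mul_pow, freeEmb_basis, powRelation, map_neg, mul_sub, mul_add, sub_mul,
    add_mul, Algebra.commutes]
  abel

theorem pbw_overlap_comm_pow (hz : ∀ i x, ⁅z i, x⁆ = (LieAlgebra.ad k g (y i) ^ p) x)
    {a b : ι} (hab : b < a) :
    (FreeAlgebra.ι k b * FreeAlgebra.ι k a + freeEmb y ⁅y a, y b⁆) * FreeAlgebra.ι k b ^ (p - 1)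
      - FreeAlgebra.ι k a * (freeEmb y (z b) + algebraMap k _ (γ b))
      ∈ (pbwSystem p y z γ).lowerIdeal (a :: List.replicate p b) := by
  have hpp : p - 1 + 1 = p := Nat.sub_add_cancel hp.out.pos
  have power := lengthIdeal_le_lowerIdeal (w := a :: List.replicate p b) (by simp)
    (powRelation_comm_mem_lengthIdeal γ hz a b)
  have pow_comm : powRelation p y z γ b * FreeAlgebra.ι k a
      ∈ (pbwSystem p y z γ).lowerIdeal (a :: List.replicate p b) := by
    refine Submodule.subset_span ⟨[], List.replicate p b, [a], _, .pow b, ?_, ?_⟩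
    · refine .of_lex (by simp) ?_
      rw [← hpp]
      exact .rel hab
    · simp [freeWord_nil, freeWord_replicate, freeWord_singleton, powRelation]
  have comm : ∑ s ∈ Finset.range (p - 1), FreeAlgebra.ι k b ^ (s + 1) * commRelation y a b
      * FreeAlgebra.ι k b ^ (p - 1 - (s + 1))
      ∈ (pbwSystem p y z γ).lowerIdeal (a :: List.replicate p b) := by
    refine sum_mem fun s hs => ?_
    have hs := Finset.mem_range.1 hs
    simp only [← freeWord_replicate]
    exact mul_commRelation_mul_mem_lowerIdeal y z γ (.of_lex (by simp; omega) (.rel hab))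
      (.of_lex (by simp; omega) (.rel hab))
  have split := Finset.sum_range_succ' (fun s => FreeAlgebra.ι k b ^ s * commRelation y a b
    * FreeAlgebra.ι k b ^ (p - 1 - s)) (p - 1)
  rw [hpp] at split
  rw [split] at power
  convert add_mem (add_mem power pow_comm) comm using 1
  have hX : FreeAlgebra.ι k a * FreeAlgebra.ι k b ^ p
      = FreeAlgebra.ι k a * FreeAlgebra.ι k b * FreeAlgebra.ι k b ^ (p - 1) := by
    rw [mul_assoc, ← pow_succ', hpp]
  simp only [pow_zero, one_mul, Nat.sub_zero, powRelation, commRelation, mul_sub, hX]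
  noncomm_ring

theorem pbw_overlap_pow_comm (hz : ∀ i x, ⁅z i, x⁆ = (LieAlgebra.ad k g (y i) ^ p) x)
    {a b : ι} (hab : b < a) :
    (freeEmb y (z a) + algebraMap k _ (γ a)) * FreeAlgebra.ι k b
      - FreeAlgebra.ι k a ^ (p - 1) *
        (FreeAlgebra.ι k b * FreeAlgebra.ι k a + freeEmb y ⁅y a, y b⁆)
      ∈ (pbwSystem p y z γ).lowerIdeal (List.replicate p a ++ [b]) := by
  have hpp : p - 1 + 1 = p := Nat.sub_add_cancel hp.out.pos
  have power := lengthIdeal_le_lowerIdeal (w := List.replicate p a ++ [b]) (by simp)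
    (powRelation_comm_mem_lengthIdeal γ hz b a)
  have comm_pow : FreeAlgebra.ι k b * powRelation p y z γ a
      ∈ (pbwSystem p y z γ).lowerIdeal (List.replicate p a ++ [b]) := by
    refine Submodule.subset_span ⟨[b], List.replicate p a, [], _, .pow a, ?_, ?_⟩
    · refine .of_lex (by simp) ?_
      rw [← hpp]
      exact .rel hab
    · simp [freeWord_nil, freeWord_replicate, freeWord_singleton, powRelation]
  have comm : ∑ s ∈ Finset.range (p - 1), FreeAlgebra.ι k a ^ s * commRelation y b a
      * FreeAlgebra.ι k a ^ (p - 1 - s)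
      ∈ (pbwSystem p y z γ).lowerIdeal (List.replicate p a ++ [b]) := by
    refine sum_mem fun s hs => ?_
    have hs := Finset.mem_range.1 hs
    have hw : List.replicate p a ++ [b]
        = List.replicate s a ++ (a :: a :: List.replicate (p - 2 - s) a ++ [b]) := by
      conv_lhs => rw [show p = s + (p - 2 - s + 1 + 1) by omega]
      simp [List.replicate_add, List.replicate_succ]
    have hv : List.replicate (p - 1 - s) a = a :: List.replicate (p - 2 - s) a := by
      rw [show p - 1 - s = p - 2 - s + 1 by omega, List.replicate_succ]
    simp only [← freeWord_replicate]
    rw [hw, hv]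
    refine mul_commRelation_mul_mem_lowerIdeal y z γ (.of_lex (by simp) ?_) (.of_lex (by simp) ?_)
    · rw [List.append_assoc]
      exact List.Lex.append_left _ (.rel hab) _
    · rw [List.append_assoc]
      exact List.Lex.append_left _ (.cons (.rel hab)) _
  have split := Finset.sum_range_succ (fun s => FreeAlgebra.ι k a ^ s * commRelation y b a
    * FreeAlgebra.ι k a ^ (p - 1 - s)) (p - 1)
  rw [hpp] at split
  rw [split] at power
  convert add_mem (sub_mem power comm_pow) comm using 1
  have hX : FreeAlgebra.ι k a ^ p * FreeAlgebra.ι k b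
      = FreeAlgebra.ι k a ^ (p - 1) * FreeAlgebra.ι k a * FreeAlgebra.ι k b := by
    rw [← pow_succ, hpp]
  rw [commRelation_swap]
  simp only [pow_zero, mul_one, Nat.sub_self, powRelation, commRelation, sub_mul, hX]
  noncomm_ring

omit [CharP k p] in
theorem freeEmb_pow_comm_mem_lengthIdeal {x : g} {a : ι} (hxa : ⁅x, y a⁆ = 0) (n : ℕ) :
    freeEmb y x * FreeAlgebra.ι k a ^ n - FreeAlgebra.ι k a ^ n * freeEmb y x
      ∈ (pbwSystem p y z γ).lengthIdeal (n + 1) := by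
  induction n with
  | zero => simp
  | succ n ih =>
    have left := ReductionSystem.mul_mem_lengthIdeal ih [] [a]
    have right := ReductionSystem.mul_mem_lengthIdeal
      (freeEmb_comm_mem_lengthIdeal (p := p) y z γ x (y a)) (List.replicate n a) []
    simp only [List.length_nil, List.length_singleton, add_zero, List.length_replicate]
      at left right
    rw [show 2 + n = n + 1 + 1 by omega] at right
    convert add_mem left right using 1
    simp only [freeWord_singleton, freeWord_nil, one_mul, mul_one, freeEmb_basis,
      freeWord_replicate, hxa, map_zero, pow_succ]
    noncomm_ring

omit [CharP k p] in
theorem pbw_overlap_pow_pow (hz : ∀ i x, ⁅z i, x⁆ = (LieAlgebra.ad k g (y i) ^ p) x)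
    (a : ι) {s : ℕ} (hs : s < p) {w : List ι} (hw : p < w.length) :
    (freeEmb y (z a) + algebraMap k _ (γ a)) * FreeAlgebra.ι k a ^ s
      - FreeAlgebra.ι k a ^ s * (freeEmb y (z a) + algebraMap k _ (γ a))
      ∈ (pbwSystem p y z γ).lowerIdeal w := by
  have hza : ⁅z a, y a⁆ = 0 := by
    rw [hz, ← Nat.sub_add_cancel hp.out.pos, pow_succ, Module.End.mul_apply, LieAlgebra.ad_apply,
      lie_self, map_zero]
  convert lengthIdeal_le_lowerIdeal ((Nat.succ_le_of_lt hs).trans_lt hw)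
    (freeEmb_pow_comm_mem_lengthIdeal (p := p) (z := z) γ hza s) using 1
  rw [add_mul, mul_add, Algebra.commutes]
  abel

omit [CharP k p] in
variable (y z) in
theorem pbw_overlap_comm_comm {a b c : ι} (hab : b < a) (hbc : c < b) :
    (FreeAlgebra.ι k b * FreeAlgebra.ι k a + freeEmb y ⁅y a, y b⁆) * FreeAlgebra.ι k c
      - FreeAlgebra.ι k a * (FreeAlgebra.ι k c * FreeAlgebra.ι k b + freeEmb y ⁅y b, y c⁆)
      ∈ (pbwSystem p y z γ).lowerIdeal [a, b, c] := by
  have hac := hbc.trans hab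
  have lex {d e f : ι} (h : d < a) : List.Shortlex (· < ·) [d, e, f] [a, b, c] :=
    .of_lex rfl (.rel h)
  have lex' {e f : ι} (h : e < b) : List.Shortlex (· < ·) [a, e, f] [a, b, c] :=
    .of_lex rfl (.cons (.rel h))
  have bac := mul_commRelation_mul_mem_lowerIdeal (p := p) y z γ (u := [b]) (v := [])
    (w := [a, b, c]) (a := a) (b := c) (lex hab) (lex hab)
  have bca := mul_commRelation_mul_mem_lowerIdeal (p := p) y z γ (u := []) (v := [a])
    (w := [a, b, c]) (a := b) (b := c) (lex hab) (lex hac)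
  have acb := mul_commRelation_mul_mem_lowerIdeal (p := p) y z γ (u := []) (v := [b])
    (w := [a, b, c]) (a := a) (b := c) (lex' hbc) (lex hac)
  have cab := mul_commRelation_mul_mem_lowerIdeal (p := p) y z γ (u := [c]) (v := [])
    (w := [a, b, c]) (a := a) (b := b) (lex hac) (lex hac)
  have comm (x x' : g) := lengthIdeal_le_lowerIdeal (w := [a, b, c]) (by simp)
    (freeEmb_comm_mem_lengthIdeal (p := p) y z γ x x')
  have jacobi : freeEmb y ⁅⁅y a, y b⁆, y c⁆
      = -freeEmb y ⁅y b, ⁅y a, y c⁆⁆ - freeEmb y ⁅⁅y b, y c⁆, y a⁆ := by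
    rw [← map_neg, ← map_sub]
    congr 1
    rw [← lie_skew ⁅y b, y c⁆ (y a), leibniz_lie (y a) (y b) (y c)]
    abel
  convert add_mem (sub_mem (sub_mem (add_mem bac bca) acb) cab)
    (add_mem (add_mem (comm (y b) ⁅y a, y c⁆) (comm ⁅y b, y c⁆ (y a)))
      (comm ⁅y a, y b⁆ (y c))) using 1
  simp only [freeWord_singleton, freeWord_nil, one_mul, mul_one, freeEmb_basis, commRelation,
    jacobi]
  noncomm_ring

end PBW

section PBWResolvable

theorem eq_nil_and_or_singleton_of_append_eq_pair {α : Type*} {A B : List α} {a b : α}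
    (hB : B ≠ []) (h : A ++ B = [a, b]) : A = [] ∧ B = [a, b] ∨ A = [a] ∧ B = [b] := by
  rcases A with _ | ⟨x, _ | ⟨x', A⟩⟩ <;> simp_all

theorem and_nil_or_singleton_of_append_eq_pair {α : Type*} {B C : List α} {a b : α}
    (hB : B ≠ []) (h : B ++ C = [a, b]) : B = [a, b] ∧ C = [] ∨ B = [a] ∧ C = [b] := by
  rcases B with _ | ⟨x, _ | ⟨x', B⟩⟩ <;> simp_all

theorem not_append_pair_append_eq_replicate {α : Type*} [Preorder α] {A C : List α} {a b c : α}
    {n : ℕ} (h : b < a) : A ++ [a, b] ++ C ≠ List.replicate n c := by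
  intro e
  have ha := List.eq_of_mem_replicate (e ▸ (by simp : a ∈ A ++ [a, b] ++ C))
  have hb := List.eq_of_mem_replicate (e ▸ (by simp : b ∈ A ++ [a, b] ++ C))
  exact h.ne (hb.trans ha.symm)

theorem eq_replicate_of_append_eq_replicate {α : Type*} {A B C : List α} {a c : α} {n : ℕ}
    (hB : B ≠ []) (hAB : A ++ B = List.replicate n a) (hBC : B ++ C = List.replicate n c) :
    a = c ∧ A = C ∧ C = List.replicate C.length a := by
  obtain ⟨hl, hA, hB₁⟩ := List.append_eq_replicate_iff.1 hAB
  obtain ⟨hl', hB₂, hC⟩ := List.append_eq_replicate_iff.1 hBC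
  obtain ⟨x, B, rfl⟩ := List.exists_cons_of_ne_nil hB
  obtain rfl : x = a := List.eq_of_mem_replicate (hB₁ ▸ List.mem_cons_self)
  obtain rfl : x = c := List.eq_of_mem_replicate (hB₂ ▸ List.mem_cons_self)
  have hlen : A.length = C.length := by omega
  exact ⟨rfl, by rw [hA, hlen, ← hC], hC⟩

variable {p : ℕ} [hp : Fact p.Prime] {k g ι : Type*} [CommRing k] [LieRing g] [LieAlgebra k g]
  [LinearOrder ι] [WellFoundedLT ι] {y : Module.Basis ι k g} {z : ι → g} (γ : ι → k)

theorem pbw_overlap [CharP k p] (hz : ∀ i x, ⁅z i, x⁆ = (LieAlgebra.ad k g (y i) ^ p) x)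
    {A B C : List ι} {f f' : FreeAlgebra k ι} (hB : B ≠ []) (hf : PBWRule p y z γ (A ++ B) f)
    (hf' : PBWRule p y z γ (B ++ C) f') :
    f * freeWord k C - freeWord k A * f' ∈ (pbwSystem p y z γ).lowerIdeal (A ++ B ++ C) := by
  generalize hAB : A ++ B = r at hf
  generalize hBC : B ++ C = r' at hf'
  rcases hf with ⟨a, b, hab⟩ | ⟨a⟩ <;> rcases hf' with ⟨c, d, hcd⟩ | ⟨c⟩
  · rcases eq_nil_and_or_singleton_of_append_eq_pair hB hAB with ⟨rfl, rfl⟩ | ⟨rfl, rfl⟩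
    · obtain ⟨rfl, rfl, rfl⟩ : a = c ∧ b = d ∧ C = [] := by simp_all
      simp [freeWord_nil]
    · obtain ⟨rfl, rfl⟩ : b = c ∧ C = [d] := by simp_all
      rw [freeWord_singleton, freeWord_singleton]
      exact pbw_overlap_comm_comm y z γ hab hcd
  · rcases eq_nil_and_or_singleton_of_append_eq_pair hB hAB with ⟨rfl, rfl⟩ | ⟨rfl, rfl⟩
    · exact (not_append_pair_append_eq_replicate (A := []) hab hBC).elim
    · obtain rfl := List.eq_of_mem_replicate (hBC ▸ (by simp : b ∈ [b] ++ C))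
      obtain rfl : C = List.replicate (p - 1) b := by
        rw [← Nat.sub_add_cancel hp.out.pos, List.replicate_succ] at hBC
        exact (List.cons.inj hBC).2
      rw [freeWord_replicate, freeWord_singleton, ← hAB, List.append_assoc, hBC]
      exact pbw_overlap_comm_pow γ hz hab
  · rcases and_nil_or_singleton_of_append_eq_pair hB hBC with ⟨rfl, rfl⟩ | ⟨rfl, rfl⟩
    · exact (not_append_pair_append_eq_replicate (C := []) hcd (by simpa using hAB)).elim
    · obtain rfl := List.eq_of_mem_replicate (hAB ▸ (by simp : c ∈ A ++ [c]))
      obtain rfl : A = List.replicate (p - 1) c := by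
        rw [← Nat.sub_add_cancel hp.out.pos, List.replicate_succ'] at hAB
        exact (List.append_inj' hAB rfl).1
      rw [freeWord_replicate, freeWord_singleton]
      exact pbw_overlap_pow_comm γ hz hcd
  · obtain ⟨rfl, rfl, hA⟩ := eq_replicate_of_append_eq_replicate hB hAB hBC
    have hlen := congrArg List.length hAB
    have hBpos := List.length_pos_iff.2 hB
    rcases eq_or_ne A [] with rfl | hA0
    · simp [freeWord_nil]
    · have hApos := List.length_pos_iff.2 hA0
      have := pbw_overlap_pow_pow γ hz a (s := A.length) (w := List.replicate p a ++ A)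
        (by simp at hlen; omega) (by simp; omega)
      rwa [← freeWord_replicate, ← hA] at this

theorem pbw_inclusion {A B C : List ι} {f f' : FreeAlgebra k ι}
    (hf : PBWRule p y z γ (A ++ B ++ C) f) (hf' : PBWRule p y z γ B f') :
    f - freeWord k A * f' * freeWord k C ∈ (pbwSystem p y z γ).lowerIdeal (A ++ B ++ C) := by
  suffices A = [] ∧ C = [] ∧ f = f' by simp [this, freeWord_nil]
  generalize hABC : A ++ B ++ C = r at hf
  have hlen := congrArg List.length hABC
  have hp2 := hp.out.two_le
  rcases hf with ⟨a, b, hab⟩ | ⟨a⟩ <;> rcases hf' with ⟨c, d, hcd⟩ | ⟨c⟩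
  · rcases A with _ | ⟨x, _ | ⟨x', A⟩⟩ <;> simp_all
  · obtain ⟨rfl, rfl⟩ : A = [] ∧ C = [] := by
      simp only [List.length_append, List.length_replicate, List.length_cons, List.length_nil]
        at hlen
      constructor <;> apply List.eq_nil_of_length_eq_zero <;> omega
    exact (not_append_pair_append_eq_replicate (A := []) (C := []) hab
      (by simpa using hABC.symm)).elim
  · exact (not_append_pair_append_eq_replicate hcd hABC).elim
  · obtain ⟨rfl, rfl⟩ : A = [] ∧ C = [] := by
      simp only [List.length_append, List.length_replicate] at hlen
      constructor <;> apply List.eq_nil_of_length_eq_zero <;> omega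
    obtain rfl : c = a := (List.replicate_right_inj hp.out.ne_zero).1 (by simpa using hABC)
    exact ⟨rfl, rfl, rfl⟩

theorem pbwSystem_isResolvable [CharP k p]
    (hz : ∀ i x, ⁅z i, x⁆ = (LieAlgebra.ad k g (y i) ^ p) x) :
    (pbwSystem p y z γ).IsResolvable where
  overlap hB hf hf' := pbw_overlap γ hz hB hf hf'
  inclusion hf hf' := pbw_inclusion γ hf hf'

end PBWResolvable

section ExponentWord

/-- The nondecreasing word in which `j` occurs `r j` times. -/
def exponentWord {d : ℕ} (r : Fin d → ℕ) : List (Fin d) :=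
  (List.ofFn fun j => List.replicate (r j) j).flatten

theorem pairwise_exponentWord {d : ℕ} (r : Fin d → ℕ) : (exponentWord r).Pairwise (· ≤ ·) := by
  rw [exponentWord, List.pairwise_flatten]
  constructor
  · simp only [List.mem_ofFn, forall_exists_index, forall_apply_eq_imp_iff]
    exact fun j => List.pairwise_replicate.2 (Or.inr le_rfl)
  · rw [List.pairwise_ofFn]
    intro i j hij a ha b hb
    rw [List.eq_of_mem_replicate ha, List.eq_of_mem_replicate hb]
    exact hij.le

theorem count_exponentWord {d : ℕ} (r : Fin d → ℕ) (j : Fin d) :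
    (exponentWord r).count j = r j := by
  rw [exponentWord, List.count_flatten, List.map_ofFn, List.sum_ofFn, Finset.sum_eq_single j]
  · simp
  · intro i _ hij
    simp [List.count_replicate, hij]
  · simp

theorem exponentWord_injective (d : ℕ) : Function.Injective (exponentWord (d := d)) := by
  intro r s h
  ext j
  rw [← count_exponentWord r j, h, count_exponentWord]

theorem prod_map_exponentWord {M : Type*} [Monoid M] {d : ℕ} (y : Fin d → M) (r : Fin d → ℕ) :
    ((exponentWord r).map y).prod = (List.ofFn fun j => y j ^ r j).prod := by
  rw [exponentWord, List.map_flatten, List.prod_flatten, List.map_map, List.map_ofFn]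
  congr 2
  ext j
  simp

end ExponentWord

section PBWAlgebra

variable {p : ℕ} [hp : Fact p.Prime] {k g : Type*} [CommRing k] [LieRing g] [LieAlgebra k g] {d : ℕ}
  {y : Module.Basis (Fin d) k g} {z : Fin d → g} {γ : Fin d → k}

theorem not_isReducible_exponentWord (r : Fin d → Fin p) :
    ¬ (pbwSystem p y z γ).IsReducible (exponentWord fun j => (r j : ℕ)) := by
  rintro ⟨u, s, v, f, ⟨a, b, hab⟩ | ⟨a⟩, h⟩
  · have sorted := pairwise_exponentWord fun j => (r j : ℕ)
    rw [h] at sorted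
    have : [a, b].Pairwise (· ≤ ·) := sorted.sublist
      ((List.sublist_append_right _ _).trans (List.sublist_append_left _ _))
    exact hab.not_ge (by simpa using this)
  · have count := count_exponentWord (fun j => (r j : ℕ)) a
    rw [h, List.count_append, List.count_append, List.count_replicate_self] at count
    have := (r a).2
    omega

theorem linearIndependent_freeWord_exponentWord [CharP k p]
    (hz : ∀ i x, ⁅z i, x⁆ = (LieAlgebra.ad k g (y i) ^ p) x) :
    LinearIndependent k fun r : Fin d → Fin p =>
      (pbwSystem p y z γ).quotientMap (freeWord k (exponentWord fun j => (r j : ℕ))) := by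
  have irreducible := (pbwSystem_isResolvable γ hz).linearIndependent_irreducible
  let word (r : Fin d → Fin p) : {w // ¬ (pbwSystem p y z γ).IsReducible w} :=
    ⟨exponentWord fun j => (r j : ℕ), not_isReducible_exponentWord r⟩
  have word_injective : Function.Injective word := fun r s h => funext fun j =>
    Fin.ext (congrFun (exponentWord_injective d (Subtype.ext_iff.1 h)) j)
  exact irreducible.comp word word_injective

theorem ReductionSystem.lengthIdeal_le_ker {ι : Type*} {R : ReductionSystem k ι} (n : ℕ) :
    R.lengthIdeal n ≤ LinearMap.ker R.quotientMap.toLinearMap := by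
  refine Submodule.span_le.2 ?_
  rintro _ ⟨u, r, v, f, hr, -, rfl⟩
  exact quotientMap_eq_zero.2 (TwoSidedIdeal.mul_mem_right _ _ _
    (TwoSidedIdeal.mul_mem_left _ _ _ (TwoSidedIdeal.subset_span ⟨r, f, hr, rfl⟩)))

attribute [local instance 100] LieRing.ofAssociativeRing

/-- The canonical map from a Lie algebra `g` to the algebra with the presentation `pbwSystem`. -/
noncomputable def pbwHom (p : ℕ) [Fact p.Prime] (y : Module.Basis (Fin d) k g) (z : Fin d → g)
    (γ : Fin d → k) : g →ₗ⁅k⁆ (pbwSystem p y z γ).PresentedAlgebra where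
  __ := (pbwSystem p y z γ).quotientMap.toLinearMap ∘ₗ freeEmb y
  map_lie' {a b} := by
    have h := ReductionSystem.lengthIdeal_le_ker _ (freeEmb_comm_mem_lengthIdeal (p := p) y z γ a b)
    rw [LinearMap.mem_ker, map_sub, sub_eq_zero] at h
    exact h.symm

theorem pbwHom_basis (i : Fin d) :
    pbwHom p y z γ (y i) = (pbwSystem p y z γ).quotientMap (FreeAlgebra.ι k i) :=
  congrArg (pbwSystem p y z γ).quotientMap (freeEmb_basis y i)

theorem pbwHom_basis_pow (i : Fin d) :
    pbwHom p y z γ (y i) ^ p = pbwHom p y z γ (z i) + algebraMap k _ (γ i) := by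
  let π := (pbwSystem p y z γ).quotientMap
  have relation : π (FreeAlgebra.ι k i ^ p - (freeEmb y (z i) + algebraMap k _ (γ i))) = 0 :=
    ReductionSystem.quotientMap_eq_zero.2 (TwoSidedIdeal.subset_span
      ⟨_, _, PBWRule.pow i, by rw [freeWord_replicate]⟩)
  rw [map_sub, sub_eq_zero, map_pow, map_add, AlgHom.commutes] at relation
  rw [pbwHom_basis]
  exact relation

end PBWAlgebra

namespace ReducedEnv

variable {p : ℕ} {F L : Type*} [Field F] [LieRing L] [LieAlgebra F L] {P : PMap p F L}
  {K : Type*} [Field K] [Algebra F K] {c : L →ₗ[F] K}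

attribute [local instance 100] LieRing.ofAssociativeRing

theorem lift_ι {A : Type*} [Ring A] [Algebra K A] (f : (K ⊗[F] L) →ₗ⁅K⁆ A)
    (hf : ∀ x : L, f ((1 : K) ⊗ₜ[F] x) ^ p
      = f ((1 : K) ⊗ₜ[F] P.toFun x) + algebraMap K A (c x ^ p)) (x : K ⊗[F] L) :
    lift f hf (ι P c x) = f x :=
  (RingQuot.liftAlgHom_mkAlgHom_apply K (s := ReducedRel P c) (UniversalEnvelopingAlgebra.lift K f)
    (by rintro _ _ ⟨x⟩; simpa using hf x) (UniversalEnvelopingAlgebra.ι K x)).trans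
    (UniversalEnvelopingAlgebra.lift_ι_apply K f x)

theorem mk_surjective : Function.Surjective (mk P c) := RingQuot.mkAlgHom_surjective K _

theorem adjoin_range_ι : Algebra.adjoin K (Set.range (ι P c)) = ⊤ := by
  have surjective : Function.Surjective ((mk P c).comp (UniversalEnvelopingAlgebra.mkAlgHom K _)) :=
    mk_surjective.comp (RingCon.mkₐ_surjective (α := K) _)
  rw [← AlgHom.range_eq_top] at surjective
  rw [← surjective, ← Algebra.map_top, ← TensorAlgebra.adjoin_range_ι, AlgHom.map_adjoin,
    ← Set.range_comp]
  rfl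

theorem one_tmul_lie (x y : L) :
    (1 : K) ⊗ₜ[F] ⁅x, y⁆ = ⁅(1 : K) ⊗ₜ[F] x, (1 : K) ⊗ₜ[F] y⁆ := by
  rw [LieAlgebra.ExtendScalars.bracket_tmul, mul_one]

/-- The restriction to `L` of a homomorphism on `K ⊗ L`. -/
noncomputable def restrictTensor {A : Type*} [LieRing A] [LieAlgebra F A] [LieAlgebra K A]
    [IsScalarTower F K A] (f : (K ⊗[F] L) →ₗ⁅K⁆ A) : L →ₗ⁅F⁆ A :=
  { (f : (K ⊗[F] L) →ₗ[K] A).restrictScalars F ∘ₗ TensorProduct.mk F K L 1 with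
    map_lie' := fun {a b} => (congrArg f (one_tmul_lie a b)).trans (f.map_lie _ _) }

theorem lie_one_tmul_toFun (x : L) (w : K ⊗[F] L) :
    ⁅(1 : K) ⊗ₜ[F] P.toFun x, w⁆ = (LieAlgebra.ad K (K ⊗[F] L) (1 ⊗ₜ x) ^ p) w := by
  have baseChange_ad (x : L) :
      LieAlgebra.ad K (K ⊗[F] L) (1 ⊗ₜ x) = (LieAlgebra.ad F L x).baseChange K :=
    LieModule.toEnd_baseChange F K L L x
  rw [baseChange_ad, ← LinearMap.baseChange_pow, ← P.ad_toFun, ← baseChange_ad, LieAlgebra.ad_apply]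

theorem linearIndependent_monomials [Fact p.Prime] [CharP F p] (c : L →ₗ[F] K) {d : ℕ}
    (x : Module.Basis (Fin d) F L) :
    LinearIndependent K fun r : Fin d → Fin p =>
      (List.ofFn fun j => ι P c ((1 : K) ⊗ₜ[F] x j) ^ (r j : ℕ)).prod := by
  have : CharP K p := charP_of_injective_algebraMap (algebraMap F K).injective p
  let y := x.baseChange K
  have y_apply (i) : y i = (1 : K) ⊗ₜ[F] x i := Module.Basis.baseChange_apply K x i
  let z (i : Fin d) : K ⊗[F] L := (1 : K) ⊗ₜ[F] P.toFun (x i)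
  let γ (i : Fin d) : K := c (x i) ^ p
  let f := pbwHom p y z γ
  let _ : Algebra F (pbwSystem p y z γ).PresentedAlgebra := Algebra.compHom _ (algebraMap F K)
  have : IsScalarTower F K (pbwSystem p y z γ).PresentedAlgebra := .of_algebraMap_eq fun _ => rfl
  have hf (w : L) : f (1 ⊗ₜ w) ^ p = f (1 ⊗ₜ P.toFun w) + algebraMap K _ (c w ^ p) := by
    refine P.pow_eq_of_basis c x (restrictTensor f) (fun i => ?_) w
    change f (1 ⊗ₜ x i) ^ p = f (z i) + algebraMap K _ (γ i)
    rw [← y_apply, pbwHom_basis_pow]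
  refine LinearIndependent.of_comp (lift f hf).toLinearMap ?_
  have map_monomial : (lift f hf).toLinearMap ∘ (fun r : Fin d → Fin p =>
      (List.ofFn fun j => ι P c ((1 : K) ⊗ₜ[F] x j) ^ (r j : ℕ)).prod) = fun r =>
      (pbwSystem p y z γ).quotientMap (freeWord K (exponentWord fun j => (r j : ℕ))) := by
    ext r
    rw [Function.comp_apply, freeWord, prod_map_exponentWord, AlgHom.toLinearMap_apply,
      map_list_prod, map_list_prod, List.map_ofFn, List.map_ofFn]
    congr 2
    ext j : 1
    simp only [Function.comp_apply, map_pow, lift_ι, ← pbwHom_basis, y_apply, f]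
  rw [map_monomial]
  exact linearIndependent_freeWord_exponentWord fun i w => by rw [y_apply, ← lie_one_tmul_toFun]

end ReducedEnv

/-! ### Straightening -/

section Straightening

variable {k X : Type*} [CommRing k] [AddCommGroup X] [Module k X]

/-- The span of all products of at most `m` operators from `G`, applied to `W₀`. -/
def wordSpan (G : Set (Module.End k X)) (W₀ : Submodule k X) (m : ℕ) : Submodule k X :=
  Submodule.span k {x | ∃ l : List (Module.End k X), l.length ≤ m ∧ (∀ a ∈ l, a ∈ G) ∧
    ∃ w ∈ W₀, x = l.prod w}

/-- The span of all ordered monomials in the operators `y j` with exponents less than `p`, applied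
to `W₀`. -/
def monomialSpan (p : ℕ) {n : ℕ} (y : Fin n → Module.End k X) (W₀ : Submodule k X) :
    Submodule k X :=
  Submodule.span k {x | ∃ r : Fin n → Fin p, ∃ w ∈ W₀,
    x = (List.ofFn fun j => y j ^ (r j : ℕ)).prod w}

section WordSpan

variable {G : Set (Module.End k X)} {W₀ : Submodule k X}

theorem prod_apply_mem_wordSpan {m : ℕ} {l : List (Module.End k X)} (hm : l.length ≤ m)
    (hl : ∀ a ∈ l, a ∈ G) {w : X} (hw : w ∈ W₀) : l.prod w ∈ wordSpan G W₀ m :=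
  Submodule.subset_span ⟨l, hm, hl, w, hw, rfl⟩

theorem le_wordSpan (m : ℕ) : W₀ ≤ wordSpan G W₀ m := fun _ hw =>
  prod_apply_mem_wordSpan (l := []) m.zero_le (by simp) hw

theorem wordSpan_mono {m m' : ℕ} (h : m ≤ m') : wordSpan G W₀ m ≤ wordSpan G W₀ m' :=
  Submodule.span_mono fun _ ⟨l, hl, hG, w, hw, e⟩ => ⟨l, hl.trans h, hG, w, hw, e⟩

theorem apply_mem_wordSpan {m : ℕ} {a : Module.End k X} (ha : a ∈ Submodule.span k G) {x : X}
    (hx : x ∈ wordSpan G W₀ m) : a x ∈ wordSpan G W₀ (m + 1) := by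
  have generator_apply (b) (hb : b ∈ G) :
      wordSpan G W₀ m ≤ (wordSpan G W₀ (m + 1)).comap b := by
    refine Submodule.span_le.2 ?_
    rintro _ ⟨l, hm, hl, w, hw, rfl⟩
    exact prod_apply_mem_wordSpan (l := b :: l) (Nat.succ_le_succ hm)
      (List.forall_mem_cons.2 ⟨hb, hl⟩) hw
  exact (Submodule.span_le.2 fun b hb => generator_apply b hb hx :
    Submodule.span k G ≤ (wordSpan G W₀ (m + 1)).comap (LinearMap.applyₗ x)) ha

theorem prod_apply_mem_wordSpan_add {m : ℕ} (l : List (Module.End k X)) (hl : ∀ a ∈ l, a ∈ G)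
    {x : X} (hx : x ∈ wordSpan G W₀ m) : l.prod x ∈ wordSpan G W₀ (m + l.length) := by
  induction l with
  | nil => exact hx
  | cons a l ih =>
    rw [List.forall_mem_cons] at hl
    rw [List.prod_cons]
    exact apply_mem_wordSpan (Submodule.subset_span hl.1) (ih hl.2)

theorem prod_sub_prod_mem_wordSpan
    (hcomm : ∀ a ∈ G, ∀ b ∈ G, a * b - b * a ∈ Submodule.span k G)
    {l l' : List (Module.End k X)} (h : l.Perm l') (hl : ∀ a ∈ l, a ∈ G)
    {w : X} (hw : w ∈ W₀) {m : ℕ} (hm : l.length = m + 1) :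
    l.prod w - l'.prod w ∈ wordSpan G W₀ m := by
  induction h generalizing m with
  | nil => simp at hm
  | @cons a l l' h ih =>
    rw [List.length_cons, Nat.add_right_cancel_iff] at hm
    rw [List.forall_mem_cons] at hl
    rw [List.prod_cons, List.prod_cons, Module.End.mul_apply, Module.End.mul_apply, ← map_sub]
    cases m with
    | zero =>
      obtain rfl := List.eq_nil_of_length_eq_zero hm
      simp [h.nil_eq.symm]
    | succ m => exact apply_mem_wordSpan (Submodule.subset_span hl.1) (ih hl.2 hm)
  | swap a b l =>
    obtain rfl : m = l.length + 1 := by simpa using hm.symm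
    simp only [List.forall_mem_cons] at hl
    have difference : (b :: a :: l).prod w - (a :: b :: l).prod w = (b * a - a * b) (l.prod w) := by
      simp
    rw [difference]
    exact apply_mem_wordSpan (hcomm b hl.1 a hl.2.1) (prod_apply_mem_wordSpan le_rfl hl.2.2 hw)
  | @trans l₁ l₂ l₃ h1 _ ih1 ih2 =>
    rw [← sub_add_sub_cancel _ (l₂.prod w)]
    exact add_mem (ih1 hl hm) (ih2 (fun a ha => hl a (h1.mem_iff.2 ha)) (h1.length_eq ▸ hm))

theorem prod_apply_mem_of_perm
    (hcomm : ∀ a ∈ G, ∀ b ∈ G, a * b - b * a ∈ Submodule.span k G) {N : Submodule k X} {m : ℕ}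
    (hN : wordSpan G W₀ m ≤ N) {l l' : List (Module.End k X)} (h : l.Perm l')
    (hl : ∀ a ∈ l, a ∈ G) {w : X} (hw : w ∈ W₀) (hm : l.length = m + 1) (hl' : l'.prod w ∈ N) :
    l.prod w ∈ N :=
  sub_add_cancel (l.prod w) (l'.prod w) ▸
    add_mem (hN (prod_sub_prod_mem_wordSpan hcomm h hl hw hm)) hl'

end WordSpan

variable {p n : ℕ} {y : Fin n → Module.End k X} {H : Set (Module.End k X)} {W₀ : Submodule k X}

theorem le_monomialSpan [hp : Fact p.Prime] : W₀ ≤ monomialSpan p y W₀ := fun w hw =>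
  Submodule.subset_span ⟨fun _ => ⟨0, hp.out.pos⟩, w, hw, by simp⟩

theorem prod_map_apply_mem_monomialSpan [hp : Fact p.Prime]
    (hcomm : ∀ a ∈ Set.range y ∪ H, ∀ b ∈ Set.range y ∪ H,
      a * b - b * a ∈ Submodule.span k (Set.range y ∪ H))
    (hpow : ∀ i, ∀ w ∈ W₀, (y i ^ p) w ∈ wordSpan (Set.range y ∪ H) W₀ (p - 1)) {m : ℕ}
    (hm : wordSpan (Set.range y ∪ H) W₀ m ≤ monomialSpan p y W₀) {s : List (Fin n)}
    (hs : s.length = m + 1) {w : X} (hw : w ∈ W₀) : (s.map y).prod w ∈ monomialSpan p y W₀ := by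
  have map_mem (t : List (Fin n)) : ∀ a ∈ t.map y, a ∈ Set.range y ∪ H := by
    simp only [List.forall_mem_map]
    exact fun i _ => Or.inl ⟨i, rfl⟩
  have of_perm {t : List (Fin n)} (h : s.Perm t) :=
    prod_apply_mem_of_perm hcomm hm (h.map y) (map_mem s) hw (by rw [List.length_map, hs])
  by_cases hr : ∀ j, s.count j < p
  · have sorted : s.Perm (exponentWord fun j => s.count j) :=
      List.perm_iff_count.2 fun j => (count_exponentWord (s.count ·) j).symm
    exact of_perm sorted (Submodule.subset_span
      ⟨fun j => ⟨s.count j, hr j⟩, w, hw, by rw [prod_map_exponentWord]⟩)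
  · push Not at hr
    obtain ⟨j, hj⟩ := hr
    obtain ⟨t, ht⟩ := (List.replicate_sublist_iff.2 hj).exists_perm_append
    have ht' : s.Perm (t ++ List.replicate p j) := ht.trans List.perm_append_comm
    have length := ht'.length_eq
    rw [List.length_append, List.length_replicate] at length
    refine of_perm ht' ?_
    rw [List.map_append, List.prod_append, Module.End.mul_apply, List.map_replicate,
      List.prod_replicate]
    refine hm (wordSpan_mono ?_ (prod_apply_mem_wordSpan_add (t.map y) (map_mem t) (hpow j w hw)))
    have := hp.out.pos
    rw [List.length_map]
    omega

theorem wordSpan_le_monomialSpan [Fact p.Prime]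
    (hcomm : ∀ a ∈ Set.range y ∪ H, ∀ b ∈ Set.range y ∪ H,
      a * b - b * a ∈ Submodule.span k (Set.range y ∪ H))
    (hH : ∀ h ∈ H, ∀ w ∈ W₀, h w ∈ W₀)
    (hpow : ∀ i, ∀ w ∈ W₀, (y i ^ p) w ∈ wordSpan (Set.range y ∪ H) W₀ (p - 1)) (m : ℕ) :
    wordSpan (Set.range y ∪ H) W₀ m ≤ monomialSpan p y W₀ := by
  induction m with
  | zero =>
    refine Submodule.span_le.2 ?_
    rintro _ ⟨l, hl, -, w, hw, rfl⟩
    obtain rfl : l = [] := List.eq_nil_of_length_eq_zero (Nat.le_zero.1 hl)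
    exact le_monomialSpan hw
  | succ m ih =>
    refine Submodule.span_le.2 ?_
    rintro _ ⟨l, hl, hG, w, hw, rfl⟩
    obtain hlt | hlm := hl.lt_or_eq
    · exact ih (prod_apply_mem_wordSpan (Nat.le_of_lt_succ hlt) hG hw)
    by_cases hy : ∀ a ∈ l, a ∈ Set.range y
    · obtain ⟨s, rfl⟩ : l ∈ Set.range (List.map y) := by rwa [Set.range_list_map]
      exact prod_map_apply_mem_monomialSpan hcomm hpow ih (by rwa [List.length_map] at hlm) hw
    · push Not at hy
      obtain ⟨a, hal, hay⟩ := hy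
      have haH : a ∈ H := (hG a hal).resolve_left hay
      obtain ⟨s, t, rfl⟩ := List.append_of_mem hal
      have move_right : (s ++ a :: t).Perm (s ++ t ++ [a]) :=
        List.perm_middle.trans (List.perm_append_comm (l₁ := [a]))
      refine prod_apply_mem_of_perm hcomm ih move_right hG hw hlm ?_
      rw [List.prod_append, List.prod_singleton, Module.End.mul_apply]
      refine ih (prod_apply_mem_wordSpan ?_ (fun b hb => hG b ?_) (hH a haH w hw))
      · simp only [List.length_append, List.length_cons] at hlm ⊢
        omega
      · simp only [List.mem_append, List.mem_cons] at hb ⊢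
        tauto

theorem apply_mem_monomialSpan [Fact p.Prime]
    (hcomm : ∀ a ∈ Set.range y ∪ H, ∀ b ∈ Set.range y ∪ H,
      a * b - b * a ∈ Submodule.span k (Set.range y ∪ H))
    (hH : ∀ h ∈ H, ∀ w ∈ W₀, h w ∈ W₀)
    (hpow : ∀ i, ∀ w ∈ W₀, (y i ^ p) w ∈ wordSpan (Set.range y ∪ H) W₀ (p - 1))
    {a : Module.End k X} (ha : a ∈ Submodule.span k (Set.range y ∪ H)) {x : X}
    (hx : x ∈ monomialSpan p y W₀) : a x ∈ monomialSpan p y W₀ := by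
  refine (Submodule.span_le.2 ?_ : monomialSpan p y W₀ ≤ (monomialSpan p y W₀).comap a) hx
  rintro _ ⟨r, w, hw, rfl⟩
  rw [← prod_map_exponentWord]
  refine wordSpan_le_monomialSpan hcomm hH hpow _
    (apply_mem_wordSpan ha (prod_apply_mem_wordSpan le_rfl ?_ hw))
  simp only [List.forall_mem_map]
  exact fun i _ => Or.inl ⟨i, rfl⟩

theorem lie_apply_mem_monomialSpan [hp : Fact p.Prime] {g : Type*} [LieRing g] [LieAlgebra k g]
    (Λ : g →ₗ[k] Module.End k X) (hΛ : ∀ a b, Λ ⁅a, b⁆ = Λ a * Λ b - Λ b * Λ a)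
    (e : Fin n → g) (h : Submodule k g) (htop : Submodule.span k (Set.range e) ⊔ h = ⊤)
    (hH : ∀ a ∈ h, ∀ w ∈ W₀, Λ a w ∈ W₀)
    (hpow : ∀ i, ∀ w ∈ W₀, ∃ b : g, (Λ (e i) ^ p) w - Λ b w ∈ W₀) (a : g) {x : X}
    (hx : x ∈ monomialSpan p (fun i => Λ (e i)) W₀) :
    Λ a x ∈ monomialSpan p (fun i => Λ (e i)) W₀ := by
  have operators : Set.range (fun i => Λ (e i)) ∪ Λ '' h = Λ '' (Set.range e ∪ h) := by
    rw [Set.image_union, ← Set.range_comp]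
    rfl
  have mem_span (a) : Λ a ∈ Submodule.span k (Set.range (fun i => Λ (e i)) ∪ Λ '' h) := by
    rw [operators, ← Submodule.map_span, Submodule.span_union, Submodule.span_eq, htop]
    exact Submodule.mem_map_of_mem trivial
  refine apply_mem_monomialSpan (H := Λ '' h) ?_ ?_ ?_ (mem_span a) hx
  · intro a ha b hb
    rw [operators] at ha hb
    obtain ⟨a, -, rfl⟩ := ha
    obtain ⟨b, -, rfl⟩ := hb
    exact hΛ a b ▸ mem_span _
  · rintro _ ⟨b, hb, rfl⟩ w hw
    exact hH b hb w hw
  · intro i w hw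
    obtain ⟨b, hb⟩ := hpow i w hw
    rw [← sub_add_cancel ((Λ (e i) ^ p) w) (Λ b w)]
    exact wordSpan_mono (Nat.le_sub_one_of_lt hp.out.one_lt)
      (add_mem (le_wordSpan 1 hb) (apply_mem_wordSpan (mem_span b) (le_wordSpan 0 hw)))

end Straightening

section Cobasis

variable {F L : Type*} [Field F] [LieRing L] [LieAlgebra F L] {S : LieSubalgebra F L}

/-- The basis of `L` which consists of a cobasis of `S` and a basis of `S`. -/
noncomputable def IsCobasis.basis {n q : ℕ} {e : Fin n → L} (he : IsCobasis S e)
    (s : Module.Basis (Fin q) F S) : Module.Basis (Fin (n + q)) F L :=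
  (((Module.Basis.span he.1).prod s).map
    (Submodule.prodEquivOfIsCompl _ _ he.2.symm)).reindex finSumFinEquiv

theorem IsCobasis.basis_apply {n q : ℕ} {e : Fin n → L} (he : IsCobasis S e)
    (s : Module.Basis (Fin q) F S) : ⇑(he.basis s) = Fin.append e (fun j => (s j : L)) := by
  ext i
  cases i using Fin.addCases <;>
  · simp only [IsCobasis.basis, Module.Basis.reindex_apply, finSumFinEquiv_symm_apply_castAdd,
      finSumFinEquiv_symm_apply_natAdd, Module.Basis.map_apply, Module.Basis.prod_apply,
      Fin.append_left, Fin.append_right]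
    exact (Submodule.coe_prodEquivOfIsCompl' _ _ _ _).trans (by simp [Module.Basis.span_apply])

theorem exists_isCobasis [FiniteDimensional F L] (S : LieSubalgebra F L) :
    ∃ (n : ℕ) (e : Fin n → L), IsCobasis S e := by
  obtain ⟨T, hT⟩ := Submodule.exists_isCompl S.toSubmodule
  let b := Module.finBasis F T
  refine ⟨_, fun i => (b i : L), b.linearIndependent.map' T.subtype T.ker_subtype, ?_⟩
  have span_range : Submodule.span F (Set.range fun i => (b i : L)) = T := by
    rw [show (fun i => (b i : L)) = T.subtype ∘ b from rfl, Set.range_comp, ← Submodule.map_span,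
      b.span_eq, Submodule.map_top, Submodule.range_subtype]
  exact span_range.symm ▸ hT

end Cobasis

section FreeRightModule

variable {K A B M : Type*} [CommRing K] [Ring A] [Algebra K A] [Ring B] [Algebra K B]

/-- The map `(a_r) ↦ ∑ r, u_r j(a_r)` of right `A`-modules defined by a family `u` in an algebra
`B` over `A`. -/
noncomputable def rightCombination {κ : Type*} [Fintype κ] (j : A →ₐ[K] B) (u : κ → B) :
    (κ → A) →ₗ[K] B :=
  ∑ r, LinearMap.mulLeft K (u r) ∘ₗ j.toLinearMap ∘ₗ LinearMap.proj r

variable {κ : Type*} [Fintype κ] (j : A →ₐ[K] B) (u : κ → B)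

theorem rightCombination_apply (a : κ → A) :
    rightCombination j u a = ∑ r, u r * j (a r) := by
  simp [rightCombination]

theorem rightCombination_single [DecidableEq κ] (r : κ) (a : A) :
    rightCombination j u (Pi.single r a) = u r * j a := by
  rw [rightCombination_apply, Finset.sum_eq_single r] <;> simp +contextual

theorem rightCombination_mul (x : κ → A) (a : A) :
    rightCombination j u (fun r => x r * a) = rightCombination j u x * j a := by
  simp only [rightCombination_apply, map_mul, Finset.sum_mul, mul_assoc]

end FreeRightModule

theorem BalancedTensor.eq_zero_of_sum_tmul_eq_zero {K A B M κ : Type*} [Field K] [Ring A]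
    [Algebra K A] [Ring B] [Algebra K B] [AddCommGroup M] [Module K M] [Fintype κ]
    {j : A →ₐ[K] B} {ρ : A →ₐ[K] Module.End K M} {u : κ → B}
    (hu : Function.Bijective (rightCombination j u)) {f : κ → M}
    (hf : (Submodule.Quotient.mk (∑ r, u r ⊗ₜ[K] f r) : BalancedTensor j ρ) = 0) : f = 0 := by
  classical
  let ψ := LinearEquiv.ofBijective (rightCombination j u) hu
  have symm_mul (b a) : ψ.symm (b * j a) = fun r => ψ.symm b r * a := by
    obtain ⟨x, rfl⟩ := ψ.surjective b
    rw [LinearEquiv.symm_apply_eq, ψ.symm_apply_apply]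
    exact (rightCombination_mul j u x a).symm
  have symm_generator (r) : ψ.symm (u r) = Pi.single r 1 := by
    rw [LinearEquiv.symm_apply_eq]
    exact ((rightCombination_single j u r 1).trans (by rw [map_one, mul_one])).symm
  let coordinate (r : κ) : B ⊗[K] M →ₗ[K] M :=
    TensorProduct.lift (ρ.toLinearMap ∘ₗ LinearMap.proj r ∘ₗ ψ.symm.toLinearMap)
  have coordinate_tmul (r b m) : coordinate r (b ⊗ₜ m) = ρ (ψ.symm b r) m := rfl
  have coordinate_eq_zero (r : κ) {t : B ⊗[K] M} (ht : t ∈ Submodule.span B {t : B ⊗[K] M |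
      ∃ (b : B) (a : A) (m : M), t = (b * j a) ⊗ₜ[K] m - b ⊗ₜ[K] (ρ a m)}) :
      coordinate r t = 0 := by
    induction ht using Submodule.closure_induction with
    | zero => exact map_zero _
    | add x y _ _ hx hy => rw [map_add, hx, hy, add_zero]
    | smul_mem b' t ht =>
      obtain ⟨b, a, m, rfl⟩ := ht
      simp only [smul_sub, TensorProduct.smul_tmul', smul_eq_mul, map_sub, coordinate_tmul,
        ← mul_assoc, symm_mul, map_mul, Module.End.mul_apply, sub_self]
  ext r
  have := coordinate_eq_zero r ((Submodule.Quotient.mk_eq_zero _).1 hf)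
  rw [map_sum, Finset.sum_eq_single r] at this
  · simpa [coordinate_tmul, symm_generator] using this
  · intro r' _ hr
    simp [coordinate_tmul, symm_generator, hr.symm]
  · simp

namespace ReducedEnv

variable {p : ℕ} {F L : Type*} [Field F] [LieRing L] [LieAlgebra F L] {P : PMap p F L}
variable {K : Type*} [Field K] [Algebra F K] {c : L →ₗ[F] K}

/-- The product `e_1 ^ r_1 ⋯ e_n ^ r_n` in the reduced enveloping algebra. -/
noncomputable def monomial (P : PMap p F L) (c : L →ₗ[F] K) {n : ℕ} (e : Fin n → L)
    (r : Fin n → ℕ) : ReducedEnv P c :=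
  (List.ofFn fun j => ι P c ((1 : K) ⊗ₜ[F] e j) ^ r j).prod

theorem monomial_append {n q : ℕ} (e : Fin n → L) (s : Fin q → L) (r : Fin n → ℕ)
    (r' : Fin q → ℕ) : monomial P c (Fin.append e s) (Fin.append r r')
      = monomial P c e r * monomial P c s r' := by
  rw [monomial, monomial, monomial, ← List.prod_append, ← List.ofFn_fin_append]
  congr 2
  ext i : 1
  cases i using Fin.addCases <;> simp

theorem eq_top_of_mul_mem (T : Submodule K (ReducedEnv P c)) (h1 : (1 : ReducedEnv P c) ∈ T)
    (hT : ∀ x, ∀ a ∈ T, ι P c x * a ∈ T) : T = ⊤ := by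
  have mul_mem (b : ReducedEnv P c) : ∀ a ∈ T, b * a ∈ T := by
    have hb : b ∈ Algebra.adjoin K (Set.range (ι P c)) := by
      rw [adjoin_range_ι]
      exact Algebra.mem_top
    induction hb using Algebra.adjoin_induction with
    | mem _ h => exact h.elim fun x hx => hx ▸ hT x
    | algebraMap t => exact fun a ha => by simpa only [← Algebra.smul_def] using T.smul_mem t ha
    | add b b' _ _ hb hb' => exact fun a ha => add_mul b b' a ▸ add_mem (hb a ha) (hb' a ha)
    | mul b b' _ _ hb hb' => exact fun a ha => mul_assoc b b' a ▸ hb _ (hb' a ha)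
  exact eq_top_iff.2 fun b _ => mul_one b ▸ mul_mem b 1 h1

theorem span_range_one_tmul {κ : Type*} (x : Module.Basis κ F L) :
    Submodule.span K (Set.range fun i => (1 : K) ⊗ₜ[F] x i) = ⊤ := by
  simpa only [← Module.Basis.baseChange_apply] using (x.baseChange K).span_eq

variable [hp : Fact p.Prime]

theorem span_range_monomial {d : ℕ} (x : Module.Basis (Fin d) F L) :
    Submodule.span K (Set.range fun r : Fin d → Fin p => monomial P c x fun j => (r j : ℕ)) =
      ⊤ := by
  let Λ : (K ⊗[F] L) →ₗ[K] Module.End K (ReducedEnv P c) :=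
    (Algebra.lmul K (ReducedEnv P c)).toLinearMap ∘ₗ ι P c
  have Λ_pow (y m) : Λ y ^ m = Algebra.lmul K (ReducedEnv P c) (ι P c y ^ m) :=
    (map_pow (Algebra.lmul K (ReducedEnv P c)) _ _).symm
  have Λ_lie (y z) : Λ ⁅y, z⁆ = Λ y * Λ z - Λ z * Λ y := by
    simp only [Λ, LinearMap.comp_apply, ι_lie, AlgHom.toLinearMap_apply, map_sub, map_mul]
  have monomials : monomialSpan p (fun i => Λ (1 ⊗ₜ x i)) (Submodule.span K {1}) = ⊤ := by
    refine eq_top_of_mul_mem _ (le_monomialSpan (Submodule.mem_span_singleton_self 1))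
      fun y a ha => lie_apply_mem_monomialSpan Λ Λ_lie (fun i => 1 ⊗ₜ x i) ⊥
        (by rw [span_range_one_tmul, top_sup_eq]) (by simp) (fun i w hw => ⟨1 ⊗ₜ P.toFun (x i), ?_⟩)
        y ha
    rw [Λ_pow, ι_pow, map_add, LinearMap.add_apply]
    change Λ (1 ⊗ₜ P.toFun (x i)) w + algebraMap K _ (c (x i) ^ p) * w - _ ∈ _
    rw [add_sub_cancel_left, ← Algebra.smul_def]
    exact Submodule.smul_mem _ _ hw
  rw [eq_top_iff, ← monomials]
  refine Submodule.span_le.2 ?_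
  rintro _ ⟨r, w, hw, rfl⟩
  obtain ⟨t, rfl⟩ := Submodule.mem_span_singleton.1 hw
  simp only [Λ_pow]
  rw [map_smul]
  refine Submodule.smul_mem _ _ (Submodule.subset_span ⟨r, ?_⟩)
  have := map_list_prod (Algebra.lmul K (ReducedEnv P c))
    (List.ofFn fun j => ι P c ((1 : K) ⊗ₜ[F] x j) ^ (r j : ℕ))
  rw [List.map_ofFn] at this
  exact (mul_one _).symm.trans (congrArg (fun f => f 1) this)

variable [CharP F p]

/-- The basis of the reduced enveloping algebra which consists of the ordered monomials. -/
noncomputable def monomialBasis (P : PMap p F L) (c : L →ₗ[F] K) {d : ℕ}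
    (x : Module.Basis (Fin d) F L) : Module.Basis (Fin d → Fin p) K (ReducedEnv P c) :=
  Module.Basis.mk (linearIndependent_monomials (P := P) c x) (span_range_monomial x).ge

theorem monomialBasis_apply {d : ℕ} (x : Module.Basis (Fin d) F L) (r : Fin d → Fin p) :
    monomialBasis P c x r = monomial P c x fun j => (r j : ℕ) :=
  Module.Basis.mk_apply _ _ _

variable (S : LieSubalgebra F L) (hS : ∀ s ∈ S, P.toFun s ∈ S) (c : L →ₗ[F] K)

omit [CharP F p] hp in
theorem incl_monomial {q : ℕ} (s : Fin q → S) (r : Fin q → ℕ) :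
    incl S hS c (monomial (P.restrict S hS) (resChar S c) s r)
      = monomial P c (fun j => (s j : L)) r := by
  have incl_ι (x : K ⊗[F] S) : incl S hS c (ι (P.restrict S hS) (resChar S c) x)
      = ι P c (S.toSubmodule.subtype.baseChange K x) := lift_ι _ _ x
  rw [monomial, monomial, map_list_prod, List.map_ofFn]
  congr 2
  ext j : 1
  simp only [Function.comp_apply, map_pow, incl_ι]
  rfl

theorem rightCombination_monomial_bijective [FiniteDimensional F L] {n : ℕ} {e : Fin n → L}
    (he : IsCobasis S e) : Function.Bijective (rightCombination (incl S hS c)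
      fun r : Fin n → Fin p => monomial P c e fun j => (r j : ℕ)) := by
  let s := Module.finBasis F S
  let b := Pi.basis fun _ : Fin n → Fin p => monomialBasis (P.restrict S hS) (resChar S c) s
  let index := (Equiv.sigmaEquivProd _ _).trans
    (Fin.appendEquiv (α := Fin p) n (Module.finrank F S))
  let ψ := b.equiv (monomialBasis P c (he.basis s)) index
  suffices rightCombination (incl S hS c) _ = ψ.toLinearMap from this ▸ ψ.bijective
  refine b.ext fun ⟨r, r'⟩ => ?_
  have exponents : (fun j => (Fin.append (α := Fin p) r r' j : ℕ))
      = Fin.append (fun j => (r j : ℕ)) fun j => (r' j : ℕ) := by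
    ext j
    cases j using Fin.addCases <;> simp
  change _ = ψ (b ⟨r, r'⟩)
  rw [Module.Basis.equiv_apply, Pi.basis_apply, rightCombination_single,
    monomialBasis_apply, monomialBasis_apply, incl_monomial, ← monomial_append, he.basis_apply,
    ← exponents]
  rfl

end ReducedEnv

theorem CInd.eq_zero_of_sum_tmul_eq_zero {p : ℕ} [Fact p.Prime] {F L : Type*} [Field F] [CharP F p]
    [LieRing L] [LieAlgebra F L] [FiniteDimensional F L] {P : PMap p F L} {K : Type*} [Field K]
    [Algebra F K] {S : LieSubalgebra F L} {hS : ∀ s ∈ S, P.toFun s ∈ S} {c : L →ₗ[F] K}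
    {M : Type*} [AddCommGroup M] [Module K M] [LieRingModule (K ⊗[F] S) M]
    [LieModule K (K ⊗[F] S) M] {h : HasCharacter (P.restrict S hS) (resChar S c) M} {n : ℕ}
    {e : Fin n → L} (he : IsCobasis S e) {f : (Fin n → Fin p) → M}
    (hf : ∑ r, CInd.tmul P S hS c h (ReducedEnv.monomial P c e fun j => (r j : ℕ)) (f r) = 0) :
    f = 0 := by
  refine BalancedTensor.eq_zero_of_sum_tmul_eq_zero (ρ := ReducedEnv.act h)
    (ReducedEnv.rightCombination_monomial_bijective S hS c he) (Eq.trans ?_ hf)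
  exact map_sum (Submodule.mkQ _) _ _

/-! ### Characters and components -/

section CharSpace

variable {p : ℕ} [hp : Fact p.Prime] {F L : Type*} [Field F] [CharP F p] [LieRing L]
  [LieAlgebra F L] (P : PMap p F L) {K : Type*} [Field K] [Algebra F K]
  {M N : Type*} [AddCommGroup M] [Module K M] [LieRingModule (K ⊗[F] L) M]
  [LieModule K (K ⊗[F] L) M] [AddCommGroup N] [Module K N] [LieRingModule (K ⊗[F] L) N]
  [LieModule K (K ⊗[F] L) N]

attribute [local instance 100] LieRing.ofAssociativeRing in
theorem phi_add (x y : L) : phi P K M (x + y) = phi P K M x + phi P K M y := by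
  let _ : Algebra F (Module.End K M) := Algebra.compHom _ (algebraMap F K)
  have : IsScalarTower F K (Module.End K M) := .of_algebraMap_eq fun _ => rfl
  exact P.pow_sub_add (ReducedEnv.restrictTensor (LieModule.toEnd K (K ⊗[F] L) M)) x y

omit hp [CharP F p] in
theorem phi_smul (t : F) (x : L) :
    phi P K M (t • x) = algebraMap F K t ^ p • phi P K M x := by
  have one_tmul_smul (s : F) (y : L) : (1 : K) ⊗ₜ[F] (s • y) = algebraMap F K s • (1 ⊗ₜ y) := by
    rw [TensorProduct.tmul_smul, algebraMap_smul]
  rw [phi, P.smul, one_tmul_smul, one_tmul_smul, map_smul, map_smul, smul_pow, map_pow, ← smul_sub,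
    phi]

omit hp [CharP F p] in
theorem phi_map (f : M →ₗ⁅K,K ⊗[F] L⁆ N) (x : L) (m : M) :
    phi P K N x (f m) = f (phi P K M x m) := by
  have toEnd_comp (y : K ⊗[F] L) : LieModule.toEnd K (K ⊗[F] L) N y ∘ₗ (f : M →ₗ[K] N)
      = (f : M →ₗ[K] N) ∘ₗ LieModule.toEnd K (K ⊗[F] L) M y :=
    LinearMap.ext fun m => (f.map_lie y m).symm
  have toEnd_pow (y : K ⊗[F] L) (m : M) : (LieModule.toEnd K (K ⊗[F] L) N y ^ p) (f m)
      = f ((LieModule.toEnd K (K ⊗[F] L) M y ^ p) m) :=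
    LinearMap.congr_fun (Module.End.commute_pow_left_of_commute (toEnd_comp y) p) m
  simp only [phi, LinearMap.sub_apply, map_sub, toEnd_pow, LieModule.toEnd_apply_apply,
    LieModuleHom.map_lie]

theorem commute_phi_toEnd (x : L) (y : K ⊗[F] L) :
    Commute (phi P K M x) (LieModule.toEnd K (K ⊗[F] L) M y) :=
  LinearMap.ext (phi_lie P K x y)

theorem commute_phi (x y : L) : Commute (phi P K M x) (phi P K M y) :=
  ((commute_phi_toEnd P x _).pow_right p).sub_right (commute_phi_toEnd P x _)

/-- The largest submodule of `M` with character `c`: the vectors on which every `φ_x` acts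
by `c(x)^p`. -/
noncomputable def charSpace (c : L →ₗ[F] K) (M : Type*) [AddCommGroup M] [Module K M]
    [LieRingModule (K ⊗[F] L) M] [LieModule K (K ⊗[F] L) M] : LieSubmodule K (K ⊗[F] L) M where
  carrier := {m | ∀ x, phi P K M x m = c x ^ p • m}
  zero_mem' x := by simp
  add_mem' hm hn x := by rw [map_add, hm, hn, smul_add]
  smul_mem' t m hm x := by rw [map_smul, hm, smul_comm]
  lie_mem {y m} hm x := by rw [phi_lie, hm, lie_smul]

variable {P}

theorem map_charSpace_le (c : L →ₗ[F] K) (f : M →ₗ⁅K,K ⊗[F] L⁆ N) :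
    (charSpace P c M).map f ≤ charSpace P c N := by
  rw [LieSubmodule.map_le_iff_le_comap]
  intro m hm x
  refine (phi_map P f x m).trans ?_
  rw [hm x]
  exact map_smul (f : M →ₗ[K] N) _ m

theorem le_charSpace_iff {c : L →ₗ[F] K} {B : LieSubmodule K (K ⊗[F] L) M} :
    B ≤ charSpace P c M ↔ HasCharacter P c B := by
  refine ⟨fun h x b => Subtype.ext ?_, fun h b hb x => ?_⟩
  · exact (phi_map P B.incl x b).symm.trans (h b.2 x)
  · exact (phi_map P B.incl x ⟨b, hb⟩).trans (congrArg B.incl (h x ⟨b, hb⟩))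

omit hp [CharP F p] in
theorem HasCharacter.of_surjective {c : L →ₗ[F] K} (h : HasCharacter P c M)
    (f : M →ₗ⁅K,K ⊗[F] L⁆ N) (hf : Function.Surjective f) : HasCharacter P c N := by
  intro x n
  obtain ⟨m, rfl⟩ := hf n
  rw [phi_map, h]
  exact map_smul (f : M →ₗ[K] N) _ m

theorem charSpace_le_component (c : L →ₗ[F] K) : charSpace P c M ≤ component P c M := by
  refine fun m hm => ⟨1, fun x => ?_⟩
  rw [pow_one, LinearMap.sub_apply, hm x, Module.algebraMap_end_apply, sub_self]

end CharSpace

section Subquotient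

variable {p : ℕ} [hp : Fact p.Prime] {F L : Type*} [Field F] [CharP F p] [LieRing L]
  [LieAlgebra F L] (P : PMap p F L) {K : Type*} [Field K] [Algebra F K]
  {M N : Type*} [AddCommGroup M] [Module K M] [LieRingModule (K ⊗[F] L) M]
  [LieModule K (K ⊗[F] L) M] [AddCommGroup N] [Module K N] [LieRingModule (K ⊗[F] L) N]
  [LieModule K (K ⊗[F] L) N]

variable (M) in
/-- The representation on `M` of the free algebra on `L` in which `x ∈ L` acts by `φ_x`. -/
noncomputable def phiAction : FreeAlgebra K L →ₐ[K] Module.End K M :=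
  FreeAlgebra.lift K (phi P K M)

/-- The scalar by which `FreeAlgebra K L` acts, through `phiAction`, on a module with
character `c`. -/
noncomputable def charEval (p : ℕ) (c : L →ₗ[F] K) : FreeAlgebra K L →ₐ[K] K :=
  FreeAlgebra.lift K fun x => c x ^ p

variable {P}

omit hp [CharP F p] in
theorem HasCharacter.phiAction_apply {c : L →ₗ[F] K} (h : HasCharacter P c M)
    (a : FreeAlgebra K L) (m : M) : phiAction P M a m = charEval p c a • m := by
  have phiAction_eq : phiAction P M = (Algebra.ofId K (Module.End K M)).comp (charEval p c) := by
    ext x m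
    simp [phiAction, charEval, h x, Algebra.ofId_apply, -map_pow]
  rw [phiAction_eq]
  rfl

omit hp [CharP F p] in
theorem phiAction_map (f : M →ₗ⁅K,K ⊗[F] L⁆ N) (a : FreeAlgebra K L) (m : M) :
    phiAction P N a (f m) = f (phiAction P M a m) := by
  induction a using FreeAlgebra.induction generalizing m with
  | grade0 t =>
    rw [AlgHom.commutes, AlgHom.commutes]
    exact (map_smul (f : M →ₗ[K] N) t m).symm
  | grade1 x => simpa only [phiAction, FreeAlgebra.lift_ι_apply] using phi_map P f x m
  | mul a b ha hb => rw [map_mul, map_mul, Module.End.mul_apply, Module.End.mul_apply, hb, ha]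
  | add a b ha hb =>
    rw [map_add, map_add, LinearMap.add_apply, LinearMap.add_apply, ha, hb, map_add]

theorem exists_charEval_ne_zero_of_notMem (s : Finset (L →ₗ[F] K)) {c : L →ₗ[F] K} (hc : c ∉ s) :
    ∃ a, charEval p c a ≠ 0 ∧ ∀ d ∈ s, charEval p d a = 0 := by
  classical
  have : CharP K p := charP_of_injective_algebraMap (algebraMap F K).injective p
  induction s using Finset.induction_on with
  | empty => exact ⟨1, by simp⟩
  | insert d s _ ih =>
    obtain ⟨a, hca, hsa⟩ := ih fun h => hc (Finset.mem_insert_of_mem h)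
    have c_ne_d : c ≠ d := fun h => hc (h ▸ Finset.mem_insert_self c s)
    obtain ⟨x, hx⟩ := DFunLike.ne_iff.1 c_ne_d
    have charEval_sub (d' : L →ₗ[F] K) : charEval p d' (FreeAlgebra.ι K x -
        algebraMap K _ (d x ^ p)) = d' x ^ p - d x ^ p := by simp [charEval]
    refine ⟨(FreeAlgebra.ι K x - algebraMap K _ (d x ^ p)) * a, ?_, fun d' hd' => ?_⟩
    · rw [map_mul, charEval_sub]
      exact mul_ne_zero (sub_ne_zero.2 fun h => hx (frobenius_inj K p h)) hca
    · rw [map_mul, charEval_sub]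
      rcases Finset.mem_insert.1 hd' with rfl | hd'
      · rw [sub_self, zero_mul]
      · rw [hsa d' hd', mul_zero]

theorem mem_of_hasCharacter_subquotient {D : Set (L →ₗ[F] K)}
    (hD : ⨆ d : D, charSpace P d.1 M = ⊤) {A B : LieSubmodule K (K ⊗[F] L) M}
    [Nontrivial (B ⧸ A.comap B.incl)] {c : L →ₗ[F] K}
    (hc : HasCharacter P c (B ⧸ A.comap B.incl)) : c ∈ D := by
  classical
  let π := LieSubmodule.Quotient.mk' (A.comap B.incl)
  obtain ⟨q, hq⟩ := exists_ne (0 : B ⧸ A.comap B.incl)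
  obtain ⟨b, rfl⟩ : ∃ b, π b = q := LieSubmodule.Quotient.surjective_mk' _ q
  by_contra hcD
  obtain ⟨s, hs⟩ : ∃ s : Finset D, (b : M) ∈ ⨆ d ∈ s, (charSpace P d.1 M).toSubmodule := by
    refine Submodule.exists_finset_of_mem_iSup _ ?_
    rw [← LieSubmodule.iSup_toSubmodule, hD]
    trivial
  obtain ⟨a, hca, hsa⟩ : ∃ a, charEval p c a ≠ 0 ∧
      ∀ d ∈ s.map (Function.Embedding.subtype _), charEval p d a = 0 :=
    exists_charEval_ne_zero_of_notMem _ (by simp [hcD])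
  have phiAction_b : phiAction P M a b = 0 := by
    suffices ⨆ d ∈ s, (charSpace P d.1 M).toSubmodule ≤ LinearMap.ker (phiAction P M a) from this hs
    refine iSup₂_le fun d hd m hm => ?_
    have hchar := le_charSpace_iff.1 (le_refl (charSpace P d.1 M))
    rw [LinearMap.mem_ker]
    refine (phiAction_map (charSpace P d.1 M).incl a ⟨m, hm⟩).trans ?_
    rw [hchar.phiAction_apply, hsa d (Finset.mem_map_of_mem _ hd), zero_smul, map_zero]
  have phiAction_b' : phiAction P B a b = 0 :=
    Subtype.ext ((phiAction_map B.incl a b).symm.trans phiAction_b)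
  have smul_eq_zero' : charEval p c a • π b = 0 := by
    rw [← hc.phiAction_apply, phiAction_map, phiAction_b', map_zero]
  exact (smul_eq_zero.1 smul_eq_zero').elim hca hq

end Subquotient

section Irreducible

variable {R g M N : Type*} [CommRing R] [LieRing g] [AddCommGroup M] [Module R M]
  [LieRingModule g M] [AddCommGroup N] [Module R N] [LieRingModule g N]

theorem isIrreducible_of_surjective [LieModule.IsIrreducible R g M] [Nontrivial N]
    (f : M →ₗ⁅R,g⁆ N) (hf : Function.Surjective f) : LieModule.IsIrreducible R g N := by
  refine .mk fun T hT => ?_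
  have comap_ne_bot : T.comap f ≠ ⊥ := by
    refine fun h => hT ((LieSubmodule.eq_bot_iff T).2 fun n hn => ?_)
    obtain ⟨m, rfl⟩ := hf n
    rw [(LieSubmodule.eq_bot_iff _).1 h m hn, map_zero]
  have comap_eq_top := (eq_bot_or_eq_top (T.comap f)).resolve_left comap_ne_bot
  refine eq_top_iff.2 fun n _ => ?_
  obtain ⟨m, rfl⟩ := hf n
  exact (comap_eq_top ▸ trivial : m ∈ T.comap f)

theorem isIrreducible_of_isAtom {B : LieSubmodule R g M} (hB : IsAtom B) :
    LieModule.IsIrreducible R g B := by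
  have : Nontrivial B := (LieSubmodule.nontrivial_iff_ne_bot R g M).2 hB.1
  have map_incl_injective : Function.Injective (LieSubmodule.map B.incl) :=
    (LieSubmodule.mapOrderEmbedding (f := B.incl) Subtype.coe_injective).injective
  refine .mk fun T hT => map_incl_injective ?_
  rw [LieSubmodule.map_incl_top]
  refine (hB.le_iff.1 (LieSubmodule.map_incl_le)).resolve_left fun h => hT (map_incl_injective ?_)
  rw [h, LieSubmodule.map_bot]

end Irreducible

section Components

variable {p : ℕ} [hp : Fact p.Prime] {F L : Type*} [Field F] [CharP F p] [LieRing L]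
  [LieAlgebra F L] (P : PMap p F L) {K : Type*} [Field K] [Algebra F K]
  {M : Type*} [AddCommGroup M] [Module K M] [LieRingModule (K ⊗[F] L) M]
  [LieModule K (K ⊗[F] L) M] [FiniteDimensional K M]

theorem exists_phi_eq_smul [IsAlgClosed K] [LieModule.IsIrreducible K (K ⊗[F] L) M] (x : L) :
    ∃ t : K, ∀ m : M, phi P K M x m = t • m := by
  have : Nontrivial M := LieModule.nontrivial_of_isIrreducible K (K ⊗[F] L) M
  obtain ⟨t, ht⟩ := Module.End.exists_eigenvalue (phi P K M x)
  let E : LieSubmodule K (K ⊗[F] L) M :=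
    { (phi P K M x).eigenspace t with
      lie_mem := fun {y m} hm => Module.End.mem_eigenspace_iff.2 <| by
        rw [phi_lie, Module.End.mem_eigenspace_iff.1 hm, lie_smul] }
  have E_ne_bot : E ≠ ⊥ := fun h => ht ((LieSubmodule.toSubmodule_eq_bot E).2 h)
  have E_eq_top : E = ⊤ := (eq_bot_or_eq_top E).resolve_left E_ne_bot
  exact ⟨t, fun m => Module.End.mem_eigenspace_iff.1 (E_eq_top ▸ trivial : m ∈ E)⟩

variable (M) in
theorem exists_hasCharacter_of_isIrreducible [IsAlgClosed K]
    [LieModule.IsIrreducible K (K ⊗[F] L) M] : ∃ c : L →ₗ[F] K, HasCharacter P c M := by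
  have : CharP K p := charP_of_injective_algebraMap (algebraMap F K).injective p
  have : Nontrivial M := LieModule.nontrivial_of_isIrreducible K (K ⊗[F] L) M
  obtain ⟨m₀, hm₀⟩ := exists_ne (0 : M)
  choose χ hχ using exists_phi_eq_smul P (K := K) (M := M)
  have χ_eq {x : L} {t : K} (h : phi P K M x m₀ = t • m₀) : χ x = t :=
    smul_left_injective K hm₀ ((hχ x m₀).symm.trans h)
  let c : L →ₗ[F] K :=
    { toFun := fun x => (frobeniusEquiv K p).symm (χ x)
      map_add' := fun x y => by
        rw [← map_add]
        exact congrArg _ (χ_eq (by rw [phi_add, LinearMap.add_apply, hχ, hχ, add_smul]))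
      map_smul' := fun t x => by
        have χ_smul : χ (t • x) = algebraMap F K t ^ p * χ x :=
          χ_eq (by rw [phi_smul, LinearMap.smul_apply, hχ, smul_smul])
        rw [RingEquiv.symm_apply_eq, χ_smul, RingHom.id_apply, Algebra.smul_def, map_mul,
          RingEquiv.apply_symm_apply]
        rfl }
  refine ⟨c, fun x m => ?_⟩
  rw [hχ x m]
  exact congrArg (· • m) (frobeniusEquiv_symm_pow_p K p (χ x)).symm

theorem exists_isAtom_le_charSpace [IsAlgClosed K] {T : LieSubmodule K (K ⊗[F] L) M} (hT : T ≠ ⊥) :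
    ∃ (c : L →ₗ[F] K) (B : LieSubmodule K (K ⊗[F] L) M),
      IsAtom B ∧ B ≤ T ∧ B ≤ charSpace P c M := by
  obtain ⟨B, hB, hBT⟩ := (IsAtomic.eq_bot_or_exists_atom_le T).resolve_left hT
  have := isIrreducible_of_isAtom hB
  obtain ⟨c, hc⟩ := exists_hasCharacter_of_isIrreducible P (K := K) B
  exact ⟨c, B, hB, hBT, le_charSpace_iff.2 hc⟩

variable (M)

/-- The simultaneous generalized eigenspace of all `φ_x`, `x ∈ L`, for the eigenvalues `χ x`. -/
noncomputable def jointGenEigenspace (χ : L → K) : LieSubmodule K (K ⊗[F] L) M where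
  __ := ⨅ x, (phi P K M x).maxGenEigenspace (χ x)
  lie_mem {y m} hm := by
    change m ∈ ⨅ x, (phi P K M x).maxGenEigenspace (χ x) at hm
    change ⁅y, m⁆ ∈ ⨅ x, (phi P K M x).maxGenEigenspace (χ x)
    rw [Submodule.mem_iInf] at hm ⊢
    exact fun x =>
      Module.End.mapsTo_maxGenEigenspace_of_comm (commute_phi_toEnd P x y) (χ x) (hm x)

theorem component_eq_jointGenEigenspace (c : L →ₗ[F] K) :
    component P c M = jointGenEigenspace P M fun x => c x ^ p := by
  ext m
  refine Iff.trans ?_ (Module.End.mem_iInf_maxGenEigenspace_iff _ _ m).symm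
  simp only [← Algebra.algebraMap_eq_smul_one]
  refine ⟨fun ⟨r, hr⟩ x => ⟨r, hr x⟩, fun h => ⟨Module.finrank K M, fun x => ?_⟩⟩
  have hx : m ∈ (phi P K M x).maxGenEigenspace (c x ^ p) := by
    rw [Module.End.mem_maxGenEigenspace]
    simpa only [← Algebra.algebraMap_eq_smul_one] using h x
  rw [Module.End.maxGenEigenspace_eq_genEigenspace_finrank, Module.End.mem_genEigenspace_nat] at hx
  simpa only [← Algebra.algebraMap_eq_smul_one, LinearMap.mem_ker] using hx

omit [FiniteDimensional K M] in
theorem iSupIndep_jointGenEigenspace :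
    iSupIndep fun χ : L → K => (jointGenEigenspace P M χ).toSubmodule :=
  Module.End.independent_iInf_maxGenEigenspace_of_forall_mapsTo (phi P K M) fun x y =>
    Module.End.mapsTo_maxGenEigenspace_of_comm (commute_phi P y x)

theorem iSupIndep_component :
    iSupIndep fun c : L →ₗ[F] K => (component P c M).toSubmodule := by
  have : CharP K p := charP_of_injective_algebraMap (algebraMap F K).injective p
  simp only [component_eq_jointGenEigenspace]
  refine (iSupIndep_jointGenEigenspace P M).comp (f := fun c : L →ₗ[F] K => fun x => c x ^ p) ?_
  exact fun c d h => LinearMap.ext fun x => frobenius_inj K p (congrFun h x)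

theorem iSup_jointGenEigenspace_eq_top [IsAlgClosed K] :
    ⨆ χ : L → K, jointGenEigenspace P M χ = ⊤ := by
  rw [← LieSubmodule.iSup_toSubmodule_eq_top]
  exact Module.End.iSup_iInf_maxGenEigenspace_eq_top_of_forall_mapsTo (phi P K M)
    (fun x y => Module.End.mapsTo_maxGenEigenspace_of_comm (commute_phi P y x))
    fun x => Module.End.iSup_maxGenEigenspace_eq_top _

-- A nonzero joint eigenspace contains an irreducible module, whose character `c` determines `χ`.
theorem exists_jointGenEigenspace_eq_component [IsAlgClosed K] {χ : L → K}
    (hχ : jointGenEigenspace P M χ ≠ ⊥) :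
    ∃ c, charSpace P c M ≠ ⊥ ∧ jointGenEigenspace P M χ = component P c M := by
  obtain ⟨c, B, hB, hBχ, hBc⟩ := exists_isAtom_le_charSpace P hχ
  refine ⟨c, ne_bot_of_le_ne_bot hB.1 hBc, ?_⟩
  rw [component_eq_jointGenEigenspace]
  congr 1
  by_contra hne
  have hBc' : B ≤ jointGenEigenspace P M fun x => c x ^ p :=
    component_eq_jointGenEigenspace P M c ▸ hBc.trans (charSpace_le_component c)
  refine hB.1 ((LieSubmodule.toSubmodule_eq_bot B).1 (eq_bot_iff.2 ?_))
  exact ((iSupIndep_jointGenEigenspace P M).pairwiseDisjoint hne) hBχ hBc'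

theorem iSup_component_eq_top [IsAlgClosed K] :
    ⨆ c : {c : L →ₗ[F] K // charSpace P c M ≠ ⊥}, component P c.1 M = ⊤ := by
  rw [eq_top_iff, ← iSup_jointGenEigenspace_eq_top P M]
  refine iSup_le fun χ => ?_
  by_cases hχ : jointGenEigenspace P M χ = ⊥
  · rw [hχ]
    exact bot_le
  obtain ⟨c, hc, hχc⟩ := exists_jointGenEigenspace_eq_component P M hχ
  exact hχc ▸ le_iSup (fun c : {c : L →ₗ[F] K // charSpace P c M ≠ ⊥} => component P c.1 M) ⟨c, hc⟩

end Components

section ClusterComponents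

variable {p : ℕ} [hp : Fact p.Prime] {F L : Type*} [Field F] [CharP F p] [LieRing L]
  [LieAlgebra F L] {P : PMap p F L} {K : Type*} [Field K] [Algebra F K]
  {V : Type*} [AddCommGroup V] [Module F V] [LieRingModule L V] [LieModule F L V]

theorem cluster_subset {D : Set (L →ₗ[F] K)}
    (hD : ⨆ d : D, charSpace P d.1 (K ⊗[F] V) = ⊤) : cluster P K V ⊆ D := by
  rintro c ⟨A, B, -, hirr, hc⟩
  have := LieModule.nontrivial_of_isIrreducible K (K ⊗[F] L) (B ⧸ A.comap B.incl)
  exact mem_of_hasCharacter_subquotient hD hc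

theorem mem_cluster_of_charSpace_ne_bot [FiniteDimensional K (K ⊗[F] V)]
    {c : L →ₗ[F] K} (hc : charSpace P c (K ⊗[F] V) ≠ ⊥) : c ∈ cluster P K V := by
  obtain ⟨B, hB, hBc⟩ := (IsAtomic.eq_bot_or_exists_atom_le _).resolve_left hc
  have := isIrreducible_of_isAtom hB
  have comap_ne_top : (⊥ : LieSubmodule K (K ⊗[F] L) (K ⊗[F] V)).comap B.incl ≠ ⊤ := by
    rw [Ne, LieSubmodule.comap_incl_eq_top, le_bot_iff]
    exact hB.1
  have : Nontrivial (B ⧸ (⊥ : LieSubmodule K (K ⊗[F] L) (K ⊗[F] V)).comap B.incl) :=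
    Submodule.Quotient.nontrivial_iff.2 fun h =>
      comap_ne_top ((LieSubmodule.toSubmodule_eq_top _).1 h)
  have surjective_mk := LieSubmodule.Quotient.surjective_mk'
    ((⊥ : LieSubmodule K (K ⊗[F] L) (K ⊗[F] V)).comap B.incl)
  exact ⟨⊥, B, bot_le, isIrreducible_of_surjective _ surjective_mk,
    (le_charSpace_iff.1 hBc).of_surjective _ surjective_mk⟩

theorem iSup_component_cluster_eq_top [IsAlgClosed K] [FiniteDimensional K (K ⊗[F] V)] :
    ⨆ c : cluster P K V, component P c.1 (K ⊗[F] V) = ⊤ := by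
  rw [eq_top_iff, ← iSup_component_eq_top P]
  exact iSup_le fun c => le_iSup (fun c : cluster P K V => component P c.1 (K ⊗[F] V))
    ⟨c.1, mem_cluster_of_charSpace_ne_bot c.2⟩

theorem IsAmenable.charSpace_eq_component (hV : IsAmenable P K V) {c : L →ₗ[F] K}
    (hc : c ∈ cluster P K V) : charSpace P c (K ⊗[F] V) = component P c (K ⊗[F] V) :=
  le_antisymm (charSpace_le_component c) (le_charSpace_iff.2 (hV c hc))

theorem IsAmenable.component_ne_bot [IsAlgClosed K] [FiniteDimensional K (K ⊗[F] V)]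
    (hV : IsAmenable P K V) {c : L →ₗ[F] K} (hc : c ∈ cluster P K V) :
    component P c (K ⊗[F] V) ≠ ⊥ := by
  rw [← hV.charSpace_eq_component hc]
  refine cluster_subset (D := {d | charSpace P d (K ⊗[F] V) ≠ ⊥}) ?_ hc
  rw [eq_top_iff, ← iSup_component_eq_top P]
  refine iSup_le fun d => ?_
  rw [← hV.charSpace_eq_component (mem_cluster_of_charSpace_ne_bot d.2)]
  exact le_iSup (fun d : {d | charSpace P d (K ⊗[F] V) ≠ ⊥} => charSpace P d.1 (K ⊗[F] V)) d

end ClusterComponents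

/-! ### Galois descent -/

section Galois

variable {F K : Type*} [Field F] [Field K] [Algebra F K]

theorem mem_range_algebraMap_iff_forall_algEquiv [PerfectField F] [IsAlgClosure F K] {t : K} :
    t ∈ Set.range (algebraMap F K) ↔ ∀ α : K ≃ₐ[F] K, α t = t :=
  have : Algebra.IsAlgebraic F K := IsAlgClosure.isAlgebraic
  have : IsGalois F K := {}
  InfiniteGalois.mem_range_algebraMap_iff_fixed t

theorem rTensor_algEquiv_smul {W : Type*} [AddCommGroup W] [Module F W] (α : K ≃ₐ[F] K) (t : K)
    (w : K ⊗[F] W) :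
    LinearMap.rTensor W α.toLinearMap (t • w) = α t • LinearMap.rTensor W α.toLinearMap w := by
  induction w with
  | zero => simp
  | add v w hv hw => rw [smul_add, map_add, hv, hw, map_add, smul_add]
  | tmul s w => simp [TensorProduct.smul_tmul']

section BasisConj

variable {V κ : Type*} [AddCommGroup V] [Module K V] [Fintype κ]
  (B : Module.Basis κ K V) (α : K ≃ₐ[F] K)

theorem repr_basisConj (v : V) (i : κ) : B.repr (basisConj B α v) i = α (B.repr v i) := by
  rw [basisConj, B.repr_sum_self]

theorem basisConj_basis (i : κ) : basisConj B α (B i) = B i := by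
  classical
  refine B.ext_elem fun j => ?_
  rw [repr_basisConj, B.repr_self, Finsupp.single_apply, apply_ite α, map_one, map_zero]

/-- `basisConj` as a semilinear map. -/
noncomputable def basisConjₛₗ : V →ₛₗ[((α : K ≃+* K) : K →+* K)] V where
  toFun := basisConj B α
  map_add' v w := B.ext_elem fun i => by simp [repr_basisConj]
  map_smul' t v := B.ext_elem fun i => by simp [repr_basisConj]

theorem basisConj_map {V' κ' : Type*} [AddCommGroup V'] [Module K V'] [Fintype κ']
    (B' : Module.Basis κ' K V') {f : V →ₗ[K] V'} {j : κ → κ'} (hf : ∀ i, f (B i) = B' (j i))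
    (v : V) : basisConj B' α (f v) = f (basisConj B α v) := by
  suffices (basisConjₛₗ B' α).comp f = f.comp (basisConjₛₗ B α) from LinearMap.congr_fun this v
  refine B.ext fun i => ?_
  change basisConj B' α (f (B i)) = f (basisConj B α (B i))
  rw [basisConj_basis, hf, basisConj_basis]

theorem basisConj_baseChange {W : Type*} [AddCommGroup W] [Module F W] (b : Module.Basis κ F W)
    (t : K ⊗[F] W) : basisConj (b.baseChange K) α t = LinearMap.rTensor W α.toLinearMap t := by
  let rTensorₛₗ : K ⊗[F] W →ₛₗ[((α : K ≃+* K) : K →+* K)] K ⊗[F] W :=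
    { LinearMap.rTensor W α.toLinearMap with map_smul' := rTensor_algEquiv_smul α }
  suffices basisConjₛₗ (b.baseChange K) α = rTensorₛₗ from LinearMap.congr_fun this t
  refine (b.baseChange K).ext fun i => (basisConj_basis _ α i).trans ?_
  rw [Module.Basis.baseChange_apply]
  exact (congrArg (· ⊗ₜ[F] b i) (map_one α)).symm

variable [Module F V] [IsScalarTower F K V]

theorem mem_span_range_iff_basisConj [PerfectField F] [IsAlgClosure F K] {v : V} :
    v ∈ Submodule.span F (Set.range B) ↔ ∀ α : K ≃ₐ[F] K, basisConj B α v = v := by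
  simp only [B.mem_span_iff_repr_mem F, mem_range_algebraMap_iff_forall_algEquiv, B.ext_elem_iff,
    repr_basisConj]
  exact forall_comm

omit [Fintype κ] in
theorem isBaseChange_span_range : IsBaseChange K (Submodule.span F (Set.range B)).subtype := by
  let b := Module.Basis.span (B.linearIndependent.restrict_scalars' F)
  refine IsBaseChange.of_equiv ((b.baseChange K).equiv B (Equiv.refl κ)) fun v => ?_
  suffices (((b.baseChange K).equiv B (Equiv.refl κ)).toLinearMap.restrictScalars F ∘ₗ
      TensorProduct.mk F K _ 1) = (Submodule.span F (Set.range B)).subtype from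
    LinearMap.congr_fun this v
  refine b.ext fun i => ?_
  change (b.baseChange K).equiv B (Equiv.refl κ) (1 ⊗ₜ[F] b i) = (b i : V)
  rw [← Module.Basis.baseChange_apply, Module.Basis.equiv_apply, Module.Basis.span_apply,
    Equiv.refl_apply]

end BasisConj

theorem exists_eq_one_tmul_of_forall_rTensor_eq [PerfectField F] [IsAlgClosure F K] {W : Type*}
    [AddCommGroup W] [Module F W] [FiniteDimensional F W] {t : K ⊗[F] W}
    (ht : ∀ α : K ≃ₐ[F] K, LinearMap.rTensor W α.toLinearMap t = t) :
    ∃ w : W, (1 : K) ⊗ₜ[F] w = t := by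
  let b := Module.finBasis F W
  have mem_span : t ∈ Submodule.span F (Set.range (b.baseChange K)) :=
    (mem_span_range_iff_basisConj _).2 fun α => (basisConj_baseChange α b t).trans (ht α)
  suffices Submodule.span F (Set.range (b.baseChange K)) ≤
    LinearMap.range (TensorProduct.mk F K W 1) from this mem_span
  refine Submodule.span_le.2 ?_
  rintro _ ⟨i, rfl⟩
  exact ⟨b i, (Module.Basis.baseChange_apply K b i).symm⟩

end Galois

section GaloisComponents

variable {p : ℕ} {F L : Type*} [Field F] [LieRing L] [LieAlgebra F L] (P : PMap p F L)
  {K : Type*} [Field K] [Algebra F K]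

theorem IsSimpleCluster.conj_mem {C : Set (L →ₗ[F] K)} (hC : IsSimpleCluster C) (α : K ≃ₐ[F] K)
    {c : L →ₗ[F] K} (hc : c ∈ C) : conjChar α c ∈ C := by
  obtain ⟨c₀, rfl⟩ := hC
  obtain ⟨β, rfl⟩ := hc
  exact ⟨β.trans α, rfl⟩

variable {V : Type*} [AddCommGroup V] [Module F V] [LieRingModule L V] [LieModule F L V]

theorem phi_tensorProduct (x : L) : phi P K (K ⊗[F] V) x =
    (LieModule.toEnd F L V x ^ p - LieModule.toEnd F L V (P.toFun x)).baseChange K := by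
  rw [phi, LieModule.toEnd_baseChange, LieModule.toEnd_baseChange, LinearMap.baseChange_sub,
    LinearMap.baseChange_pow]

theorem rTensor_phi (α : K ≃ₐ[F] K) (x : L) (t : K ⊗[F] V) :
    LinearMap.rTensor V α.toLinearMap (phi P K (K ⊗[F] V) x t)
      = phi P K (K ⊗[F] V) x (LinearMap.rTensor V α.toLinearMap t) := by
  rw [phi_tensorProduct]
  exact LinearMap.congr_fun ((LinearMap.rTensor_comp_lTensor _ _ _).trans
    (LinearMap.lTensor_comp_rTensor _ _ _).symm) t

theorem rTensor_mem_component [Fact p.Prime] [CharP F p] (α : K ≃ₐ[F] K) {c : L →ₗ[F] K}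
    {t : K ⊗[F] V} (ht : t ∈ component P c (K ⊗[F] V)) :
    LinearMap.rTensor V α.toLinearMap t ∈ component P (conjChar α c) (K ⊗[F] V) := by
  obtain ⟨r, hr⟩ := ht
  refine ⟨r, fun x => ?_⟩
  have semiconj : Function.Semiconj (LinearMap.rTensor V α.toLinearMap)
      (phi P K (K ⊗[F] V) x - algebraMap K _ (c x ^ p) : Module.End K (K ⊗[F] V))
      (phi P K (K ⊗[F] V) x - algebraMap K _ (conjChar α c x ^ p) : Module.End K (K ⊗[F] V)) :=
    fun m => by
      rw [LinearMap.sub_apply, LinearMap.sub_apply, Module.algebraMap_end_apply,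
        Module.algebraMap_end_apply, map_sub, rTensor_phi, rTensor_algEquiv_smul, map_pow]
      rfl
  rw [Module.End.pow_apply, ← (semiconj.iterate_right r).eq, ← Module.End.pow_apply, hr, map_zero]

end GaloisComponents

section ComponentSum

variable {p : ℕ} [hp : Fact p.Prime] {F L : Type*} [Field F] [CharP F p] [LieRing L]
  [LieAlgebra F L] {P : PMap p F L} {S : LieSubalgebra F L} {hS : ∀ s ∈ S, P.toFun s ∈ S}
  {K : Type*} [Field K] [Algebra F K] {C : Set (L →ₗ[F] K)}
  {W : Type*} [AddCommGroup W] [Module F W] [LieRingModule S W] [LieModule F S W]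

theorem isComponentSum [IsAlgClosed K] [FiniteDimensional K (K ⊗[F] W)]
    (hCS : RestrictsSimply S C) (hC : cluster (P.restrict S hS) K W = resChar S '' C) :
    IsComponentSum P S hS C W := by
  classical
  have iSupIndep_wComp := (iSupIndep_component (P.restrict S hS) (K ⊗[F] W)).comp
    (f := fun c : C => resChar S c.1) fun c d h => Subtype.ext (hCS c.2 d.2 h)
  refine DirectSum.isInternal_submodule_of_iSupIndep_of_iSup_eq_top iSupIndep_wComp ?_
  rw [LieSubmodule.iSup_toSubmodule_eq_top, eq_top_iff, ← iSup_component_cluster_eq_top, hC]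
  refine iSup_le ?_
  rintro ⟨_, c, hc, rfl⟩
  exact le_iSup (fun c : C => wComp P S hS W c.1) ⟨c, hc⟩

open Classical in
/-- The decomposition of `K ⊗ W` into its components. -/
noncomputable def componentEquiv (hD : IsComponentSum P S hS C W) :
    (K ⊗[F] W) ≃ₗ[K] ⨁ c : C, wComp P S hS W c.1 :=
  (LinearEquiv.ofBijective
    (DirectSum.coeLinearMap fun c : C => (wComp P S hS W c.1).toSubmodule) hD).symm

variable (hD : IsComponentSum P S hS C W)

include hD in
theorem component_induction {motive : K ⊗[F] W → Prop}
    (mem : ∀ (c : C) (w : wComp P S hS W c.1), motive w) (zero : motive 0)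
    (add : ∀ v w, motive v → motive w → motive (v + w)) (t : K ⊗[F] W) : motive t := by
  classical
  let := hD.chooseDecomposition
  exact DirectSum.Decomposition.inductionOn (fun c : C => wComp P S hS W c.1) zero (mem _)
    (fun v w => add v w) t

open Classical in
theorem componentEquiv_coe (c : C) (w : wComp P S hS W c.1) :
    componentEquiv hD w = DirectSum.lof K C (fun c : C => wComp P S hS W c.1) c w := by
  rw [componentEquiv, LinearEquiv.symm_apply_eq]
  exact (DirectSum.coeLinearMap_lof (fun c : C => (wComp P S hS W c.1).toSubmodule) c w).symm

theorem componentEquiv_lie (y : K ⊗[F] S) (t : K ⊗[F] W) :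
    componentEquiv hD ⁅y, t⁆ = ⁅y, componentEquiv hD t⁆ := by
  classical
  induction t using component_induction hD with
  | mem c w =>
    rw [← LieSubmodule.coe_bracket, componentEquiv_coe, componentEquiv_coe]
    exact LieModuleHom.map_lie (DirectSum.lieModuleOf K C (K ⊗[F] S)
      (fun c : C => wComp P S hS W c.1) c) y w
  | zero => rw [lie_zero y, map_zero, lie_zero]
  | add v w hv hw => rw [lie_add y, map_add, hv, hw, map_add, lie_add]

/-- The operator on `K ⊗ W` that acts on the component `(K ⊗ W)_c` by `c(x)^p`. -/
noncomputable def charOp (x : L) : K ⊗[F] W →ₗ[K] K ⊗[F] W :=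
  (componentEquiv hD).symm.conj (DirectSum.lmap fun c : C => c.1 x ^ p • LinearMap.id)

theorem componentEquiv_charOp (x : L) (t : K ⊗[F] W) (c : C) :
    componentEquiv hD (charOp hD x t) c = c.1 x ^ p • componentEquiv hD t c := by
  rw [charOp, LinearEquiv.conj_apply_apply, LinearEquiv.apply_symm_apply]
  rfl

theorem charOp_of_mem (x : L) {c : C} {w : K ⊗[F] W} (hw : w ∈ wComp P S hS W c.1) :
    charOp hD x w = c.1 x ^ p • w := by
  classical
  lift w to wComp P S hS W c.1 using hw
  refine (componentEquiv hD).injective (DFinsupp.ext fun d => ?_)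
  refine (componentEquiv_charOp hD x w d).trans ?_
  rw [map_smul, componentEquiv_coe]
  change _ = c.1 x ^ p • DirectSum.lof K C (fun c : C => wComp P S hS W c.1) c w d
  obtain rfl | hcd := eq_or_ne d c
  · rfl
  · rw [DirectSum.lof_eq_of, DirectSum.of_eq_of_ne _ _ _ hcd, smul_zero, smul_zero]

variable (hCconj : ∀ (α : K ≃ₐ[F] K), ∀ c ∈ C, conjChar α c ∈ C)

include hCconj

theorem rTensor_charOp (α : K ≃ₐ[F] K) (x : L) (t : K ⊗[F] W) :
    LinearMap.rTensor W α.toLinearMap (charOp hD x t)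
      = charOp hD x (LinearMap.rTensor W α.toLinearMap t) := by
  induction t using component_induction hD with
  | mem c w =>
    have conj_mem : LinearMap.rTensor W α.toLinearMap w ∈ wComp P S hS W (conjChar α c.1) :=
      rTensor_mem_component (P.restrict S hS) α (c := resChar S c.1) w.2
    rw [charOp_of_mem hD x w.2, rTensor_algEquiv_smul,
      charOp_of_mem hD x (c := ⟨_, hCconj α c.1 c.2⟩) conj_mem, map_pow]
    rfl
  | zero => simp only [map_zero]
  | add v w hv hw => simp only [map_add, hv, hw]

theorem exists_charOp_one_tmul [PerfectField F] [IsAlgClosure F K] [FiniteDimensional F W] (x : L)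
    (w : W) : ∃ w' : W, (1 : K) ⊗ₜ[F] w' = charOp hD x ((1 : K) ⊗ₜ[F] w) :=
  exists_eq_one_tmul_of_forall_rTensor_eq fun α => by
    rw [rTensor_charOp hD hCconj, LinearMap.rTensor_tmul, AlgEquiv.toLinearMap_apply, map_one]

end ComponentSum

/-! ### Induced modules -/

section CInd

variable {p : ℕ} {F L : Type*} [Field F] [LieRing L] [LieAlgebra F L] {P : PMap p F L}
  {K : Type*} [Field K] [Algebra F K]
  {S : LieSubalgebra F L} {hS : ∀ s ∈ S, P.toFun s ∈ S} {c : L →ₗ[F] K}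
  {M : Type*} [AddCommGroup M] [Module K M] [LieRingModule (K ⊗[F] S) M]
  [LieModule K (K ⊗[F] S) M] {h : HasCharacter (P.restrict S hS) (resChar S c) M}

namespace CInd

theorem toEnd_eq_lsmul (y : K ⊗[F] L) : LieModule.toEnd K (K ⊗[F] L) (CInd P S hS c h) y =
    Algebra.lsmul K K (CInd P S hS c h) (ReducedEnv.ι P c y) := rfl

theorem hasCharacter : HasCharacter P c (CInd P S hS c h) := fun x v => by
  rw [phi, toEnd_eq_lsmul, toEnd_eq_lsmul, ← map_pow, ← map_sub, ReducedEnv.ι_pow,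
    add_sub_cancel_left]
  exact algebraMap_smul (ReducedEnv P c) (c x ^ p) v

theorem tmul_mul_incl (b : ReducedEnv P c) (a : ReducedEnv (P.restrict S hS) (resChar S c))
    (m : M) : tmul P S hS c h (b * ReducedEnv.incl S hS c a) m
      = tmul P S hS c h b (ReducedEnv.act h a m) :=
  (Submodule.Quotient.eq _).2 (Submodule.subset_span ⟨b, a, m, rfl⟩)

theorem one_tmul_lie (s : S) (m : M) :
    tmul P S hS c h 1 ⁅(1 : K) ⊗ₜ[F] s, m⁆ = ⁅(1 : K) ⊗ₜ[F] (s : L), tmul P S hS c h 1 m⁆ := by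
  have act_ι : ReducedEnv.act h (ReducedEnv.ι _ _ ((1 : K) ⊗ₜ[F] s)) m = ⁅(1 : K) ⊗ₜ[F] s, m⁆ :=
    LinearMap.congr_fun (ReducedEnv.lift_ι _ _ _) m
  have incl_ι : ReducedEnv.incl S hS c (ReducedEnv.ι _ _ ((1 : K) ⊗ₜ[F] s))
      = ReducedEnv.ι P c ((1 : K) ⊗ₜ[F] (s : L)) := ReducedEnv.lift_ι _ _ _
  rw [← act_ι, ← tmul_mul_incl, incl_ι, one_mul, ← mul_one (ReducedEnv.ι P c _)]
  rfl

theorem eq_top_of_one_tmul_mem {N : LieSubmodule K (K ⊗[F] L) (CInd P S hS c h)}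
    (hN : ∀ m, tmul P S hS c h 1 m ∈ N) : N = ⊤ := by
  have tmul_mem (a : ReducedEnv P c) (m : M) : tmul P S hS c h a m ∈ N := by
    let T : Submodule K (ReducedEnv P c) := N.toSubmodule.comap
      ((LinearMap.toSpanSingleton _ _ (tmul P S hS c h 1 m)).restrictScalars K)
    have mem_T (a : ReducedEnv P c) : a ∈ T ↔ tmul P S hS c h a m ∈ N := by
      conv_rhs => rw [← mul_one a]
      rfl
    have T_eq_top : T = ⊤ := ReducedEnv.eq_top_of_mul_mem T ((mem_T 1).2 (hN m)) fun x a ha =>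
      (mem_T _).2 (N.lie_mem (x := x) ((mem_T a).1 ha))
    exact (mem_T a).1 (T_eq_top ▸ Submodule.mem_top)
  refine eq_top_iff.2 fun v _ => ?_
  obtain ⟨t, rfl⟩ := Submodule.Quotient.mk_surjective _ v
  induction t with
  | zero => exact zero_mem N
  | add t u ht hu => exact add_mem (S := LieSubmodule _ _ _) (ht trivial) (hu trivial)
  | tmul a m => exact tmul_mem a m

end CInd

end CInd

section CIndSum

variable {p : ℕ} [hp : Fact p.Prime] {F L : Type*} [Field F] [CharP F p] [LieRing L]
  [LieAlgebra F L] {P : PMap p F L} {S : LieSubalgebra F L} {hS : ∀ s ∈ S, P.toFun s ∈ S}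
  {K : Type*} [Field K] [Algebra F K] {C : Set (L →ₗ[F] K)}
  {W : Type*} [AddCommGroup W] [Module F W] [LieRingModule S W] [LieModule F S W]
  {hW : IsAmenable (P.restrict S hS) K W} {hC : cluster (P.restrict S hS) K W = resChar S '' C}

namespace CIndSum

variable (P S hS C W hW hC) in
/-- The projection of the direct sum `CIndSum` onto its summand for `c`. -/
noncomputable def proj (c : C) :
    CIndSum P S hS C W hW hC →ₗ⁅K,K ⊗[F] L⁆ CInd P S hS c.1 (wComp_hasCharacter P S hS hW hC c) :=
  DirectSum.lieModuleComponent K C (K ⊗[F] L)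
    (fun c : C => CInd P S hS c.1 (wComp_hasCharacter P S hS hW hC c)) c

variable (P S hS C W hW hC) in
open Classical in
/-- The inclusion of the summand for `c` into the direct sum `CIndSum`. -/
noncomputable def lof (c : C) :
    CInd P S hS c.1 (wComp_hasCharacter P S hS hW hC c) →ₗ⁅K,K ⊗[F] L⁆ CIndSum P S hS C W hW hC :=
  DirectSum.lieModuleOf K C (K ⊗[F] L)
    (fun c : C => CInd P S hS c.1 (wComp_hasCharacter P S hS hW hC c)) c

theorem ext {v w : CIndSum P S hS C W hW hC}
    (h : ∀ c, proj P S hS C W hW hC c v = proj P S hS C W hW hC c w) : v = w :=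
  DFinsupp.ext h

theorem eq_top_of_comap_lof_eq_top {N : LieSubmodule K (K ⊗[F] L) (CIndSum P S hS C W hW hC)}
    (hN : ∀ c, N.comap (lof P S hS C W hW hC c) = ⊤) : N = ⊤ := by
  classical
  refine eq_top_iff.2 fun v _ => ?_
  refine DirectSum.induction_on (motive := (· ∈ N)) v (zero_mem N) (fun c v => ?_)
    fun _ _ => add_mem
  exact LieSubmodule.mem_comap.1 ((hN c).symm ▸ LieSubmodule.mem_top v)

theorem lof_mem_charSpace (c : C)
    (v : CInd P S hS c.1 (wComp_hasCharacter P S hS hW hC c)) :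
    lof P S hS C W hW hC c v ∈ charSpace P c.1 (CIndSum P S hS C W hW hC) := fun x =>
  (phi_map P _ x v).trans ((congrArg _ (CInd.hasCharacter x v)).trans (LinearMap.map_smul _ _ _))

theorem iSup_charSpace_eq_top : ⨆ c : C, charSpace P c.1 (CIndSum P S hS C W hW hC) = ⊤ :=
  eq_top_of_comap_lof_eq_top fun c => eq_top_iff.2 fun v _ =>
    le_iSup (fun c : C => charSpace P c.1 (CIndSum P S hS C W hW hC)) c (lof_mem_charSpace c v)

theorem proj_prod_map_toEnd {ι : Type*} (c : C) (e : ι → L) (l : List ι)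
    (v : CIndSum P S hS C W hW hC) :
    proj P S hS C W hW hC c ((l.map fun j => LieModule.toEnd F L _ (e j)).prod v)
      = (l.map fun j => ReducedEnv.ι P c.1 ((1 : K) ⊗ₜ[F] e j)).prod
        • proj P S hS C W hW hC c v := by
  induction l with
  | nil => exact (one_smul _ _).symm
  | cons j l ih =>
    rw [List.map_cons, List.prod_cons, List.map_cons, List.prod_cons, mul_smul, ← ih]
    exact LieModuleHom.map_lie _ _ _

end CIndSum

variable (P S hS C W hW hC) in
/-- The map `t ↦ e(r) ⊗ t` from `K ⊗ W` to `CIndSum`. -/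
noncomputable def monomialLin (hD : IsComponentSum P S hS C W) {n : ℕ} (e : Fin n → L)
    (r : Fin n → ℕ) : K ⊗[F] W →ₗ[K] CIndSum P S hS C W hW hC :=
  monomialTmulFamily P S hS hW hC e r ∘ₗ (componentEquiv hD).toLinearMap

variable (P S hS C W hW hC) in
/-- The map `t ↦ 1 ⊗ t` from `K ⊗ W` to `CIndSum`. -/
noncomputable def oneLin (hD : IsComponentSum P S hS C W) :
    K ⊗[F] W →ₗ[K] CIndSum P S hS C W hW hC :=
  monomialLin P S hS C W hW hC hD (Fin.elim0 : Fin 0 → L) Fin.elim0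

variable (hD : IsComponentSum P S hS C W)

theorem monomialTmul_eq_monomialLin {n : ℕ} (e : Fin n → L) (r : Fin n → ℕ) (t : K ⊗[F] W) :
    monomialTmul P S hS hW hC hD e r t = monomialLin P S hS C W hW hC hD e r t := by
  refine congrArg (monomialTmulFamily P S hS hW hC e r) ?_
  rw [AddEquiv.symm_apply_eq]
  exact ((componentEquiv hD).symm_apply_apply t).symm

theorem proj_monomialLin {n : ℕ} (e : Fin n → L) (r : Fin n → ℕ) (t : K ⊗[F] W) (c : C) :
    CIndSum.proj P S hS C W hW hC c (monomialLin P S hS C W hW hC hD e r t)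
      = CInd.tmul P S hS c.1 (wComp_hasCharacter P S hS hW hC c) (ReducedEnv.monomial P c.1 e r)
        (componentEquiv hD t c) :=
  DirectSum.lmap_apply (fun c : C => CInd.tmul P S hS c.1 (wComp_hasCharacter P S hS hW hC c)
    (List.ofFn fun j => ReducedEnv.ι P c.1 ((1 : K) ⊗ₜ[F] e j) ^ r j).prod) _ c

theorem proj_oneLin (t : K ⊗[F] W) (c : C) :
    CIndSum.proj P S hS C W hW hC c (oneLin P S hS C W hW hC hD t)
      = CInd.tmul P S hS c.1 (wComp_hasCharacter P S hS hW hC c) 1 (componentEquiv hD t c) := by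
  rw [oneLin, proj_monomialLin, ReducedEnv.monomial, List.ofFn_zero, List.prod_nil]

theorem lof_one_tmul (c : C) (w : wComp P S hS W c.1) :
    CIndSum.lof P S hS C W hW hC c (CInd.tmul P S hS c.1 (wComp_hasCharacter P S hS hW hC c) 1 w)
      = oneLin P S hS C W hW hC hD w := by
  classical
  rw [oneLin, monomialLin, LinearMap.comp_apply, LinearEquiv.coe_coe, componentEquiv_coe]
  exact (DirectSum.lmap_lof (fun c : C => CInd.tmul P S hS c.1
    (wComp_hasCharacter P S hS hW hC c) 1) c w).symm

theorem eq_top_of_oneLin_mem {N : LieSubmodule K (K ⊗[F] L) (CIndSum P S hS C W hW hC)}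
    (hN : ∀ t, oneLin P S hS C W hW hC hD t ∈ N) : N = ⊤ :=
  CIndSum.eq_top_of_comap_lof_eq_top fun c => CInd.eq_top_of_one_tmul_mem fun w => by
    rw [LieSubmodule.mem_comap, lof_one_tmul hD]
    exact hN w

theorem monomialLin_eq_prod {n : ℕ} (e : Fin n → L) (r : Fin n → ℕ) (t : K ⊗[F] W) :
    monomialLin P S hS C W hW hC hD e r t
      = (List.ofFn fun j => LieModule.toEnd F L (CIndSum P S hS C W hW hC) (e j) ^ r j).prod
        (oneLin P S hS C W hW hC hD t) := by
  refine CIndSum.ext fun c => ?_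
  rw [← prod_map_exponentWord (fun j => LieModule.toEnd F L _ (e j)),
    CIndSum.proj_prod_map_toEnd, proj_oneLin, proj_monomialLin, ReducedEnv.monomial,
    ← prod_map_exponentWord]
  conv_lhs => rw [← mul_one (List.prod _)]
  rfl

theorem oneLin_eq_monomialLin {n : ℕ} (e : Fin n → L) (t : K ⊗[F] W) :
    oneLin P S hS C W hW hC hD t = monomialLin P S hS C W hW hC hD e 0 t := by
  simp only [monomialLin_eq_prod, Pi.zero_apply, pow_zero, List.ofFn_const, List.prod_replicate,
    one_pow, Module.End.one_apply]

theorem lie_oneLin (s : S) (t : K ⊗[F] W) : ⁅(s : L), oneLin P S hS C W hW hC hD t⁆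
    = oneLin P S hS C W hW hC hD ⁅(1 : K) ⊗ₜ[F] s, t⁆ := by
  refine CIndSum.ext fun c => (LieModuleHom.map_lie _ ((1 : K) ⊗ₜ[F] (s : L)) _).trans ?_
  rw [proj_oneLin, proj_oneLin, componentEquiv_lie, ← CInd.one_tmul_lie]
  rfl

theorem toEnd_pow_sub_oneLin (x : L) (t : K ⊗[F] W) :
    (LieModule.toEnd F L (CIndSum P S hS C W hW hC) x ^ p) (oneLin P S hS C W hW hC hD t)
      - ⁅P.toFun x, oneLin P S hS C W hW hC hD t⁆
      = oneLin P S hS C W hW hC hD (charOp hD x t) := by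
  have eq_phi (v : CIndSum P S hS C W hW hC) : (LieModule.toEnd F L _ x ^ p) v - ⁅P.toFun x, v⁆
      = phi P K (CIndSum P S hS C W hW hC) x v := by
    rw [phi, LinearMap.sub_apply, Module.End.pow_apply, Module.End.pow_apply]
    rfl
  refine CIndSum.ext fun c => ?_
  rw [eq_phi, ← phi_map, CInd.hasCharacter, proj_oneLin, proj_oneLin, componentEquiv_charOp,
    map_smul]

end CIndSum

theorem prod_map_toEnd_apply_mem {k L M ι : Type*} [CommRing k] [LieRing L] [LieAlgebra k L]
    [AddCommGroup M] [Module k M] [LieRingModule L M] [LieModule k L M] {N : LieSubmodule k L M}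
    (e : ι → L) (l : List ι) {v : M} (hv : v ∈ N) :
    (l.map fun j => LieModule.toEnd k L M (e j)).prod v ∈ N := by
  induction l with
  | nil => exact hv
  | cons j l ih => exact N.lie_mem ih

theorem lie_mem_span_of_one_tmul_lie_mem {F K L M : Type*} [CommRing F] [CommRing K] [Algebra F K]
    [LieRing L] [LieAlgebra F L] [AddCommGroup M] [Module K M] [LieRingModule (K ⊗[F] L) M]
    [LieModule K (K ⊗[F] L) M] {V : Set M} (hV : ∀ (x : L), ∀ v ∈ V, ⁅(1 : K) ⊗ₜ[F] x, v⁆ ∈ V)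
    (y : K ⊗[F] L) {v : M} (hv : v ∈ Submodule.span K V) : ⁅y, v⁆ ∈ Submodule.span K V := by
  induction y with
  | zero => rw [zero_lie]; exact zero_mem _
  | add y z hy hz => rw [add_lie]; exact add_mem hy hz
  | tmul s x =>
    suffices Submodule.span K V ≤
      (Submodule.span K V).comap (LieModule.toEnd K (K ⊗[F] L) M (s ⊗ₜ[F] x)) from this hv
    refine Submodule.span_le.2 fun v hv => ?_
    change ⁅s ⊗ₜ[F] x, v⁆ ∈ Submodule.span K V
    rw [← mul_one s, ← smul_eq_mul, ← TensorProduct.smul_tmul', smul_lie]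
    exact Submodule.smul_mem _ s (Submodule.subset_span (hV x v hv))

section InducedModule

variable {p : ℕ} [hp : Fact p.Prime] {F L : Type*} [Field F] [CharP F p] [LieRing L]
  [LieAlgebra F L] {P : PMap p F L} {S : LieSubalgebra F L} {hS : ∀ s ∈ S, P.toFun s ∈ S}
  {K : Type*} [Field K] [Algebra F K] {C : Set (L →ₗ[F] K)}
  {W : Type*} [AddCommGroup W] [Module F W] [LieRingModule S W] [LieModule F S W]
  {hW : IsAmenable (P.restrict S hS) K W} {hC : cluster (P.restrict S hS) K W = resChar S '' C}

section

variable {n : ℕ} {e : Fin n → L} {hD : IsComponentSum P S hS C W}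

theorem eq_zero_of_sum_monomialLin_eq_zero [FiniteDimensional F L] (he : IsCobasis S e)
    {t : (Fin n → Fin p) → K ⊗[F] W}
    (ht : ∑ r, monomialLin P S hS C W hW hC hD e (fun j => (r j : ℕ)) (t r) = 0) : t = 0 := by
  funext r
  refine (componentEquiv hD).injective (DFinsupp.ext fun c => ?_)
  rw [Pi.zero_apply, map_zero]
  have proj_eq_zero := congrArg (CIndSum.proj P S hS C W hW hC c) ht
  rw [← LieModuleHom.coe_toLinearMap, map_sum, map_zero] at proj_eq_zero
  simp only [LieModuleHom.coe_toLinearMap, proj_monomialLin] at proj_eq_zero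
  exact congrFun (CInd.eq_zero_of_sum_tmul_eq_zero he proj_eq_zero) r

variable (hD) in
theorem oneLin_injective [FiniteDimensional F L] :
    Function.Injective (oneLin P S hS C W hW hC hD) := by
  obtain ⟨n, e, he⟩ := exists_isCobasis S
  refine (injective_iff_map_eq_zero _).2 fun t ht => ?_
  let r₀ : Fin n → Fin p := fun _ => ⟨0, hp.out.pos⟩
  refine Pi.single_eq_zero_iff.1 (eq_zero_of_sum_monomialLin_eq_zero (hW := hW) (hC := hC)
    (hD := hD) (t := Pi.single r₀ t) he ?_)
  rw [Finset.sum_eq_single_of_mem r₀ (Finset.mem_univ _) fun r _ hr => by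
    rw [Pi.single_eq_of_ne hr, map_zero], Pi.single_eq_same]
  exact (oneLin_eq_monomialLin hD e t).symm.trans ht

end

variable (P S hS C W hW hC) in
/-- The `F`-space of the elements `1 ⊗ w` with `w ∈ W`. -/
noncomputable def oneSpace (hD : IsComponentSum P S hS C W) :
    Submodule F (CIndSum P S hS C W hW hC) :=
  LinearMap.range ((oneLin P S hS C W hW hC hD).restrictScalars F ∘ₗ TensorProduct.mk F K W 1)

variable (P S hS C W hW hC) in
/-- The `C`-induced module `ind (W, C)`, defined without reference to a cobasis as the `L`-module
generated by the elements `1 ⊗ w` with `w ∈ W`. -/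
noncomputable def inducedModule (hD : IsComponentSum P S hS C W) :
    LieSubmodule F L (CIndSum P S hS C W hW hC) :=
  LieSubmodule.lieSpan F L (oneSpace P S hS C W hW hC hD)

variable {hD : IsComponentSum P S hS C W}

theorem lie_mem_oneSpace (s : S) {v : CIndSum P S hS C W hW hC}
    (hv : v ∈ oneSpace P S hS C W hW hC hD) : ⁅(s : L), v⁆ ∈ oneSpace P S hS C W hW hC hD := by
  obtain ⟨w, rfl⟩ := hv
  refine ⟨⁅s, w⁆, Eq.trans ?_ (lie_oneLin hD s ((1 : K) ⊗ₜ[F] w)).symm⟩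
  rw [LieAlgebra.ExtendScalars.bracket_tmul, one_mul]
  rfl

theorem span_inducedModule_eq_top :
    Submodule.span K (inducedModule P S hS C W hW hC hD : Set (CIndSum P S hS C W hW hC)) = ⊤ := by
  let Y : LieSubmodule K (K ⊗[F] L) (CIndSum P S hS C W hW hC) :=
    { Submodule.span K (inducedModule P S hS C W hW hC hD : Set (CIndSum P S hS C W hW hC)) with
      lie_mem := fun {y} {_} hv => lie_mem_span_of_one_tmul_lie_mem
        (fun x _ hv => (inducedModule P S hS C W hW hC hD).lie_mem (x := x) hv) y hv }
  suffices Y = ⊤ from congrArg LieSubmodule.toSubmodule this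
  refine eq_top_of_oneLin_mem hD fun t => ?_
  induction t with
  | zero => rw [map_zero]; exact zero_mem _
  | add t u ht hu => rw [map_add]; exact add_mem ht hu
  | tmul s w =>
    rw [← mul_one s, ← smul_eq_mul, ← TensorProduct.smul_tmul', map_smul]
    exact Submodule.smul_mem _ s (Submodule.subset_span (LieSubmodule.subset_lieSpan ⟨w, rfl⟩))

theorem monomialSpan_oneSpace_le_inducedModule {n : ℕ} (e : Fin n → L) :
    monomialSpan p (fun i => LieModule.toEnd F L _ (e i)) (oneSpace P S hS C W hW hC hD)
      ≤ inducedModule P S hS C W hW hC hD := by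
  refine Submodule.span_le.2 ?_
  rintro _ ⟨r, w, hw, rfl⟩
  rw [← prod_map_exponentWord]
  exact prod_map_toEnd_apply_mem e _ (LieSubmodule.subset_lieSpan hw)

section Monomials

variable {n : ℕ} {κ : Type*}

variable (P S hS C W hW hC) in
/-- The family of the elements `e(r) ⊗ bⁱ` with `r ∈ {0, …, p - 1}ⁿ`. -/
noncomputable def monomialFamily (hD : IsComponentSum P S hS C W) (e : Fin n → L) (b : κ → W)
    (q : (Fin n → Fin p) × κ) : CIndSum P S hS C W hW hC :=
  monomialLin P S hS C W hW hC hD e (fun j => (q.1 j : ℕ)) ((1 : K) ⊗ₜ[F] b q.2)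

theorem monomialSpan_oneSpace_eq_span (e : Fin n → L) (b : Module.Basis κ F W) :
    monomialSpan p (fun i => LieModule.toEnd F L _ (e i)) (oneSpace P S hS C W hW hC hD)
      = Submodule.span F (Set.range (monomialFamily P S hS C W hW hC hD e b)) := by
  refine le_antisymm (Submodule.span_le.2 ?_) (Submodule.span_le.2 ?_)
  · rintro _ ⟨r, _, ⟨w, rfl⟩, rfl⟩
    let f : W →ₗ[F] CIndSum P S hS C W hW hC :=
      (monomialLin P S hS C W hW hC hD e fun j => (r j : ℕ)).restrictScalars F ∘ₗ
        TensorProduct.mk F K W 1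
    have mem_span_of_basis : Submodule.span F (Set.range b) ≤ (Submodule.span F
        (Set.range (monomialFamily P S hS C W hW hC hD e b))).comap f := by
      refine Submodule.span_le.2 ?_
      rintro _ ⟨i, rfl⟩
      exact Submodule.subset_span ⟨(r, i), rfl⟩
    have f_apply : f w = _ := monomialLin_eq_prod hD e (fun j => (r j : ℕ)) ((1 : K) ⊗ₜ[F] w)
    exact f_apply ▸ mem_span_of_basis (b.mem_span w)
  · rintro _ ⟨⟨r, i⟩, rfl⟩
    exact Submodule.subset_span ⟨r, _, ⟨b i, rfl⟩,
      monomialLin_eq_prod hD e (fun j => (r j : ℕ)) ((1 : K) ⊗ₜ[F] b i)⟩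

theorem linearIndependent_monomialFamily [FiniteDimensional F L] {e : Fin n → L}
    (he : IsCobasis S e) [Finite κ] (b : Module.Basis κ F W) :
    LinearIndependent K (monomialFamily P S hS C W hW hC hD e b) := by
  have := Fintype.ofFinite κ
  refine Fintype.linearIndependent_iff.2 fun g hg ⟨r, i⟩ => ?_
  have rows_eq_zero : (fun r => ∑ i, g (r, i) • (1 : K) ⊗ₜ[F] b i) = 0 := by
    refine eq_zero_of_sum_monomialLin_eq_zero (hW := hW) (hC := hC) (hD := hD) he ?_
    simpa only [map_sum, map_smul, Fintype.sum_prod_type, monomialFamily] using hg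
  refine Fintype.linearIndependent_iff.1 (b.baseChange K).linearIndependent (fun i => g (r, i)) ?_ i
  simpa only [Module.Basis.baseChange_apply, Pi.zero_apply] using congrFun rows_eq_zero r

end Monomials

section Conjugation

variable [PerfectField F] [IsAlgClosure F K] [FiniteDimensional F W] {n : ℕ} {e : Fin n → L}
  (hCconj : ∀ (α : K ≃ₐ[F] K), ∀ c ∈ C, conjChar α c ∈ C)

include hCconj

theorem toEnd_pow_sub_mem_oneSpace (x : L) {v : CIndSum P S hS C W hW hC}
    (hv : v ∈ oneSpace P S hS C W hW hC hD) :
    (LieModule.toEnd F L _ x ^ p) v - ⁅P.toFun x, v⁆ ∈ oneSpace P S hS C W hW hC hD := by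
  obtain ⟨w, rfl⟩ := hv
  obtain ⟨w', hw'⟩ := exists_charOp_one_tmul hD hCconj x w
  refine ⟨w', (congrArg _ hw').trans (toEnd_pow_sub_oneLin hD x _).symm⟩

attribute [local instance 100] LieRing.ofAssociativeRing in
theorem lie_mem_monomialSpan_oneSpace (he : IsCobasis S e) (x : L) {v : CIndSum P S hS C W hW hC}
    (hv : v ∈ monomialSpan p (fun i => LieModule.toEnd F L _ (e i))
      (oneSpace P S hS C W hW hC hD)) :
    ⁅x, v⁆ ∈ monomialSpan p (fun i => LieModule.toEnd F L _ (e i))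
      (oneSpace P S hS C W hW hC hD) :=
  lie_apply_mem_monomialSpan (LieModule.toEnd F L (CIndSum P S hS C W hW hC)).toLinearMap
    (fun a b => (LieHom.map_lie _ a b).trans (LieRing.of_associative_ring_bracket _ _))
    e S.toSubmodule (by rw [sup_comm, he.2.sup_eq_top])
    (fun s hs _ hw => lie_mem_oneSpace ⟨s, hs⟩ hw)
    (fun i _ hw => ⟨P.toFun (e i), toEnd_pow_sub_mem_oneSpace hCconj (e i) hw⟩) x hv

theorem inducedModule_eq_monomialSpan (he : IsCobasis S e) :
    (inducedModule P S hS C W hW hC hD : Submodule F (CIndSum P S hS C W hW hC))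
      = monomialSpan p (fun i => LieModule.toEnd F L _ (e i))
        (oneSpace P S hS C W hW hC hD) := by
  refine le_antisymm ?_ (monomialSpan_oneSpace_le_inducedModule e)
  let N : LieSubmodule F L (CIndSum P S hS C W hW hC) :=
    { monomialSpan p (fun i => LieModule.toEnd F L _ (e i)) (oneSpace P S hS C W hW hC hD) with
      lie_mem := lie_mem_monomialSpan_oneSpace hCconj he _ }
  exact LieSubmodule.lieSpan_le (N := N).2 le_monomialSpan

theorem inducedModule_eq_span {κ : Type*} (he : IsCobasis S e) (b : Module.Basis κ F W) :
    (inducedModule P S hS C W hW hC hD : Submodule F (CIndSum P S hS C W hW hC))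
      = Submodule.span F (Set.range (monomialFamily P S hS C W hW hC hD e b)) := by
  rw [inducedModule_eq_monomialSpan hCconj he, monomialSpan_oneSpace_eq_span e b]

theorem span_monomialFamily_eq_top {κ : Type*} (he : IsCobasis S e) (b : Module.Basis κ F W) :
    Submodule.span K (Set.range (monomialFamily P S hS C W hW hC hD e b)) = ⊤ := by
  rw [← Submodule.span_span_of_tower F K, ← inducedModule_eq_span hCconj he b]
  exact span_inducedModule_eq_top

omit hCconj in
variable (P S hS W hW hC hD) in
/-- The basis of `CIndSum` which consists of the elements `e(r) ⊗ bⁱ`. -/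
noncomputable def inducedBasis [FiniteDimensional F L] {κ : Type*} [Finite κ]
    (hCconj : ∀ (α : K ≃ₐ[F] K), ∀ c ∈ C, conjChar α c ∈ C) (he : IsCobasis S e)
    (b : Module.Basis κ F W) :
    Module.Basis ((Fin n → Fin p) × κ) K (CIndSum P S hS C W hW hC) :=
  Module.Basis.mk (linearIndependent_monomialFamily (hW := hW) (hC := hC) (hD := hD) he b)
    (span_monomialFamily_eq_top hCconj he b).ge

variable [FiniteDimensional F L] {κ : Type*} (he : IsCobasis S e) (b : Module.Basis κ F W)

theorem coe_inducedBasis [Finite κ] : ⇑(inducedBasis P S hS W hW hC hD hCconj he b) =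
    monomialFamily P S hS C W hW hC hD e b :=
  Module.Basis.coe_mk _ _

theorem inducedModule_eq_span_inducedBasis [Finite κ] :
    (inducedModule P S hS C W hW hC hD : Submodule F (CIndSum P S hS C W hW hC))
      = Submodule.span F (Set.range (inducedBasis P S hS W hW hC hD hCconj he b)) := by
  rw [coe_inducedBasis, inducedModule_eq_span hCconj he b]

theorem mem_inducedModule_iff_basisConj [Fintype κ] {v : CIndSum P S hS C W hW hC} :
    v ∈ inducedModule P S hS C W hW hC hD ↔
      ∀ α : K ≃ₐ[F] K, basisConj (inducedBasis P S hS W hW hC hD hCconj he b) α v = v := by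
  rw [← mem_span_range_iff_basisConj, ← inducedModule_eq_span_inducedBasis,
    LieSubmodule.mem_toSubmodule]

theorem basisConj_monomialLin [Fintype κ] (α : K ≃ₐ[F] K) (r : Fin n → Fin p) (t : K ⊗[F] W) :
    basisConj (inducedBasis P S hS W hW hC hD hCconj he b) α
        (monomialLin P S hS C W hW hC hD e (fun j => (r j : ℕ)) t)
      = monomialLin P S hS C W hW hC hD e (fun j => (r j : ℕ))
        (LinearMap.rTensor W α.toLinearMap t) := by
  rw [← basisConj_baseChange α b]
  refine basisConj_map (b.baseChange K) α _ (j := fun i => (r, i)) (fun i => ?_) t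
  rw [coe_inducedBasis, Module.Basis.baseChange_apply, monomialFamily]

theorem isBaseChange_inducedModule :
    IsBaseChange K (inducedModule P S hS C W hW hC hD :
      Submodule F (CIndSum P S hS C W hW hC)).subtype := by
  obtain ⟨n, e, he⟩ := exists_isCobasis S
  rw [inducedModule_eq_span_inducedBasis hCconj he (Module.finBasis F W)]
  exact isBaseChange_span_range _

theorem finiteDimensional_cIndSum (hD : IsComponentSum P S hS C W) :
    FiniteDimensional K (CIndSum P S hS C W hW hC) := by
  obtain ⟨n, e, he⟩ := exists_isCobasis S
  exact .of_basis (inducedBasis P S hS W hW hC hD hCconj he (Module.finBasis F W))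

end Conjugation

end InducedModule

/-! ### The cluster of a form -/

section Form

variable {F K L V M : Type*} [CommRing F] [CommRing K] [Algebra F K] [LieRing L] [LieAlgebra F L]
  [AddCommGroup V] [Module F V] [LieRingModule L V] [LieModule F L V]
  [AddCommGroup M] [Module K M] [Module F M] [IsScalarTower F K M] [LieRingModule (K ⊗[F] L) M]
  [LieModule K (K ⊗[F] L) M]
  {f : V →ₗ[F] M} (hf : IsBaseChange K f) (hlie : ∀ (x : L) v, f ⁅x, v⁆ = ⁅(1 : K) ⊗ₜ[F] x, f v⁆)

include hlie in
theorem baseChange_equiv_lie (y : K ⊗[F] L) (t : K ⊗[F] V) :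
    hf.equiv ⁅y, t⁆ = ⁅y, hf.equiv t⁆ := by
  induction t with
  | zero => rw [lie_zero y, map_zero, lie_zero]
  | add t u ht hu => rw [lie_add y, map_add, ht, hu, map_add, lie_add]
  | tmul s v =>
    induction y with
    | zero => rw [zero_lie, zero_lie (s ⊗ₜ[F] v), map_zero]
    | add y z hy hz => rw [add_lie, add_lie y z (s ⊗ₜ[F] v), map_add, hy, hz]
    | tmul t x =>
      rw [LieAlgebra.ExtendScalars.bracket_tmul, hf.equiv_tmul, hf.equiv_tmul, hlie, lie_smul,
        ← mul_one t, ← smul_eq_mul (a := t), ← TensorProduct.smul_tmul', smul_lie, smul_smul,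
        smul_eq_mul, mul_one, mul_comm]

/-- If the `L`-module `V` is a form of the module `M` over `K ⊗ L`, then `M` is isomorphic to
`K ⊗ V`. -/
noncomputable def formEquiv : M ≃ₗ⁅K,K ⊗[F] L⁆ K ⊗[F] V :=
  { hf.equiv.symm with
    map_lie' := fun {y m} => hf.equiv.symm_apply_eq.2 <| by
      rw [baseChange_equiv_lie hf hlie]
      exact congrArg _ (hf.equiv.apply_symm_apply m).symm }

end Form

section Cluster

variable {p : ℕ} [hp : Fact p.Prime] {F L : Type*} [Field F] [CharP F p] [LieRing L]
  [LieAlgebra F L] {P : PMap p F L} {K : Type*} [Field K] [Algebra F K] {C : Set (L →ₗ[F] K)}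

theorem cluster_eq_of_equiv {M V : Type*} [AddCommGroup M] [Module K M]
    [LieRingModule (K ⊗[F] L) M] [LieModule K (K ⊗[F] L) M] [FiniteDimensional K M]
    [AddCommGroup V] [Module F V] [LieRingModule L V] [LieModule F L V]
    (φ : M ≃ₗ⁅K,K ⊗[F] L⁆ K ⊗[F] V) (hM : ⨆ c : C, charSpace P c.1 M = ⊤)
    (hC : ∀ c ∈ C, charSpace P c M ≠ ⊥) : cluster P K V = C := by
  have : FiniteDimensional K (K ⊗[F] V) := Module.Finite.equiv φ.toLinearEquiv
  refine subset_antisymm (cluster_subset ?_) fun c hc => mem_cluster_of_charSpace_ne_bot ?_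
  · have map_top : (⊤ : LieSubmodule K (K ⊗[F] L) M).map φ.toLieModuleHom = ⊤ :=
      (LieModuleHom.map_top _).trans ((LieModuleHom.range_eq_top _).2 φ.surjective)
    rw [eq_top_iff, ← map_top, ← hM, LieSubmodule.map_iSup]
    exact iSup_mono fun c => map_charSpace_le c.1 φ.toLieModuleHom
  · refine ne_bot_of_le_ne_bot (fun map_eq_bot => hC c hc ?_) (map_charSpace_le c φ.toLieModuleHom)
    refine (LieSubmodule.eq_bot_iff _).2 fun m hm => φ.injective ?_
    exact ((LieSubmodule.eq_bot_iff _).1 map_eq_bot _ (LieSubmodule.mem_map_of_mem hm)).trans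
      (map_zero φ.toLinearEquiv).symm

variable {S : LieSubalgebra F L} {hS : ∀ s ∈ S, P.toFun s ∈ S}
  {W : Type*} [AddCommGroup W] [Module F W] [LieRingModule S W] [LieModule F S W]
  {hW : IsAmenable (P.restrict S hS) K W} {hC : cluster (P.restrict S hS) K W = resChar S '' C}

theorem CIndSum.charSpace_ne_bot [IsAlgClosed K] [FiniteDimensional F L] [FiniteDimensional F W]
    (hD : IsComponentSum P S hS C W) {c : L →ₗ[F] K} (hc : c ∈ C) :
    charSpace P c (CIndSum P S hS C W hW hC) ≠ ⊥ := by
  have component_ne_bot : wComp P S hS W c ≠ ⊥ :=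
    hW.component_ne_bot (hC ▸ Set.mem_image_of_mem _ hc)
  obtain ⟨w, hw, w_ne_zero⟩ := (Submodule.ne_bot_iff _).1
    ((LieSubmodule.toSubmodule_eq_bot _).not.2 component_ne_bot)
  refine fun h => w_ne_zero (oneLin_injective (hW := hW) (hC := hC) hD ?_)
  refine ((LieSubmodule.eq_bot_iff _).1 h _ ?_).trans (map_zero _).symm
  rw [← lof_one_tmul hD ⟨c, hc⟩ ⟨w, hw⟩]
  exact lof_mem_charSpace ⟨c, hc⟩ _

end Cluster

theorem lemma6p4_general {p : ℕ} [Fact p.Prime]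
    {F : Type*} [Field F] [CharP F p] [PerfectField F]
    {K : Type*} [Field K] [Algebra F K] [IsAlgClosure F K]
    {L : Type*} [LieRing L] [LieAlgebra F L] [FiniteDimensional F L] (P : PMap p F L)
    (S : LieSubalgebra F L) (hS : ∀ s ∈ S, P.toFun s ∈ S)
    (C : Set (L →ₗ[F] K)) (hCconj : ∀ (α : K ≃ₐ[F] K), ∀ c ∈ C, conjChar α c ∈ C)
    (hCS : RestrictsSimply S C)
    (W : Type*) [AddCommGroup W] [Module F W] [LieRingModule S W] [LieModule F S W]
    [FiniteDimensional F W]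
    (hW : IsAmenable (P.restrict S hS) K W)
    (hC : cluster (P.restrict S hS) K W = resChar S '' C) :
    ∃ hD : IsComponentSum P S hS C W,
    ∃ V : LieSubmodule F L (CIndSum P S hS C W hW hC),
      (∀ (n m : ℕ) (e : Fin n → L) (_ : IsCobasis S e) (b : Module.Basis (Fin m) F W),
        ∃ B : Module.Basis ((Fin n → Fin p) × Fin m) K (CIndSum P S hS C W hW hC),
          (∀ (r : Fin n → Fin p) (i : Fin m),
            B (r, i) = monomialTmul P S hS hW hC hD e (fun j => (r j : ℕ)) ((1 : K) ⊗ₜ[F] b i)) ∧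
          (∀ (α : K ≃ₐ[F] K) (r : Fin n → Fin p) (t : K ⊗[F] W),
            basisConj B α (monomialTmul P S hS hW hC hD e (fun j => (r j : ℕ)) t)
              = monomialTmul P S hS hW hC hD e (fun j => (r j : ℕ))
                  (LinearMap.rTensor W α.toLinearMap t)) ∧
          (∀ v : CIndSum P S hS C W hW hC,
            v ∈ V ↔ ∀ α : K ≃ₐ[F] K, basisConj B α v = v) ∧
          (V : Submodule F (CIndSum P S hS C W hW hC)) = Submodule.span F (Set.range B)) ∧
      IsBaseChange K (V : Submodule F (CIndSum P S hS C W hW hC)).subtype ∧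
      cluster P K V = C := by
  have : IsAlgClosed K := IsAlgClosure.isAlgClosed F
  have hD : IsComponentSum P S hS C W := isComponentSum hCS hC
  have hV : IsBaseChange K (inducedModule P S hS C W hW hC hD :
      Submodule F (CIndSum P S hS C W hW hC)).subtype := isBaseChange_inducedModule hCconj
  refine ⟨hD, inducedModule P S hS C W hW hC hD, fun n m e he b => ?_, hV, ?_⟩
  · simp only [monomialTmul_eq_monomialLin]
    refine ⟨inducedBasis P S hS W hW hC hD hCconj he b, fun r i => ?_,
      basisConj_monomialLin hCconj he b, fun v => mem_inducedModule_iff_basisConj hCconj he b,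
      inducedModule_eq_span_inducedBasis hCconj he b⟩
    rw [coe_inducedBasis, monomialFamily]
  · have := finiteDimensional_cIndSum (hW := hW) (hC := hC) hCconj hD
    exact cluster_eq_of_equiv (formEquiv hV fun _ _ => rfl) CIndSum.iSup_charSpace_eq_top
      fun c hc => CIndSum.charSpace_ne_bot hD hc

theorem lemma6p4 {p : ℕ} [Fact p.Prime]
    {F : Type*} [Field F] [CharP F p] [PerfectField F]
    {K : Type*} [Field K] [Algebra F K] [IsAlgClosure F K]
    {L : Type*} [LieRing L] [LieAlgebra F L] [FiniteDimensional F L] (P : PMap p F L)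
    (S : LieSubalgebra F L) (hS : ∀ s ∈ S, P.toFun s ∈ S)
    (C : Set (L →ₗ[F] K)) (hCsimple : IsSimpleCluster C) (hCS : RestrictsSimply S C)
    (W : Type*) [AddCommGroup W] [Module F W] [LieRingModule S W] [LieModule F S W]
    [FiniteDimensional F W]
    (hW : IsAmenable (P.restrict S hS) K W)
    (hC : cluster (P.restrict S hS) K W = resChar S '' C) :
    ∃ hD : IsComponentSum P S hS C W,
    ∃ V : LieSubmodule F L (CIndSum P S hS C W hW hC),
      (∀ (n m : ℕ) (e : Fin n → L) (_ : IsCobasis S e) (b : Module.Basis (Fin m) F W),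
        ∃ B : Module.Basis ((Fin n → Fin p) × Fin m) K (CIndSum P S hS C W hW hC),
          (∀ (r : Fin n → Fin p) (i : Fin m),
            B (r, i) = monomialTmul P S hS hW hC hD e (fun j => (r j : ℕ)) ((1 : K) ⊗ₜ[F] b i)) ∧
          (∀ (α : K ≃ₐ[F] K) (r : Fin n → Fin p) (t : K ⊗[F] W),
            basisConj B α (monomialTmul P S hS hW hC hD e (fun j => (r j : ℕ)) t)
              = monomialTmul P S hS hW hC hD e (fun j => (r j : ℕ))
                  (LinearMap.rTensor W α.toLinearMap t)) ∧
          (∀ v : CIndSum P S hS C W hW hC,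
            v ∈ V ↔ ∀ α : K ≃ₐ[F] K, basisConj B α v = v) ∧
          (V : Submodule F (CIndSum P S hS C W hW hC)) = Submodule.span F (Set.range B)) ∧
      IsBaseChange K (V : Submodule F (CIndSum P S hS C W hW hC)).subtype ∧
      cluster P K V = C :=
  lemma6p4_general P S hS C (fun α _ hc => hCsimple.conj_mem α hc) hCS W hW hC
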